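/- **Setting.** Fix an intensity $\lambda>0$, a speed $v>0$, a scale $x_m>0$ and an index $\alpha\in(1,2)$. Targets are located at the points $p_i=(p_{i,1},p_{i,2})$ of a homogeneous Poisson point process of intensity $\lambda$ on $\mathbb R^2$, and the target at $p_i$ carries a reward $r(p_i)$; the rewards are i.i.d., independent of the locations, and Pareto distributed, $\mathbb P(r\le x)=1-(x_m/x)^{\alpha}$ for $x\ge x_m$ and $\mathbb P(r\le x)=0$ for $x<x_m$. A robot moves according to $\dot x_1(t)=v$, $\dot x_2(t)=u(t)$ with a measurable control $|u(t)|\le v$ (unit agility). For $L>0$ let $T^*(L)$ be the maximal total reward of the targets visited by a trajectory that starts at the origin and travels the longitudinal distance $L$ (all targets being known), and let $R^*(L)=T^*(L)/L$. The receding-horizon algorithm with sensing distance $S>0$ starts at the origin. In each iteration the robot, in its current state $x$, senses the targets $p_i$ with $0\le p_{i,1}-x_1\le S$, almost surely chooses, among the trajectories from $x$ of longitudinal length $S$, one which maximizes the total reward of the visited targets, and executes it to its end. Ties are broken by any measurable rule that uses only the locations and rewards of the targets sensed so far. Iterations are carried out as long as the longitudinal distance travelled is less than $L$, so there are $\lceil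 L/S\rceil$ of them. With $T_i$ the reward collected in the $i$-th iteration, let $R_{\mathrm{iterative}}(L;S)=\frac1L\sum_{i=1}^{\lceil L/S\rceil}T_i$. **Theorem.** There is a probability space on which such a target field is defined. Moreover there is a constant $c>0$ (depending only on $\lambda$, $v$, $x_m$, $\alpha$) such that, on every probability space on which such a field is defined, for every function $S:(0,\infty)\to(0,\infty)$ with $\lim_{L\to\infty}S(L)/L=0$ and all executions of the algorithm with sensing distances $S(L)$, the random variables $R^*(L)$ and $R_{\mathrm{iterative}}(L;S(L))$ have finite expectation for every $L>0$, and $$\lim_{L\to\infty}\frac{\mathbb E[R^*(L)]-\mathbb E[R_{\mathrm{iterative}}(L;S(L))]}{L^{2/\alpha-1}}=c .$$ -/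

import Mathlib

open MeasureTheory ProbabilityTheory Filter Topology Set
open scoped ENNReal NNReal

namespace MaxReward

noncomputable section

/-! ### The target field -/

/-- The number of indices whose location lies in `B`. -/
def count {Ω : Type*} (p : ℕ → Ω → ℝ × ℝ) (B : Set (ℝ × ℝ)) (ω : Ω) : ℕ∞ :=
  {i | p i ω ∈ B}.encard

/-- The number of targets with location in `B` and reward in `U`. -/
def markedCount {Ω : Type*} (p : ℕ → Ω → ℝ × ℝ) (r : ℕ → Ω → ℝ≥0)
    (B : Set (ℝ × ℝ)) (U : Set ℝ≥0) (ω : Ω) : ℕ∞ :=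
  {i | p i ω ∈ B ∧ r i ω ∈ U}.encard

/-- The random locations `p 0, p 1, …` (in some measurable enumeration) form a homogeneous Poisson
point process on the plane with intensity `lam`: numbers of points in sets of finite area are
Poisson distributed, and they are independent for disjoint sets. -/
structure IsPoissonProcess {Ω : Type*} [MeasurableSpace Ω] (P : Measure Ω) (lam : ℝ≥0)
    (p : ℕ → Ω → ℝ × ℝ) : Prop where
  measurable : ∀ i, Measurable (p i)
  law : ∀ B : Set (ℝ × ℝ), MeasurableSet B → volume B ≠ ∞ → ∀ n : ℕ,
    P {ω | count p B ω = n} = poissonMeasure (lam * (volume B).toNNReal) {n}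
  indep : ∀ (k : ℕ) (B : Fin k → Set (ℝ × ℝ)), (∀ j, MeasurableSet (B j)) →
    (∀ j, volume (B j) ≠ ∞) → Pairwise (fun i j => Disjoint (B i) (B j)) →
    iIndepFun (fun j => count p (B j)) P

/-- Targets at the points of a Poisson process of intensity `lam`; the rewards are independent of
the locations and are i.i.d. with the Pareto distribution of scale `xm` and index `α`. -/
structure IsParetoField {Ω : Type*} [MeasurableSpace Ω] (P : Measure Ω) (lam : ℝ≥0) (xm α : ℝ)
    (p : ℕ → Ω → ℝ × ℝ) (r : ℕ → Ω → ℝ≥0) : Prop where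
  poisson : IsPoissonProcess P lam p
  measurable : ∀ i, Measurable (r i)
  law : ∀ i, P.map (fun ω => (r i ω : ℝ)) = paretoMeasure xm α
  iIndep : iIndepFun r P
  indep : IndepFun (fun ω i => p i ω) (fun ω i => r i ω) P

/-! ### Dynamics and rewards -/

/-- `x` is, on the time interval `[0, τ]`, a trajectory started at `z` of the robot of unit agility
with longitudinal speed `v`: `x₁' = v`, `x₂' = u`, `|u| ≤ v`. -/
def IsFeasible (v τ : ℝ) (z : ℝ × ℝ) (x : ℝ → ℝ × ℝ) : Prop :=
  ∃ u : ℝ → ℝ, Measurable u ∧ (∀ t ∈ Icc 0 τ, |u t| ≤ v) ∧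
    ∀ t ∈ Icc 0 τ, x t = (z.1 + v * t, z.2 + ∫ s in (0 : ℝ)..t, u s)

/-- Total reward of the targets visited by `x` during `[0, τ]`, for one realization of the field
with locations `q` and rewards `m`. -/
def collected (q : ℕ → ℝ × ℝ) (m : ℕ → ℝ≥0) (τ : ℝ) (x : ℝ → ℝ × ℝ) : ℝ≥0∞ :=
  ∑' i : {i : ℕ // q i ∈ x '' Icc 0 τ}, (m i : ℝ≥0∞)

/-- The optimal total reward over trajectories from the origin of longitudinal length `L`
(that is, of duration `L / v`), all targets being known. -/
def optimalTotal (q : ℕ → ℝ × ℝ) (m : ℕ → ℝ≥0) (v L : ℝ) : ℝ≥0∞ :=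
  ⨆ (x : ℝ → ℝ × ℝ) (_ : IsFeasible v (L / v) (0, 0) x), collected q m (L / v) x

/-- The optimal mean reward `R*(L) = T*(L) / L`. -/
def optimalMean {Ω : Type*} (p : ℕ → Ω → ℝ × ℝ) (r : ℕ → Ω → ℝ≥0) (v L : ℝ) (ω : Ω) : ℝ≥0∞ :=
  optimalTotal (fun i => p i ω) (fun i => r i ω) v L / ENNReal.ofReal L

/-! ### The receding-horizon algorithm -/

/-- The information revealed by the targets (locations and rewards) with longitudinal coordinate
in `[0, a]`. -/
@[reducible] def sensed {Ω : Type*} (p : ℕ → Ω → ℝ × ℝ) (r : ℕ → Ω → ℝ≥0) (a : ℝ) : MeasurableSpace Ω :=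
  MeasurableSpace.generateFrom
    {A | ∃ (B : Set (ℝ × ℝ)) (U : Set ℝ≥0) (n : ℕ∞), MeasurableSet B ∧
      (∀ q ∈ B, 0 ≤ q.1 ∧ q.1 ≤ a) ∧ MeasurableSet U ∧ A = {ω | markedCount p r B U ω = n}}

/-- The state of the robot at the beginning of each iteration (iterations counted from `0`), when
`X k` is the trajectory executed in iteration `k`, with its own clock running over `[0, S / v]`. -/
def startState {Ω : Type*} (v S : ℝ) (X : ℕ → Ω → ℝ → ℝ × ℝ) (ω : Ω) : ℕ → ℝ × ℝ
  | 0 => (0, 0)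
  | k + 1 => X k ω (S / v)

/-- `X` is an execution of the receding-horizon algorithm with sensing distance `S`: starting at
the origin, in every iteration the robot senses the targets up to longitudinal distance `S` ahead,
picks a trajectory of longitudinal length `S` from its current state with maximal reward, and
executes it to the end. Ties between optimal trajectories may be broken in any way that uses only
the targets sensed so far, which for iteration `k` are those up to coordinate `(k + 1) * S`. -/
structure IsRecedingHorizon {Ω : Type*} [MeasurableSpace Ω] (P : Measure Ω)
    (p : ℕ → Ω → ℝ × ℝ) (r : ℕ → Ω → ℝ≥0) (v S : ℝ) (X : ℕ → Ω → ℝ → ℝ × ℝ) : Prop where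
  feasible : ∀ k ω, IsFeasible v (S / v) (startState v S X ω k) (X k ω)
  optimal : ∀ᵐ ω ∂P, ∀ k x, IsFeasible v (S / v) (startState v S X ω k) x →
    collected (fun i => p i ω) (fun i => r i ω) (S / v) x ≤
      collected (fun i => p i ω) (fun i => r i ω) (S / v) (X k ω)
  adapted : ∀ k : ℕ, ∀ t ∈ Icc 0 (S / v),
    Measurable[sensed p r (((k : ℝ) + 1) * S)] (fun ω => X k ω t)

/-- The mean reward of an execution with sensing distance `S` for the mission length `L`: iterations
are carried out as long as the longitudinal distance travelled so far is less than `L`, which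
makes `⌈L / S⌉` iterations. -/
def iterativeMean {Ω : Type*} (p : ℕ → Ω → ℝ × ℝ) (r : ℕ → Ω → ℝ≥0) (v S : ℝ)
    (X : ℕ → Ω → ℝ → ℝ × ℝ) (L : ℝ) (ω : Ω) : ℝ≥0∞ :=
  (∑ k ∈ Finset.range ⌈L / S⌉₊, collected (fun i => p i ω) (fun i => r i ω) (S / v) (X k ω)) /
    ENNReal.ofReal L

end

end MaxReward

/-! Write `G(L)` for the expected optimal total over the longitudinal distance `L`, and `β = 2 / α >
1`. The theorem comes down to `G(L) / L ^ β → c > 0`, together with the fact that an algorithm with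
`S = o(L)` collects only `o(L ^ β)` in expectation.

Convergence follows from monotonicity and boundedness. Contracting the plane by `c ≤ 1` multiplies
the intensity by `c ^ (-2)`; discarding the rewards `u` with `c ^ β * u < xm` and multiplying the
others by `c ^ β` compensates this exactly, because Pareto tails are self-similar. Hence `G(c L) ≤ c
^ β G(L)` (`IsParetoField.lintegral_best_scale`), and `G(L) / L ^ β` is monotone.

The bound `G(L) = O(L ^ β)` (`IsParetoField.exists_lintegral_best_le`) splits rewards dyadically.
Those above `L ^ β` have a total of expectation `O(L ^ β)` even over the whole reachable box. For
rewards of order `L ^ β / 2 ^ j`, every trajectory lies in one of `3 ^ n` tubes of area at most `3 L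
^ 2 / n`. With `n` of order `2 ^ (α j / 2)`, the mean count in a tube and the logarithm of the
number of tubes have the same order, so the largest count in a tube has expectation `O(2 ^ (α j /
2))`. The resulting series in `j` converges because `α < 2`.

The start of an iteration depends only on targets sensed before, which are independent of those
ahead. Rounding its lateral position to a grid and starting a distance `S` earlier bounds the
expected reward of an iteration by `G(2 S)` (`IsParetoField.lintegral_collected_le`). The total is
thus at most `⌈L / S⌉ G(2 S) = O((L / S + 1) S ^ β) = o(L ^ β)`.

Trajectories are first replaced by finite causal sets of targets (`optimalTotal_eq_best`). The
expectation of the optimum is then a limit of expectations of functions of finitely many cell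
totals, so it is determined by the Laplace functional of the field (`lintegral_best_eq_of_laplace`).
Independence, invariance, scaling and the agreement of all target fields all become identities
between Laplace functionals. -/

namespace MaxReward

/-! ### The negative exponential on `ℝ≥0∞` -/

/-- The function `exp (-x)` on `[0, ∞]`. -/
noncomputable def nexp (x : ℝ≥0∞) : ℝ≥0∞ := EReal.exp (-(x : EReal))

/-- The inverse of `nexp` on `[0, 1]`. -/
noncomputable def nlog (y : ℝ≥0∞) : ℝ≥0∞ := (-(ENNReal.log y)).toENNReal

@[simp] lemma nexp_zero : nexp 0 = 1 := by simp [nexp]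

@[simp] lemma nexp_top : nexp ∞ = 0 := by simp [nexp]

lemma nexp_coe (x : ℝ≥0) : nexp x = ENNReal.ofReal (Real.exp (-(x : ℝ))) := by
  rw [nexp, ← EReal.exp_coe]
  rfl

lemma nexp_ofReal {x : ℝ} (hx : 0 ≤ x) : nexp (ENNReal.ofReal x) = ENNReal.ofReal (Real.exp (-x)) := by
  rw [ENNReal.ofReal, nexp_coe, Real.coe_toNNReal x hx]

lemma nexp_add (x y : ℝ≥0∞) : nexp (x + y) = nexp x * nexp y := by
  rw [nexp, nexp, nexp, ← EReal.exp_add, EReal.coe_ennreal_add, EReal.neg_add]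
  · rfl
  · simp
  · simp

lemma nexp_strictAnti : StrictAnti nexp := by
  intro x y h
  rw [nexp, nexp, EReal.exp_lt_exp_iff, EReal.neg_lt_neg_iff]
  exact_mod_cast h

lemma nexp_antitone : Antitone nexp := nexp_strictAnti.antitone

lemma nexp_injective : Function.Injective nexp := nexp_strictAnti.injective

lemma nexp_le_one (x : ℝ≥0∞) : nexp x ≤ 1 := by
  simpa using nexp_antitone (zero_le (a := x))

lemma nexp_ne_top (x : ℝ≥0∞) : nexp x ≠ ∞ := ((nexp_le_one x).trans_lt ENNReal.one_lt_top).ne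

lemma continuous_nexp : Continuous nexp :=
  ENNReal.continuous_exp.comp (continuous_neg.comp continuous_coe_ennreal_ereal)

@[fun_prop]
lemma measurable_nexp : Measurable nexp := continuous_nexp.measurable

lemma nexp_nlog {y : ℝ≥0∞} (hy : y ≤ 1) : nexp (nlog y) = y := by
  have h : 0 ≤ -(ENNReal.log y) := by
    rw [EReal.neg_nonneg]
    simpa using ENNReal.log_le_log_iff.2 hy
  rw [nexp, nlog, EReal.coe_toENNReal h, neg_neg, ENNReal.exp_log]

lemma nlog_nexp (x : ℝ≥0∞) : nlog (nexp x) = x := nexp_injective (nexp_nlog (nexp_le_one x))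

@[fun_prop]
lemma measurable_nlog : Measurable nlog :=
  measurable_ereal_toENNReal.comp ENNReal.measurable_log.neg

lemma nexp_sum {ι : Type*} (s : Finset ι) (f : ι → ℝ≥0∞) :
    nexp (∑ i ∈ s, f i) = ∏ i ∈ s, nexp (f i) := by
  classical
  induction s using Finset.induction_on with
  | empty => simp
  | insert a s ha ih => rw [Finset.sum_insert ha, Finset.prod_insert ha, nexp_add, ih]

lemma nexp_natCast_mul (n : ℕ) (x : ℝ≥0∞) : nexp (n * x) = nexp x ^ n := by
  induction n with
  | zero => simp
  | succ n ih => rw [Nat.cast_succ, add_mul, one_mul, nexp_add, ih, pow_succ]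

lemma lintegral_nexp_le_one {Ω : Type*} [MeasurableSpace Ω] (P : Measure Ω) [IsProbabilityMeasure P]
    (f : Ω → ℝ≥0∞) : ∫⁻ ω, nexp (f ω) ∂P ≤ 1 :=
  (lintegral_mono fun ω => nexp_le_one (f ω)).trans (by simp)

/-- Since `nexp` is continuous on `[0, ∞]` and bounded by one, dominated convergence needs no
integrability of the `f i`, and infinite values are harmless. -/
lemma tendsto_lintegral_nexp {Ω ι : Type*} [MeasurableSpace Ω] (P : Measure Ω)
    [IsProbabilityMeasure P] {l : Filter ι} [l.IsCountablyGenerated] {f : ι → Ω → ℝ≥0∞}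
    {g : Ω → ℝ≥0∞} (hf : ∀ i, Measurable (f i))
    (h : ∀ᵐ ω ∂P, Tendsto (fun i => f i ω) l (𝓝 (g ω))) :
    Tendsto (fun i => ∫⁻ ω, nexp (f i ω) ∂P) l (𝓝 (∫⁻ ω, nexp (g ω) ∂P)) := by
  refine tendsto_lintegral_filter_of_dominated_convergence (fun _ => 1)
    (Eventually.of_forall fun i => measurable_nexp.comp (hf i))
    (Eventually.of_forall fun i => Eventually.of_forall fun ω => nexp_le_one _) (by simp) ?_
  filter_upwards [h] with ω hω
  exact (continuous_nexp.tendsto _).comp hω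

/-- The Laplace transform of a sum of independent random variables. -/
lemma lintegral_nexp_tsum_of_iIndepFun {Ω ι : Type*} [MeasurableSpace Ω] [Countable ι]
    {P : Measure Ω} [IsProbabilityMeasure P] {X : ι → Ω → ℝ≥0∞} (hX : iIndepFun X P)
    (hm : ∀ i, Measurable (X i)) :
    ∫⁻ ω, nexp (∑' i, X i ω) ∂P = nexp (∑' i, nlog (∫⁻ ω, nexp (X i ω) ∂P)) := by
  have h1 : Tendsto (fun s : Finset ι => ∫⁻ ω, nexp (∑ i ∈ s, X i ω) ∂P) atTop
      (𝓝 (∫⁻ ω, nexp (∑' i, X i ω) ∂P)) :=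
    tendsto_lintegral_nexp P (fun s => Finset.measurable_fun_sum s fun i _ => hm i)
      (Eventually.of_forall fun ω => ENNReal.summable.hasSum)
  have h2 : Tendsto (fun s : Finset ι => nexp (∑ i ∈ s, nlog (∫⁻ ω, nexp (X i ω) ∂P))) atTop
      (𝓝 (nexp (∑' i, nlog (∫⁻ ω, nexp (X i ω) ∂P)))) :=
    (continuous_nexp.tendsto _).comp ENNReal.summable.hasSum
  refine tendsto_nhds_unique h1 (h2.congr fun s => ?_)
  simp_rw [nexp_sum]
  rw [lintegral_prod_eq_prod_lintegral_of_indepFun s (fun i ω => nexp (X i ω))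
    (hX.comp (fun _ => nexp) fun _ => measurable_nexp) fun i => measurable_nexp.comp (hm i)]
  exact Finset.prod_congr rfl fun i _ => nexp_nlog (lintegral_nexp_le_one P _)

/-! ### Measures on `[0, ∞]ᴶ` are determined by their Laplace transforms -/

section LaplaceUniqueness

open BoundedContinuousFunction

variable {J : Type*} [Fintype J]

/-- The function `exp (-∑ t j * x j)` as a bounded continuous function of `x`. -/
noncomputable def expFun (t : J → ℕ) : (J → ℝ≥0∞) →ᵇ ℝ :=
  BoundedContinuousFunction.ofNormedAddCommGroup
    (fun x => ∏ j, (nexp (x j)).toReal ^ t j)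
    (by
      refine continuous_finsetProd _ fun j _ => Continuous.pow ?_ _
      exact ENNReal.continuousOn_toReal.comp_continuous
        (continuous_nexp.comp (continuous_apply j)) fun x => nexp_ne_top _) 1
    (by
      intro x
      rw [Real.norm_of_nonneg (by positivity)]
      refine Finset.prod_le_one (fun j _ => by positivity) fun j _ => ?_
      refine pow_le_one₀ ENNReal.toReal_nonneg ?_
      exact ENNReal.toReal_le_of_le_ofReal zero_le_one (by simpa using nexp_le_one _))

lemma expFun_apply (t : J → ℕ) (x : J → ℝ≥0∞) :
    expFun t x = ∏ j, (nexp (x j)).toReal ^ t j := rfl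

lemma expFun_apply_eq_toReal (t : J → ℕ) (x : J → ℝ≥0∞) :
    expFun t x = (nexp (∑ j, t j * x j)).toReal := by
  rw [expFun_apply, nexp_sum, ENNReal.toReal_prod]
  refine Finset.prod_congr rfl fun j _ => ?_
  rw [nexp_natCast_mul, ENNReal.toReal_pow]

/-- The functions `expFun t` form a submonoid. -/
noncomputable def expSubmonoid (J : Type*) [Fintype J] : Submonoid ((J → ℝ≥0∞) →ᵇ ℝ) where
  carrier := Set.range expFun
  one_mem' := ⟨0, by ext x; simp [expFun_apply]⟩
  mul_mem' := by
    rintro _ _ ⟨s, rfl⟩ ⟨t, rfl⟩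
    refine ⟨s + t, ?_⟩
    ext x
    simp [expFun_apply, pow_add, Finset.prod_mul_distrib]

/-- Products of exponentials are exponentials, so their linear span is an algebra of bounded
continuous functions. It separates points because `nexp` is injective, and such an algebra
determines finite measures on a Polish space. Integer exponents are enough for this. -/
theorem measure_ext_of_lintegral_nexp {μ ν : Measure (J → ℝ≥0∞)} [IsFiniteMeasure μ]
    [IsFiniteMeasure ν]
    (h : ∀ t : J → ℕ, ∫⁻ x, nexp (∑ j, t j * x j) ∂μ = ∫⁻ x, nexp (∑ j, t j * x j) ∂ν) :
    μ = ν := by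
  classical
  let A : StarSubalgebra ℝ ((J → ℝ≥0∞) →ᵇ ℝ) :=
    { Algebra.adjoin ℝ (expSubmonoid J : Set ((J → ℝ≥0∞) →ᵇ ℝ)) with
      star_mem' := fun {a} ha => by
        have : star a = a := by ext x; simp
        rw [this]
        exact ha }
  have hA : ∀ g, g ∈ A ↔ g ∈ Submodule.span ℝ (expSubmonoid J : Set ((J → ℝ≥0∞) →ᵇ ℝ)) := by
    intro g
    have h1 : g ∈ A ↔ g ∈ Subalgebra.toSubmodule
      (Algebra.adjoin ℝ (expSubmonoid J : Set ((J → ℝ≥0∞) →ᵇ ℝ))) := Iff.rfl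
    rw [h1, Algebra.adjoin_eq_span, Submonoid.closure_eq]
  refine ext_of_forall_mem_subalgebra_integral_eq_of_polish (A := A) ?_ ?_
  · intro x y hxy
    obtain ⟨j, hj⟩ := Function.ne_iff.1 hxy
    refine ⟨_, ⟨_, ⟨expFun (Pi.single j 1), ?_, rfl⟩, rfl⟩, ?_⟩
    · exact Algebra.subset_adjoin ⟨_, rfl⟩
    · intro he
      have he' : expFun (Pi.single j 1) x = expFun (Pi.single j 1) y := he
      rw [expFun_apply_eq_toReal, expFun_apply_eq_toReal,
        ENNReal.toReal_eq_toReal_iff' (nexp_ne_top _) (nexp_ne_top _)] at he'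
      have := nexp_injective he'
      simp [Pi.single_apply, Finset.sum_ite_eq'] at this
      exact hj this
  · intro g hg
    rw [hA] at hg
    induction hg using Submodule.span_induction with
    | mem g hg =>
      obtain ⟨t, rfl⟩ := hg
      have key : ∀ κ : Measure (J → ℝ≥0∞), ∫ x, expFun t x ∂κ
          = (∫⁻ x, nexp (∑ j, t j * x j) ∂κ).toReal := by
        intro κ
        simp_rw [expFun_apply_eq_toReal]
        refine integral_toReal ?_ ?_
        · refine Measurable.aemeasurable ?_
          fun_prop
        · exact Eventually.of_forall fun x => (nexp_ne_top _).lt_top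
      rw [key, key, h t]
    | zero => simp
    | add f g _ _ hf hg =>
      simp only [BoundedContinuousFunction.coe_add, Pi.add_apply]
      rw [integral_add (f.integrable _) (g.integrable _),
        integral_add (f.integrable _) (g.integrable _), hf, hg]
    | smul c f _ hf =>
      simp only [BoundedContinuousFunction.coe_smul, smul_eq_mul]
      rw [integral_const_mul, integral_const_mul, hf]

end LaplaceUniqueness

/-! ### Poisson random variables -/

lemma lintegral_poissonMeasure (a : ℝ≥0) (f : ℕ → ℝ≥0∞) :
    ∫⁻ n, f n ∂(poissonMeasure a)
      = ∑' n : ℕ, ENNReal.ofReal (Real.exp (-a) * a ^ n / n.factorial) * f n := by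
  rw [poissonMeasure, lintegral_sum_measure]
  refine tsum_congr fun n => ?_
  rw [lintegral_smul_measure, lintegral_dirac, smul_eq_mul]

lemma lintegral_pow_poissonMeasure (a : ℝ≥0) {c : ℝ} (hc : 0 ≤ c) :
    ∫⁻ n, ENNReal.ofReal c ^ n ∂(poissonMeasure a) = ENNReal.ofReal (Real.exp (a * (c - 1))) := by
  rw [lintegral_poissonMeasure]
  have h : HasSum (fun n : ℕ => Real.exp (-a) * a ^ n / n.factorial * c ^ n)
      (Real.exp (a * (c - 1))) := by
    have h := (NormedSpace.expSeries_div_hasSum_exp ((a : ℝ) * c)).mul_left (Real.exp (-a))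
    rw [← Real.exp_eq_exp_ℝ, ← Real.exp_add] at h
    convert! h using 1
    · ext n
      rw [mul_pow]
      ring
    · congr 1
      ring
  rw [← h.tsum_eq, ENNReal.ofReal_tsum_of_nonneg (fun n => by positivity) h.summable]
  refine tsum_congr fun n => ?_
  rw [ENNReal.ofReal_mul (by positivity), ENNReal.ofReal_pow hc]

lemma one_sub_nexp_eq {t : ℝ≥0∞} : ∃ c : ℝ, 0 ≤ c ∧ c ≤ 1 ∧ nexp t = ENNReal.ofReal c ∧
    1 - nexp t = ENNReal.ofReal (1 - c) := by
  refine ⟨(nexp t).toReal, ENNReal.toReal_nonneg, ?_, (ENNReal.ofReal_toReal (nexp_ne_top t)).symm, ?_⟩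
  · exact ENNReal.toReal_le_of_le_ofReal zero_le_one (by simpa using nexp_le_one _)
  · rw [ENNReal.ofReal_sub _ ENNReal.toReal_nonneg, ENNReal.ofReal_toReal (nexp_ne_top t),
      ENNReal.ofReal_one]

lemma lintegral_nexp_poissonMeasure (a : ℝ≥0) (t : ℝ≥0∞) :
    ∫⁻ n : ℕ, nexp (n * t) ∂(poissonMeasure a) = nexp (a * (1 - nexp t)) := by
  obtain ⟨c, hc0, hc1, hc, hc'⟩ := one_sub_nexp_eq (t := t)
  simp_rw [nexp_natCast_mul]
  rw [hc', hc, lintegral_pow_poissonMeasure a hc0, ← ENNReal.ofReal_coe_nnreal,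
    ← ENNReal.ofReal_mul (by positivity), nexp_ofReal (x := a * (1 - c)) (mul_nonneg a.2 (by linarith))]
  congr 2
  ring

lemma lintegral_natCast_poissonMeasure (a : ℝ≥0) :
    ∫⁻ n : ℕ, (n : ℝ≥0∞) ∂(poissonMeasure a) = a := by
  rw [lintegral_poissonMeasure, tsum_eq_zero_add' ENNReal.summable]
  simp only [Nat.cast_zero, mul_zero, zero_add]
  have h : ∀ n : ℕ, ENNReal.ofReal (Real.exp (-a) * a ^ (n + 1) / (n + 1).factorial) *
      ((n + 1 : ℕ) : ℝ≥0∞) = a * ENNReal.ofReal (Real.exp (-a) * a ^ n / n.factorial) := by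
    intro n
    rw [← ENNReal.ofReal_natCast, ← ENNReal.ofReal_mul (by positivity), ← ENNReal.ofReal_coe_nnreal,
      ← ENNReal.ofReal_mul (by positivity)]
    congr 1
    rw [Nat.factorial_succ]
    have : (n.factorial : ℝ) ≠ 0 := by positivity
    push_cast
    field_simp
    ring
  rw [tsum_congr h, ENNReal.tsum_mul_left,
    ← ENNReal.ofReal_tsum_of_nonneg (fun n => by positivity) (hasSum_one_poissonMeasure a).summable,
    (hasSum_one_poissonMeasure a).tsum_eq]
  simp

/-! ### Counting points -/

section Count

variable {Ω : Type*} [MeasurableSpace Ω] {P : Measure Ω} {lam : ℝ≥0} {p : ℕ → Ω → ℝ × ℝ}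

lemma coe_encard_eq_tsum {ι : Type*} (s : Set ι) :
    ((s.encard : ℕ∞) : ℝ≥0∞) = ∑' i, s.indicator (fun _ => 1) i := by
  rw [← ENNReal.tsum_set_one, tsum_subtype s (fun _ => (1 : ℝ≥0∞))]

/-- Read in `[0, ∞]`, counts become series over the targets, to which termwise measurability and
Laplace functionals apply. -/
lemma coe_count {Ω : Type*} (p : ℕ → Ω → ℝ × ℝ) (B : Set (ℝ × ℝ)) (ω : Ω) :
    ((count p B ω : ℕ∞) : ℝ≥0∞) = ∑' i, B.indicator (fun _ => 1) (p i ω) := by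
  rw [count, coe_encard_eq_tsum]
  rfl

lemma measurable_of_measurable_coe_enat {N : Ω → ℕ∞}
    (h : Measurable fun ω => ((N ω : ℕ∞) : ℝ≥0∞)) : Measurable N := by
  refine measurable_to_countable' fun n => ?_
  have : N ⁻¹' {n} = (fun ω => ((N ω : ℕ∞) : ℝ≥0∞)) ⁻¹' {(n : ℝ≥0∞)} := by
    ext ω
    simp
  rw [this]
  exact h (measurableSet_singleton _)

lemma measurable_count (hp : ∀ i, Measurable (p i)) {B : Set (ℝ × ℝ)} (hB : MeasurableSet B) :
    Measurable (count p B) := by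
  refine measurable_of_measurable_coe_enat ?_
  simp_rw [coe_count]
  exact Measurable.tsum fun i => (measurable_const.indicator hB).comp (hp i)

/-- A random variable in `ℕ∞` with the point probabilities of a Poisson distribution. -/
lemma map_eq_poissonMeasure [IsProbabilityMeasure P] {N : Ω → ℕ∞} (hN : Measurable N) {a : ℝ≥0}
    (h : ∀ n : ℕ, P {ω | N ω = n} = poissonMeasure a {n}) :
    P.map N = (poissonMeasure a).map (fun n : ℕ => (n : ℕ∞)) := by
  have hc : Measurable (fun n : ℕ => (n : ℕ∞)) := measurable_from_top
  have := Measure.isProbabilityMeasure_map (μ := P) hN.aemeasurable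
  have := Measure.isProbabilityMeasure_map (μ := poissonMeasure a) hc.aemeasurable
  have hsing : ∀ n : ℕ, P.map N {(n : ℕ∞)}
      = (poissonMeasure a).map (fun n : ℕ => (n : ℕ∞)) {(n : ℕ∞)} := by
    intro n
    rw [Measure.map_apply hN (measurableSet_singleton _),
      Measure.map_apply hc (measurableSet_singleton _)]
    convert! h n using 2
    ext m
    simp
  have hrange : P.map N (Set.range (fun n : ℕ => (n : ℕ∞)))
      = (poissonMeasure a).map (fun n : ℕ => (n : ℕ∞)) (Set.range (fun n : ℕ => (n : ℕ∞))) := by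
    have hU : Set.range (fun n : ℕ => (n : ℕ∞)) = ⋃ n : ℕ, {(n : ℕ∞)} := by
      ext x
      simp
    have hd : Pairwise (Function.onFun Disjoint fun n : ℕ => ({(n : ℕ∞)} : Set ℕ∞)) := by
      intro i j hij
      simpa [Function.onFun] using hij
    rw [hU, measure_iUnion hd fun n => measurableSet_singleton _,
      measure_iUnion hd fun n => measurableSet_singleton _]
    exact tsum_congr hsing
  refine Measure.ext_of_singleton fun x => ?_
  induction x using ENat.recTopCoe with
  | coe n => exact hsing n
  | top =>
    -- The hypothesis is silent about infinite counts; the mass at `⊤` is what the finite values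
    -- leave of a probability measure.
    have ht : ({⊤} : Set ℕ∞) = (Set.range (fun n : ℕ => (n : ℕ∞)))ᶜ := by
      ext x
      induction x using ENat.recTopCoe <;> simp
    have hm : MeasurableSet (Set.range (fun n : ℕ => (n : ℕ∞))) :=
      (Set.countable_range _).measurableSet
    rw [ht, measure_compl hm (measure_ne_top _ _), measure_compl hm (measure_ne_top _ _), hrange]
    simp

lemma IsPoissonProcess.lintegral_comp_count [IsProbabilityMeasure P]
    (h : IsPoissonProcess P lam p) {B : Set (ℝ × ℝ)} (hB : MeasurableSet B) (hv : volume B ≠ ∞)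
    (f : ℕ∞ → ℝ≥0∞) :
    ∫⁻ ω, f (count p B ω) ∂P
      = ∫⁻ n : ℕ, f n ∂(poissonMeasure (lam * (volume B).toNNReal)) := by
  have hm := measurable_count h.measurable hB
  rw [← lintegral_map (f := f) (measurable_from_top) hm, map_eq_poissonMeasure hm (h.law B hB hv),
    lintegral_map measurable_from_top measurable_from_top]

lemma IsPoissonProcess.lintegral_count [IsProbabilityMeasure P]
    (h : IsPoissonProcess P lam p) {B : Set (ℝ × ℝ)} (hB : MeasurableSet B) (hv : volume B ≠ ∞) :
    ∫⁻ ω, ∑' i, B.indicator (fun _ => 1) (p i ω) ∂P = lam * volume B := by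
  simp_rw [← coe_count]
  rw [h.lintegral_comp_count hB hv (fun n => (n : ℝ≥0∞))]
  simp only [ENat.toENNReal_coe]
  rw [lintegral_natCast_poissonMeasure, ENNReal.coe_mul, ENNReal.coe_toNNReal hv]

/-! ### The Laplace functional of a Poisson process -/

lemma tendsto_tsum_of_monotone {ι : Type*} {f : ℕ → ι → ℝ≥0∞} {g : ι → ℝ≥0∞}
    (hf : ∀ i, Monotone fun n => f n i) (h : ∀ i, Tendsto (fun n => f n i) atTop (𝓝 (g i))) :
    Tendsto (fun n => ∑' i, f n i) atTop (𝓝 (∑' i, g i)) := by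
  let _ : MeasurableSpace ι := ⊤
  simp_rw [← lintegral_count]
  exact lintegral_tendsto_of_tendsto_of_monotone
    (fun n => measurable_from_top.aemeasurable)
    (Eventually.of_forall hf) (Eventually.of_forall h)

lemma measurable_tsum_comp {E : Type*} [MeasurableSpace E] {Z : ℕ → Ω → E}
    (hZ : ∀ i, Measurable (Z i)) {f : E → ℝ≥0∞} (hf : Measurable f) :
    Measurable fun ω => ∑' i, f (Z i ω) :=
  Measurable.tsum fun i => hf.comp (hZ i)

/-- The level sets of nonzero values are disjoint and of finite area, so the sum is a linear
combination of independent Poisson counts and its Laplace transform is a product. -/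
lemma IsPoissonProcess.lintegral_nexp_simpleFunc [IsProbabilityMeasure P]
    (h : IsPoissonProcess P lam p) (f : SimpleFunc (ℝ × ℝ) ℝ≥0∞)
    (hf : ∀ c, c ≠ 0 → volume (f ⁻¹' {c}) ≠ ∞) :
    ∫⁻ ω, nexp (∑' i, f (p i ω)) ∂P = nexp (lam * ∫⁻ x, (1 - nexp (f x))) := by
  classical
  -- The value zero is left out: its level set has no area bound, and it contributes nothing to
  -- either side.
  set s : Finset ℝ≥0∞ := f.range.filter (· ≠ 0) with hs
  let e : Fin s.card ≃ s := s.equivFin.symm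
  let c : Fin s.card → ℝ≥0∞ := fun j => (e j : ℝ≥0∞)
  let B : Fin s.card → Set (ℝ × ℝ) := fun j => f ⁻¹' {c j}
  have hc : ∀ j, c j ≠ 0 := fun j => (Finset.mem_filter.1 (e j).2).2
  have hsum : ∀ g : ℝ≥0∞ → ℝ≥0∞, ∑ j, g (c j) = ∑ x ∈ s, g x := by
    intro g
    rw [← Finset.sum_coe_sort s]
    exact Equiv.sum_comp e (fun x : s => g x)
  have hB : ∀ j, MeasurableSet (B j) := fun j => f.measurableSet_preimage _
  have hv : ∀ j, volume (B j) ≠ ∞ := fun j => hf _ (hc j)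
  have hd : Pairwise fun i j => Disjoint (B i) (B j) := by
    intro i j hij
    refine Disjoint.preimage _ ?_
    rw [Set.disjoint_singleton]
    intro he
    exact hij (e.injective (Subtype.ext he))
  have hfx : ∀ x, f x = ∑ j, c j * (B j).indicator (fun _ => 1) x := by
    intro x
    rw [hsum (fun a => a * (f ⁻¹' {a}).indicator (fun _ => 1) x)]
    by_cases hx : f x = 0
    · rw [hx]
      refine (Finset.sum_eq_zero fun a ha => ?_).symm
      have : x ∉ f ⁻¹' {a} := fun h' => (Finset.mem_filter.1 ha).2 (by rw [← hx]; exact h'.symm)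
      simp [this]
    · rw [Finset.sum_eq_single (f x)]
      · simp
      · intro a _ ha
        have : x ∉ f ⁻¹' {a} := fun h' => ha h'.symm
        simp [this]
      · intro h'
        exact absurd (Finset.mem_filter.2 ⟨f.mem_range_self x, hx⟩) h'
  have h1 : ∀ ω, ∑' i, f (p i ω) = ∑ j, c j * ((count p (B j) ω : ℕ∞) : ℝ≥0∞) := by
    intro ω
    simp_rw [coe_count, ← ENNReal.tsum_mul_left]
    rw [← Summable.tsum_finsetSum fun _ _ => ENNReal.summable]
    exact tsum_congr fun i => hfx _
  simp_rw [h1, nexp_sum]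
  rw [lintegral_prod_eq_prod_lintegral_of_indepFun Finset.univ
    (fun j ω => nexp (c j * ((count p (B j) ω : ℕ∞) : ℝ≥0∞)))
    ((h.indep _ B hB hv hd).comp (fun j n => nexp (c j * ((n : ℕ∞) : ℝ≥0∞)))
      fun _ => measurable_from_top)
    fun j => (measurable_from_top (f := fun n : ℕ∞ => nexp (c j * (n : ℝ≥0∞)))).comp
      (measurable_count h.measurable (hB j))]
  have h2 : ∀ j, ∫⁻ ω, nexp (c j * ((count p (B j) ω : ℕ∞) : ℝ≥0∞)) ∂P
      = nexp (lam * ((1 - nexp (c j)) * volume (B j))) := by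
    intro j
    rw [h.lintegral_comp_count (hB j) (hv j) (fun n => nexp (c j * (n : ℝ≥0∞)))]
    simp_rw [ENat.toENNReal_coe, mul_comm (c j)]
    rw [lintegral_nexp_poissonMeasure, ENNReal.coe_mul, ENNReal.coe_toNNReal (hv j)]
    congr 1
    ring
  rw [Finset.prod_congr rfl fun j _ => h2 j, ← nexp_sum, ← Finset.mul_sum]
  congr 2
  have h3 := SimpleFunc.map_lintegral (μ := volume) (fun t => 1 - nexp t) f
  rw [← SimpleFunc.lintegral_eq_lintegral] at h3
  simp only [SimpleFunc.coe_map, Function.comp_apply] at h3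
  rw [h3, hsum (fun a => (1 - nexp a) * volume (f ⁻¹' {a})), hs, Finset.sum_filter_of_ne]
  intro a _ ha h0
  simp [h0] at ha

/-- The Laplace functional of a homogeneous Poisson process. -/
theorem IsPoissonProcess.lintegral_nexp_tsum [IsProbabilityMeasure P]
    (h : IsPoissonProcess P lam p) {f : ℝ × ℝ → ℝ≥0∞} (hf : Measurable f) :
    ∫⁻ ω, nexp (∑' i, f (p i ω)) ∂P = nexp (lam * ∫⁻ x, (1 - nexp (f x))) := by
  -- Cutting the simple approximations off outside balls gives their nonzero level sets finite area.
  let B : ℕ → Set (ℝ × ℝ) := fun n => Metric.ball 0 n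
  let g : ℕ → SimpleFunc (ℝ × ℝ) ℝ≥0∞ := fun n => (SimpleFunc.eapprox f n).restrict (B n)
  have hgx : ∀ n x, g n x = (B n).indicator (SimpleFunc.eapprox f n) x := fun n x =>
    SimpleFunc.restrict_apply _ measurableSet_ball _
  have hmono : ∀ x, Monotone fun n => g n x := by
    intro x m n hmn
    simp only [hgx]
    refine (Set.indicator_le_indicator_of_subset 
      (Metric.ball_subset_ball (Nat.cast_le (α := ℝ).2 hmn)) (fun _ => zero_le) x).trans ?_
    exact Set.indicator_le_indicator (SimpleFunc.monotone_eapprox f hmn x)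
  have hlim : ∀ x, Tendsto (fun n => g n x) atTop (𝓝 (f x)) := by
    intro x
    have h1 : Tendsto (fun n => SimpleFunc.eapprox f n x) atTop (𝓝 (f x)) := by
      rw [← SimpleFunc.iSup_eapprox_apply hf x]
      exact tendsto_atTop_iSup fun m n hmn => SimpleFunc.monotone_eapprox f hmn x
    refine h1.congr' ?_
    obtain ⟨N, hN⟩ := exists_nat_gt (dist x 0)
    filter_upwards [eventually_ge_atTop N] with n hn
    rw [hgx, Set.indicator_of_mem]
    exact Metric.mem_ball.2 (hN.trans_le (by exact_mod_cast hn))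
  have hfin : ∀ n c, c ≠ 0 → volume (g n ⁻¹' {c}) ≠ ∞ := by
    intro n c hc
    refine ((measure_mono ?_).trans_lt (measure_ball_lt_top (μ := volume) (x := (0 : ℝ × ℝ))
      (r := n))).ne
    intro x hx
    by_contra hx'
    have : g n x = 0 := by rw [hgx]; exact Set.indicator_of_notMem hx' _
    exact hc (by rw [← this]; exact hx.symm)
  have hL : Tendsto (fun n => ∫⁻ ω, nexp (∑' i, g n (p i ω)) ∂P) atTop
      (𝓝 (∫⁻ ω, nexp (∑' i, f (p i ω)) ∂P)) :=
    tendsto_lintegral_nexp P (fun n => measurable_tsum_comp h.measurable (g n).measurable)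
      (Eventually.of_forall fun ω =>
        tendsto_tsum_of_monotone (fun i => hmono _) (fun i => hlim _))
  have hR : Tendsto (fun n => nexp (lam * ∫⁻ x, (1 - nexp (g n x)))) atTop
      (𝓝 (nexp (lam * ∫⁻ x, (1 - nexp (f x))))) := by
    refine (continuous_nexp.tendsto _).comp (ENNReal.Tendsto.const_mul ?_ (Or.inr (by simp)))
    refine lintegral_tendsto_of_tendsto_of_monotone (fun n => ?_) (Eventually.of_forall fun x => ?_)
      (Eventually.of_forall fun x => ?_)
    · exact (measurable_const.sub (measurable_nexp.comp (g n).measurable)).aemeasurable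
    · exact fun m n hmn => tsub_le_tsub_left (nexp_antitone (hmono x hmn)) _
    · exact ENNReal.Tendsto.sub tendsto_const_nhds ((continuous_nexp.tendsto _).comp (hlim x))
        (Or.inl (by simp))
  refine tendsto_nhds_unique hL (hR.congr fun n => ?_)
  exact (h.lintegral_nexp_simpleFunc (g n) (hfin n)).symm

end Count

/-! ### Independent marks -/

/-- The Laplace transform of a sum over independent coordinates. -/
lemma lintegral_nexp_tsum_infinitePi {ι : Type*} [Countable ι] {E : ι → Type*}
    [∀ i, MeasurableSpace (E i)] (μ : ∀ i, Measure (E i)) [∀ i, IsProbabilityMeasure (μ i)]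
    {f : ∀ i, E i → ℝ≥0∞} (hf : ∀ i, Measurable (f i)) :
    ∫⁻ x, nexp (∑' i, f i (x i)) ∂(Measure.infinitePi μ)
      = nexp (∑' i, nlog (∫⁻ y, nexp (f i y) ∂(μ i))) := by
  refine (lintegral_nexp_tsum_of_iIndepFun (X := fun i (x : ∀ i, E i) => f i (x i))
    (iIndepFun_infinitePi hf)
    fun i => (hf i).comp (measurable_pi_apply i)).trans ?_
  congr 3
  ext i
  have hm : Measurable fun y => nexp (f i y) := measurable_nexp.comp (hf i)
  conv_rhs => rw [← Measure.infinitePi_map_eval μ i, lintegral_map hm (measurable_pi_apply i)]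

/-- The Pareto distribution as a measure on `ℝ≥0`. -/
noncomputable def markLaw (xm α : ℝ) : Measure ℝ≥0 := (paretoMeasure xm α).map Real.toNNReal

section Field

variable {Ω : Type*} [MeasurableSpace Ω] {P : Measure Ω} {lam : ℝ≥0} {xm α : ℝ}
  {p : ℕ → Ω → ℝ × ℝ} {r : ℕ → Ω → ℝ≥0}

lemma IsParetoField.map_mark (h : IsParetoField P lam xm α p r) (i : ℕ) :
    P.map (r i) = markLaw xm α := by
  rw [markLaw, ← h.law i, Measure.map_map (f := fun ω => (r i ω : ℝ)) measurable_real_toNNReal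
    (measurable_coe_nnreal_real.comp (h.measurable i))]
  congr 1
  ext ω
  simp

lemma IsParetoField.isProbabilityMeasure_markLaw [IsProbabilityMeasure P]
    (h : IsParetoField P lam xm α p r) : IsProbabilityMeasure (markLaw xm α) := by
  rw [← h.map_mark 0]
  exact Measure.isProbabilityMeasure_map (h.measurable 0).aemeasurable

lemma IsParetoField.measurable_pair (h : IsParetoField P lam xm α p r) (i : ℕ) :
    Measurable fun ω => (p i ω, r i ω) := (h.poisson.measurable i).prodMk (h.measurable i)

lemma IsParetoField.measurable_tsum (h : IsParetoField P lam xm α p r)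
    {F : (ℝ × ℝ) × ℝ≥0 → ℝ≥0∞} (hF : Measurable F) :
    Measurable fun ω => ∑' i, F (p i ω, r i ω) :=
  measurable_tsum_comp h.measurable_pair hF

/-- The Laplace functional of the field of targets with their rewards. -/
theorem IsParetoField.lintegral_nexp_tsum [IsProbabilityMeasure P]
    (h : IsParetoField P lam xm α p r) {F : (ℝ × ℝ) × ℝ≥0 → ℝ≥0∞} (hF : Measurable F) :
    ∫⁻ ω, nexp (∑' i, F (p i ω, r i ω)) ∂P
      = nexp (lam * ∫⁻ x, ∫⁻ u, (1 - nexp (F (x, u))) ∂(markLaw xm α)) := by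
  have := h.isProbabilityMeasure_markLaw
  have hp : Measurable fun ω i => p i ω := measurable_pi_lambda _ h.poisson.measurable
  have hr : Measurable fun ω i => r i ω := measurable_pi_lambda _ h.measurable
  have := Measure.isProbabilityMeasure_map (μ := P) hp.aemeasurable
  have hlaw : P.map (fun ω => ((fun i => p i ω), (fun i => r i ω)))
      = (P.map fun ω i => p i ω).prod (Measure.infinitePi fun _ : ℕ => markLaw xm α) := by
    rw [(indepFun_iff_map_prod_eq_prod_map_map hp.aemeasurable hr.aemeasurable).1 h.indep,
      h.iIndep.map_fun_eq_infinitePi_map h.measurable]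
    simp_rw [h.map_mark]
  have hm : Measurable fun z : (ℕ → ℝ × ℝ) × (ℕ → ℝ≥0) => nexp (∑' i, F (z.1 i, z.2 i)) := by
    refine measurable_nexp.comp (Measurable.tsum fun i => hF.comp ?_)
    fun_prop
  have hG : Measurable fun x => ∫⁻ u, nexp (F (x, u)) ∂(markLaw xm α) :=
    (measurable_nexp.comp hF).lintegral_prod_right'
  calc ∫⁻ ω, nexp (∑' i, F (p i ω, r i ω)) ∂P
      = ∫⁻ z, nexp (∑' i, F (z.1 i, z.2 i))
          ∂(P.map (fun ω => ((fun i => p i ω), (fun i => r i ω)))) := by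
        rw [lintegral_map hm (hp.prodMk hr)]
    -- Given the locations, the marks are independent; integrating them out leaves a Laplace
    -- functional of the locations alone, with `nlog` of the mean over the mark as test function.
    _ = ∫⁻ ω, nexp (∑' i, nlog (∫⁻ u, nexp (F (p i ω, u)) ∂(markLaw xm α))) ∂P := by
        rw [hlaw, lintegral_prod _ hm.aemeasurable]
        have h1 : ∀ q : ℕ → ℝ × ℝ, ∫⁻ m, nexp (∑' i, F (q i, m i))
            ∂(Measure.infinitePi fun _ : ℕ => markLaw xm α)
            = nexp (∑' i, nlog (∫⁻ u, nexp (F (q i, u)) ∂(markLaw xm α))) := fun q =>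
          lintegral_nexp_tsum_infinitePi (fun _ => markLaw xm α) (f := fun i u => F (q i, u))
            fun i => hF.comp (by fun_prop)
        simp_rw [h1]
        rw [lintegral_map _ hp]
        refine measurable_nexp.comp (Measurable.tsum fun i => measurable_nlog.comp (hG.comp ?_))
        exact measurable_pi_apply i
    _ = nexp (lam * ∫⁻ x, ∫⁻ u, (1 - nexp (F (x, u))) ∂(markLaw xm α)) := by
        refine (h.poisson.lintegral_nexp_tsum (measurable_nlog.comp hG)).trans ?_
        congr 3
        ext x
        rw [Function.comp_apply, nexp_nlog (lintegral_nexp_le_one _ _),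
          lintegral_sub (show Measurable fun u => nexp (F (x, u)) by fun_prop)
            ((lintegral_nexp_le_one _ _).trans_lt ENNReal.one_lt_top).ne
            (Eventually.of_forall fun u => nexp_le_one _)]
        simp

/-- Campbell's formula for product functions. -/
lemma IsParetoField.lintegral_tsum_mul [IsProbabilityMeasure P]
    (h : IsParetoField P lam xm α p r) {B : Set (ℝ × ℝ)} (hB : MeasurableSet B)
    (hv : volume B ≠ ∞) {φ : ℝ≥0 → ℝ≥0∞} (hφ : Measurable φ) :
    ∫⁻ ω, ∑' i, B.indicator (fun _ => 1) (p i ω) * φ (r i ω) ∂P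
      = lam * volume B * ∫⁻ u, φ u ∂(markLaw xm α) := by
  have hi : Measurable (B.indicator (fun _ => (1 : ℝ≥0∞))) := measurable_const.indicator hB
  rw [lintegral_tsum (f := fun i ω => B.indicator (fun _ => 1) (p i ω) * φ (r i ω))
    fun i => ((hi.comp (h.poisson.measurable i)).mul (hφ.comp (h.measurable i))).aemeasurable, ← h.poisson.lintegral_count hB hv,
    lintegral_tsum (f := fun i ω => B.indicator (fun _ => 1) (p i ω))
      fun i => (hi.comp (h.poisson.measurable i)).aemeasurable, ← ENNReal.tsum_mul_right]
  refine tsum_congr fun i => ?_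
  have hind : IndepFun (fun ω => B.indicator (fun _ => (1 : ℝ≥0∞)) (p i ω)) (fun ω => φ (r i ω)) P :=
    h.indep.comp (φ := fun q : ℕ → ℝ × ℝ => B.indicator (fun _ => (1 : ℝ≥0∞)) (q i))
      (ψ := fun m : ℕ → ℝ≥0 => φ (m i))
      (hi.comp (measurable_pi_apply i)) (hφ.comp (measurable_pi_apply i))
  refine (lintegral_mul_eq_lintegral_mul_lintegral_of_indepFun''
    (hi.comp (h.poisson.measurable i)).aemeasurable (hφ.comp (h.measurable i)).aemeasurable
    hind).trans ?_
  rw [← h.map_mark i, lintegral_map hφ (h.measurable i)]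
  rfl

lemma IsPoissonProcess.ae_notMem_of_volume_eq_zero [IsProbabilityMeasure P]
    (h : IsPoissonProcess P lam p) {B : Set (ℝ × ℝ)} (hB : MeasurableSet B) (hv : volume B = 0) :
    ∀ᵐ ω ∂P, ∀ i, p i ω ∉ B := by
  have h1 := h.lintegral_count hB (by simp [hv])
  rw [hv, mul_zero, lintegral_eq_zero_iff (measurable_tsum_comp h.measurable
    (measurable_const.indicator hB))] at h1
  filter_upwards [h1] with ω hω i hi
  have := (ENNReal.tsum_eq_zero.1 hω) i
  simp [hi] at this

lemma IsPoissonProcess.ae_finite [IsProbabilityMeasure P]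
    (h : IsPoissonProcess P lam p) {B : Set (ℝ × ℝ)} (hB : MeasurableSet B) (hv : volume B ≠ ∞) :
    ∀ᵐ ω ∂P, {i | p i ω ∈ B}.Finite := by
  have h1 := h.lintegral_count hB hv
  have h2 := ae_lt_top (measurable_tsum_comp h.measurable
    (measurable_const.indicator hB)) (by rw [h1]; exact ENNReal.mul_ne_top (by simp) hv)
  filter_upwards [h2] with ω hω
  rw [← coe_count] at hω
  refine Set.encard_lt_top_iff.1 ?_
  simpa [count] using hω

end Field

/-! ### The Pareto distribution -/

section Pareto

variable {xm α : ℝ}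

lemma lintegral_markLaw {f : ℝ≥0 → ℝ≥0∞} (hf : Measurable f) :
    ∫⁻ u, f u ∂(markLaw xm α)
      = ∫⁻ x in Ici xm, ENNReal.ofReal (α * xm ^ α * x ^ (-(α + 1))) * f x.toNNReal := by
  have hf' : Measurable fun x : ℝ => f x.toNNReal := hf.comp measurable_real_toNNReal
  have hd : Measurable (paretoPDF xm α) := (measurable_paretoPDFReal xm α).ennreal_ofReal
  rw [markLaw, lintegral_map hf measurable_real_toNNReal, paretoMeasure,
    lintegral_withDensity_eq_lintegral_mul _ hd hf', ← lintegral_indicator measurableSet_Ici]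
  congr 1
  ext x
  simp only [Pi.mul_apply, Set.indicator_apply, mem_Ici]
  split_ifs with hx
  · rw [paretoPDF_of_le hx]
  · rw [paretoPDF_of_lt (not_le.1 hx), zero_mul]

lemma lintegral_Ici_rpow {a w : ℝ} (ha : a < -1) (hw : 0 < w) :
    ∫⁻ x in Ici w, ENNReal.ofReal (x ^ a) = ENNReal.ofReal (-w ^ (a + 1) / (a + 1)) := by
  rw [setLIntegral_congr Ioi_ae_eq_Ici.symm, ← ofReal_integral_eq_lintegral_ofReal
    (integrableOn_Ioi_rpow_of_lt ha hw), integral_Ioi_rpow_of_lt ha hw]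
  filter_upwards [ae_restrict_mem measurableSet_Ioi] with x hx
  exact Real.rpow_nonneg (hw.trans hx).le _

/-- For `w ≤ xm` the bound is at least one and hence trivial; for `w > xm` it is the integral of the
density. -/
lemma markLaw_Ioi_le (hxm : 0 < xm) (hα : 1 < α) {w : ℝ} (hw : 0 < w) :
    markLaw xm α {u : ℝ≥0 | w < u} ≤ ENNReal.ofReal ((xm / w) ^ α) := by
  have hms : MeasurableSet {u : ℝ≥0 | w < u} := measurableSet_lt measurable_const (by fun_prop)
  have := isProbabilityMeasure_paretoMeasure hxm (by linarith : 0 < α)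
  rcases le_or_gt w xm with hwx | hwx
  · have h1 : markLaw xm α {u : ℝ≥0 | w < u} ≤ 1 := by
      rw [markLaw, Measure.map_apply measurable_real_toNNReal hms]
      exact prob_le_one
    refine h1.trans ?_
    rw [← ENNReal.ofReal_one]
    exact ENNReal.ofReal_le_ofReal (Real.one_le_rpow ((one_le_div hw).2 hwx) (by linarith))
  · rw [← lintegral_indicator_one hms, lintegral_markLaw (measurable_one.indicator hms)]
    calc ∫⁻ x in Ici xm, ENNReal.ofReal (α * xm ^ α * x ^ (-(α + 1))) *
          {u : ℝ≥0 | w < u}.indicator 1 x.toNNReal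
        ≤ ∫⁻ x in Ici w, ENNReal.ofReal (α * xm ^ α) * ENNReal.ofReal (x ^ (-(α + 1))) := by
          rw [← lintegral_indicator measurableSet_Ici, ← lintegral_indicator measurableSet_Ici]
          refine lintegral_mono fun x => ?_
          by_cases hx : w < x
          · rw [Set.indicator_of_mem (show x ∈ Ici w from hx.le), ← ENNReal.ofReal_mul (by positivity)]
            refine (Set.indicator_le_self _ _ _).trans ?_
            exact mul_le_of_le_one_right zero_le
              (Set.indicator_le_self (M := ℝ≥0∞) _ (1 : ℝ≥0 → ℝ≥0∞) x.toNNReal)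
          · have : x.toNNReal ∉ {u : ℝ≥0 | w < u} := by
              simp only [mem_ofPred_eq, Real.coe_toNNReal', not_lt]
              exact max_le (not_lt.1 hx) hw.le
            simp [Set.indicator_of_notMem this, Set.indicator_apply (Ici xm)]
      _ = ENNReal.ofReal ((xm / w) ^ α) := by
          rw [lintegral_const_mul _ (by fun_prop), lintegral_Ici_rpow (by linarith) hw,
            ← ENNReal.ofReal_mul (by positivity), Real.div_rpow hxm.le hw.le]
          congr 1
          have e : -(α + 1) + 1 = -α := by ring
          rw [e, Real.rpow_neg hw.le]
          field_simp

/-- Continuing the power density below `xm` only increases the integral, so no comparison between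
`w` and `xm` is required. Convergence uses `α > 1`. -/
lemma lintegral_markLaw_tail_le (hxm : 0 < xm) (hα : 1 < α) {w : ℝ} (hw : 0 < w) :
    ∫⁻ u, {u : ℝ≥0 | w < u}.indicator (fun u => (u : ℝ≥0∞)) u ∂(markLaw xm α)
      ≤ ENNReal.ofReal (α / (α - 1) * xm ^ α * w ^ (1 - α)) := by
  have hms : MeasurableSet {u : ℝ≥0 | w < u} := measurableSet_lt measurable_const (by fun_prop)
  have hme : Measurable ({u : ℝ≥0 | w < u}.indicator fun u => (u : ℝ≥0∞)) :=
    Measurable.indicator (by fun_prop) hms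
  rw [lintegral_markLaw hme]
  calc ∫⁻ x in Ici xm, ENNReal.ofReal (α * xm ^ α * x ^ (-(α + 1))) *
        {u : ℝ≥0 | w < u}.indicator (fun u => (u : ℝ≥0∞)) x.toNNReal
      ≤ ∫⁻ x in Ici w, ENNReal.ofReal (α * xm ^ α) * ENNReal.ofReal (x ^ (-α)) := by
        rw [← lintegral_indicator measurableSet_Ici, ← lintegral_indicator measurableSet_Ici]
        refine lintegral_mono fun x => ?_
        by_cases hx : w < x
        · have hx0 : 0 < x := hw.trans hx
          rw [Set.indicator_of_mem (show x ∈ Ici w from hx.le), ← ENNReal.ofReal_mul (by positivity)]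
          refine (Set.indicator_le_self _ _ _).trans ?_
          have h1 : {u : ℝ≥0 | w < u}.indicator (fun u => (u : ℝ≥0∞)) x.toNNReal ≤ ENNReal.ofReal x :=
            Set.indicator_le_self (M := ℝ≥0∞) _ _ _
          refine (mul_le_mul_right h1 _).trans ?_
          rw [← ENNReal.ofReal_mul (by positivity), neg_add, Real.rpow_add hx0, Real.rpow_neg_one]
          apply le_of_eq
          congr 1
          field_simp
        · have : x.toNNReal ∉ {u : ℝ≥0 | w < u} := by
            simp only [mem_ofPred_eq, Real.coe_toNNReal', not_lt]
            exact max_le (not_lt.1 hx) hw.le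
          simp [Set.indicator_of_notMem this, Set.indicator_apply (Ici xm)]
    _ = ENNReal.ofReal (α / (α - 1) * xm ^ α * w ^ (1 - α)) := by
        rw [lintegral_const_mul _ (by fun_prop), lintegral_Ici_rpow (by linarith) hw,
          ← ENNReal.ofReal_mul (by positivity)]
        congr 1
        have e : -α + 1 = 1 - α := by ring
        have e1 : α - 1 ≠ 0 := by linarith
        have e2 : 1 - α ≠ 0 := by linarith
        rw [e]
        field_simp
        ring

lemma ae_markLaw_le : ∀ᵐ u : ℝ≥0 ∂(markLaw xm α), xm ≤ u := by
  have hms : MeasurableSet {u : ℝ≥0 | xm ≤ u} := measurableSet_le measurable_const (by fun_prop)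
  rw [ae_iff]
  change markLaw xm α ({u : ℝ≥0 | xm ≤ u}ᶜ) = 0
  rw [← lintegral_indicator_one hms.compl, lintegral_markLaw (measurable_one.indicator hms.compl), ← lintegral_zero (μ := volume.restrict (Ici xm))]
  refine setLIntegral_congr_fun measurableSet_Ici fun x hx => ?_
  have : x.toNNReal ∉ {u : ℝ≥0 | xm ≤ u}ᶜ := by
    simp only [mem_compl_iff, mem_ofPred_eq, not_not]
    exact hx.trans (Real.le_coe_toNNReal x)
  rw [Set.indicator_of_notMem this, mul_zero]

lemma lintegral_coe_markLaw_ne_top (hxm : 0 < xm) (hα : 1 < α) :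
    ∫⁻ u, (u : ℝ≥0∞) ∂(markLaw xm α) ≠ ∞ := by
  -- The tail is defined by a strict inequality, so the level `xm / 2` is used to capture the whole
  -- law.
  refine ((lintegral_mono_ae ?_).trans_lt ((lintegral_markLaw_tail_le hxm hα
    (half_pos hxm)).trans_lt ENNReal.ofReal_lt_top)).ne
  filter_upwards [ae_markLaw_le] with u hu
  rw [Set.indicator_of_mem]
  exact (half_lt_self hxm).trans_le hu

/-- Self-similarity of the tail of the Pareto distribution. -/
lemma lintegral_markLaw_scale (hxm : 0 < xm) (hα : 1 < α) {s : ℝ≥0} (hs : 0 < s) (hs1 : s ≤ 1)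
    {φ : ℝ≥0 → ℝ≥0∞} (hφ : Measurable φ) :
    ∫⁻ u, {u : ℝ≥0 | xm ≤ s * u}.indicator (fun u => φ (s * u)) u ∂(markLaw xm α)
      = ENNReal.ofReal ((s : ℝ) ^ α) * ∫⁻ u, φ u ∂(markLaw xm α) := by
  have hs' : (0 : ℝ) < s := hs
  have hms : MeasurableSet {u : ℝ≥0 | xm ≤ s * u} := measurableSet_le measurable_const (by fun_prop)
  have hme : Measurable ({u : ℝ≥0 | xm ≤ s * u}.indicator fun u => φ (s * u)) :=
    Measurable.indicator (hφ.comp (by fun_prop)) hms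
  have hd : Measurable fun x : ℝ => ENNReal.ofReal (α * xm ^ α * x ^ (-(α + 1))) := by fun_prop
  have hφ' : Measurable fun x : ℝ => φ x.toNNReal := hφ.comp measurable_real_toNNReal
  rw [lintegral_markLaw hme, lintegral_markLaw hφ, ← lintegral_indicator measurableSet_Ici, ← lintegral_indicator measurableSet_Ici]
  have hmap : Measure.map (fun x : ℝ => (s : ℝ) * x) volume = ENNReal.ofReal (|(s : ℝ)⁻¹|) • volume :=
    Real.map_volume_mul_left hs'.ne'
  have hchange : ∀ f : ℝ → ℝ≥0∞, Measurable f →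
      ∫⁻ x, f x = ENNReal.ofReal s * ∫⁻ x, f (s * x) := by
    intro f hf
    rw [← lintegral_map (g := fun x : ℝ => (s : ℝ) * x) hf (by fun_prop), hmap, lintegral_smul_measure, smul_eq_mul, ← mul_assoc,
      ← ENNReal.ofReal_mul hs'.le, abs_of_pos (inv_pos.2 hs'), mul_inv_cancel₀ hs'.ne',
      ENNReal.ofReal_one, one_mul]
  have hg : Measurable ((Ici xm).indicator fun x : ℝ =>
      ENNReal.ofReal (α * xm ^ α * x ^ (-(α + 1))) * φ x.toNNReal) :=
    (hd.mul hφ').indicator measurableSet_Ici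
  rw [hchange _ hg, ← mul_assoc, ← lintegral_const_mul _ (by fun_prop)]
  congr 1
  ext x
  by_cases hx : xm ≤ s * x
  · have hx0 : 0 < x := pos_of_mul_pos_right (hxm.trans_le hx) hs'.le
    -- Here `s ≤ 1` matters: whenever the scaled reward exceeds `xm`, so does the original, and its
    -- density is the pure power.
    have hx1 : xm ≤ x := hx.trans (by
      have : (s : ℝ) ≤ 1 := hs1
      nlinarith)
    have hx2 : (s : ℝ≥0) * x.toNNReal = (s * x).toNNReal := by
      rw [Real.toNNReal_mul hs'.le, Real.toNNReal_coe]
    rw [Set.indicator_of_mem (show x ∈ Ici xm from hx1),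
      Set.indicator_of_mem (show x.toNNReal ∈ {u : ℝ≥0 | xm ≤ s * u} by
        simpa [Real.coe_toNNReal x hx0.le] using hx),
      Set.indicator_of_mem (show (s : ℝ) * x ∈ Ici xm from hx), hx2, ← mul_assoc]
    congr 1
    rw [← ENNReal.ofReal_mul (by positivity), ← ENNReal.ofReal_mul (by positivity)]
    congr 1
    rw [Real.mul_rpow hs'.le hx0.le, neg_add, Real.rpow_add hs', Real.rpow_neg hs'.le,
      Real.rpow_neg_one]
    field_simp
  · rw [Set.indicator_of_notMem (show (s : ℝ) * x ∉ Ici xm from hx), mul_zero]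
    by_cases hx1 : x ∈ Ici xm
    · rw [Set.indicator_of_mem hx1, Set.indicator_of_notMem, mul_zero]
      simp only [mem_ofPred_eq]
      rwa [Real.coe_toNNReal x (hxm.le.trans hx1)]
    · rw [Set.indicator_of_notMem hx1]

end Pareto

/-! ### Reduction of the control problem to chains of targets -/

/-- The targets with index in `I` can be visited in one run of longitudinal length `ℓ` from `z`. -/
def IsCausal (z : ℝ × ℝ) (ℓ : ℝ) (q : ℕ → ℝ × ℝ) (I : Finset ℕ) : Prop :=
  (∀ i ∈ I, |(q i).2 - z.2| ≤ (q i).1 - z.1 ∧ (q i).1 - z.1 ≤ ℓ) ∧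
    ∀ i ∈ I, ∀ j ∈ I, |(q i).2 - (q j).2| ≤ |(q i).1 - (q j).1|

/-- The maximal total reward of a causal set of targets. -/
noncomputable def best (z : ℝ × ℝ) (ℓ : ℝ) (q : ℕ → ℝ × ℝ) (m : ℕ → ℝ≥0) : ℝ≥0∞ :=
  ⨆ (I : Finset ℕ) (_ : IsCausal z ℓ q I), ∑ i ∈ I, (m i : ℝ≥0∞)

lemma IsFeasible.fst {v τ : ℝ} {z : ℝ × ℝ} {x : ℝ → ℝ × ℝ} (hx : IsFeasible v τ z x) {t : ℝ}
    (ht : t ∈ Icc 0 τ) : (x t).1 = z.1 + v * t := by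
  obtain ⟨u, -, -, h⟩ := hx
  rw [h t ht]

lemma IsFeasible.snd_zero {v τ : ℝ} {z : ℝ × ℝ} {x : ℝ → ℝ × ℝ} (hx : IsFeasible v τ z x)
    (hτ : 0 ≤ τ) : x 0 = z := by
  obtain ⟨u, -, -, h⟩ := hx
  rw [h 0 ⟨le_rfl, hτ⟩]
  simp

lemma IsFeasible.abs_snd_sub_le {v τ : ℝ} {z : ℝ × ℝ} {x : ℝ → ℝ × ℝ} (hx : IsFeasible v τ z x)
    {s t : ℝ} (hs : s ∈ Icc 0 τ) (ht : t ∈ Icc 0 τ) : |(x t).2 - (x s).2| ≤ v * |t - s| := by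
  obtain ⟨u, hu, hb, h⟩ := hx
  have h0 : (0 : ℝ) ∈ Icc 0 τ := ⟨le_rfl, hs.1.trans hs.2⟩
  have hsub : ∀ a ∈ Icc 0 τ, ∀ b ∈ Icc 0 τ, ∀ w ∈ Set.uIoc a b, |u w| ≤ v := fun a ha b hbb w hw =>
    hb w (Set.uIcc_subset_Icc ha hbb (Set.uIoc_subset_uIcc hw))
  have hint : ∀ a ∈ Icc 0 τ, IntervalIntegrable u volume 0 a := by
    intro a ha
    refine (intervalIntegrable_const (c := v)).mono_fun hu.aestronglyMeasurable ?_
    filter_upwards [ae_restrict_mem measurableSet_uIoc] with w hw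
    exact (hsub 0 h0 a ha w hw).trans (le_abs_self v)
  rw [h t ht, h s hs]
  simp only [add_sub_add_left_eq_sub]
  rw [intervalIntegral.integral_interval_sub_left (hint t ht) (hint s hs)]
  exact intervalIntegral.norm_integral_le_of_norm_le_const (f := u) fun w hw => hsub s hs t ht w hw

/-- The first coordinate is affine in time with slope `v`, so the bound on the lateral speed turns
into the cone condition between any two visited points. -/
lemma isCausal_of_visited {v ℓ : ℝ} (hv : 0 < v) {z : ℝ × ℝ} {x : ℝ → ℝ × ℝ}
    (hx : IsFeasible v (ℓ / v) z x) {q : ℕ → ℝ × ℝ} {I : Finset ℕ}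
    (hI : ∀ i ∈ I, q i ∈ x '' Icc 0 (ℓ / v)) : IsCausal z ℓ q I := by
  refine ⟨fun i hi => ?_, fun i hi j hj => ?_⟩
  · obtain ⟨t, ht, hti⟩ := hI i hi
    have h0 : (0 : ℝ) ∈ Icc 0 (ℓ / v) := ⟨le_rfl, ht.1.trans ht.2⟩
    have h1 := hx.abs_snd_sub_le h0 ht
    have h2 := (le_div_iff₀ hv).1 ht.2
    rw [hx.snd_zero (ht.1.trans ht.2), sub_zero, abs_of_nonneg ht.1, hti] at h1
    have h3 := hx.fst ht
    rw [hti] at h3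
    constructor <;> linarith
  · obtain ⟨t, ht, hti⟩ := hI i hi
    obtain ⟨s, hs, hsj⟩ := hI j hj
    have h1 := hx.abs_snd_sub_le hs ht
    rw [← hti, ← hsj, hx.fst ht, hx.fst hs]
    rwa [add_sub_add_left_eq_sub, ← mul_sub, abs_mul, abs_of_pos hv]

/-- A finite set of pairwise reachable points lies on the graph of a `1`-Lipschitz function. -/
lemma exists_lipschitzWith_one {S : Finset (ℝ × ℝ)} (hS : S.Nonempty)
    (h : ∀ a ∈ S, ∀ b ∈ S, |a.2 - b.2| ≤ |a.1 - b.1|) :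
    ∃ f : ℝ → ℝ, LipschitzWith 1 f ∧ ∀ a ∈ S, f a.1 = a.2 := by
  -- This is the McShane extension: the lowest of the upward cones with apex in `S`.
  refine ⟨fun y => S.inf' hS fun s => s.2 + |y - s.1|, ?_, ?_⟩
  · refine LipschitzWith.of_le_add fun y w => ?_
    rw [← sub_le_iff_le_add]
    refine Finset.le_inf' _ _ fun s hs => ?_
    have h1 : (S.inf' hS fun s => s.2 + |y - s.1|) ≤ s.2 + |y - s.1| := Finset.inf'_le _ hs
    have h2 : |y - s.1| ≤ |y - w| + |w - s.1| := abs_sub_le _ _ _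
    rw [Real.dist_eq]
    linarith
  · intro a ha
    refine le_antisymm ((Finset.inf'_le _ ha).trans (by simp)) (Finset.le_inf' _ _ fun s hs => ?_)
    have := (abs_le.1 (h a ha s hs)).2
    linarith

/-- The control is the derivative of the lateral position. A Lipschitz function is absolutely
continuous and so is recovered from its derivative; where it is not differentiable, `deriv` is zero
and respects the speed bound. -/
lemma exists_isFeasible {v ℓ : ℝ} (hv : 0 < v) (z : ℝ × ℝ) {f : ℝ → ℝ}
    (hf : LipschitzWith 1 f) (hz : f z.1 = z.2) :
    IsFeasible v (ℓ / v) z fun t => (z.1 + v * t, f (z.1 + v * t)) := by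
  set y : ℝ → ℝ := fun t => f (z.1 + v * t) with hy
  have hL : LipschitzWith v.toNNReal y := by
    refine LipschitzWith.of_dist_le_mul fun s t => ?_
    have := hf.dist_le_mul (z.1 + v * s) (z.1 + v * t)
    simp only [hy]
    rw [Real.coe_toNNReal v hv.le]
    refine this.trans (le_of_eq ?_)
    rw [NNReal.coe_one, one_mul, Real.dist_eq, Real.dist_eq, add_sub_add_left_eq_sub, ← mul_sub,
      abs_mul, abs_of_pos hv]
  refine ⟨deriv y, measurable_deriv y, fun t _ => ?_, fun t _ => ?_⟩
  · have := norm_deriv_le_of_lipschitz hL (x₀ := t)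
    rwa [Real.coe_toNNReal v hv.le] at this
  · have := ((hL.lipschitzOnWith (s := Set.uIcc 0 t)).absolutelyContinuousOnInterval
      ).integral_deriv_eq_sub
    rw [this]
    simp [hy, hz]

/-- Reachability from `z` is the pairwise cone condition with `z` added to the points, so one
Lipschitz graph passes through the start and all the targets. -/
lemma IsCausal.exists_isFeasible {v ℓ : ℝ} (hv : 0 < v) {z : ℝ × ℝ} {q : ℕ → ℝ × ℝ}
    {I : Finset ℕ} (hI : IsCausal z ℓ q I) :
    ∃ x, IsFeasible v (ℓ / v) z x ∧ ∀ i ∈ I, q i ∈ x '' Icc 0 (ℓ / v) := by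
  classical
  have hpos : ∀ i ∈ I, 0 ≤ (q i).1 - z.1 := fun i hi => (abs_nonneg _).trans (hI.1 i hi).1
  obtain ⟨f, hf, hfS⟩ := exists_lipschitzWith_one (S := insert z (I.image q))
    ⟨z, Finset.mem_insert_self _ _⟩ (by
      intro a ha b hb
      rw [Finset.mem_insert, Finset.mem_image] at ha hb
      rcases ha with rfl | ⟨i, hi, rfl⟩ <;> rcases hb with rfl | ⟨j, hj, rfl⟩
      · simp
      · rw [abs_sub_comm, abs_sub_comm a.1]
        exact (hI.1 j hj).1.trans (le_abs_self _)
      · exact (hI.1 i hi).1.trans (le_abs_self _)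
      · exact hI.2 i hi j hj)
  refine ⟨_, MaxReward.exists_isFeasible hv z hf (hfS z (Finset.mem_insert_self _ _)), ?_⟩
  intro i hi
  have h1 : z.1 + v * (((q i).1 - z.1) / v) = (q i).1 := by field_simp; ring
  refine ⟨((q i).1 - z.1) / v, ⟨div_nonneg (hpos i hi) hv.le, ?_⟩, ?_⟩
  · exact (div_le_div_iff_of_pos_right hv).2 (hI.1 i hi).2
  · simp only [h1]
    rw [hfS (q i) (Finset.mem_insert_of_mem (Finset.mem_image_of_mem q hi))]

lemma collected_eq_iSup (q : ℕ → ℝ × ℝ) (m : ℕ → ℝ≥0) (τ : ℝ) (x : ℝ → ℝ × ℝ) :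
    collected q m τ x
      = ⨆ (I : Finset ℕ) (_ : ∀ i ∈ I, q i ∈ x '' Icc 0 τ), ∑ i ∈ I, (m i : ℝ≥0∞) := by
  classical
  rw [collected]
  refine le_antisymm ?_ (iSup₂_le fun I hI => ?_)
  · rw [ENNReal.tsum_eq_iSup_sum]
    refine iSup_le fun s => ?_
    refine le_iSup₂_of_le (s.map (Function.Embedding.subtype _)) ?_ ?_
    · intro i hi
      rw [Finset.mem_map] at hi
      obtain ⟨a, -, rfl⟩ := hi
      exact a.2
    · rw [Finset.sum_map]
      exact le_rfl
  · have h1 := ENNReal.sum_le_tsum (f := fun i : {i : ℕ // q i ∈ x '' Icc 0 τ} => (m i : ℝ≥0∞))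
      (I.subtype fun i => q i ∈ x '' Icc 0 τ)
    refine le_trans (le_of_eq ?_) h1
    rw [Finset.sum_subtype_eq_sum_filter (f := fun i => (m i : ℝ≥0∞)),
      Finset.filter_true_of_mem hI]

lemma collected_le_best {v ℓ : ℝ} (hv : 0 < v) {z : ℝ × ℝ} {x : ℝ → ℝ × ℝ}
    (hx : IsFeasible v (ℓ / v) z x) (q : ℕ → ℝ × ℝ) (m : ℕ → ℝ≥0) :
    collected q m (ℓ / v) x ≤ best z ℓ q m := by
  rw [collected_eq_iSup]
  exact iSup₂_le fun I hI => le_iSup₂_of_le I (isCausal_of_visited hv hx hI) le_rfl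

lemma best_le_of_forall_collected_le {v ℓ : ℝ} (hv : 0 < v) {z : ℝ × ℝ} {q : ℕ → ℝ × ℝ}
    {m : ℕ → ℝ≥0} {c : ℝ≥0∞}
    (h : ∀ x, IsFeasible v (ℓ / v) z x → collected q m (ℓ / v) x ≤ c) : best z ℓ q m ≤ c := by
  refine iSup₂_le fun I hI => ?_
  obtain ⟨x, hx, hxI⟩ := hI.exists_isFeasible hv
  refine le_trans ?_ (h x hx)
  rw [collected_eq_iSup]
  exact le_iSup₂_of_le I hxI le_rfl

/-- This removes the trajectories: the supremum over a function space becomes one over the countably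
many finite sets of indices. -/
lemma optimalTotal_eq_best {v : ℝ} (hv : 0 < v) (L : ℝ) (q : ℕ → ℝ × ℝ) (m : ℕ → ℝ≥0) :
    optimalTotal q m v L = best 0 L q m :=
  le_antisymm (iSup₂_le fun _ hx => collected_le_best hv hx q m)
    (best_le_of_forall_collected_le hv fun x hx => le_iSup₂_of_le x hx le_rfl)

/-- For each of the countably many `I`, causality is a finite system of measurable inequalities. The
start may be random, as it is for the iterations of the algorithm. -/
lemma measurable_best {Ω : Type*} [MeasurableSpace Ω] {z : Ω → ℝ × ℝ} (hz : Measurable z) (ℓ : ℝ)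
    {q : ℕ → Ω → ℝ × ℝ} (hq : ∀ i, Measurable (q i)) {m : ℕ → Ω → ℝ≥0}
    (hm : ∀ i, Measurable (m i)) :
    Measurable fun ω => best (z ω) ℓ (fun i => q i ω) (fun i => m i ω) := by
  classical
  refine Measurable.iSup fun I => ?_
  have h1 : MeasurableSet {ω | IsCausal (z ω) ℓ (fun i => q i ω) I} := by
    have h2 : ∀ i, MeasurableSet {ω | |(q i ω).2 - (z ω).2| ≤ (q i ω).1 - (z ω).1 ∧
        (q i ω).1 - (z ω).1 ≤ ℓ} := fun i => by
      have := hq i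
      exact MeasurableSet.inter (s₁ := {ω | |(q i ω).2 - (z ω).2| ≤ (q i ω).1 - (z ω).1})
        (s₂ := {ω | (q i ω).1 - (z ω).1 ≤ ℓ}) (measurableSet_le (by fun_prop) (by fun_prop))
        (measurableSet_le (by fun_prop) (by fun_prop))
    have h3 : ∀ i j, MeasurableSet {ω | |(q i ω).2 - (q j ω).2| ≤ |(q i ω).1 - (q j ω).1|} :=
      fun i j => by
        have := hq i
        have := hq j
        exact measurableSet_le (by fun_prop) (by fun_prop)
    have : {ω | IsCausal (z ω) ℓ (fun i => q i ω) I}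
        = (⋂ i ∈ I, {ω | |(q i ω).2 - (z ω).2| ≤ (q i ω).1 - (z ω).1 ∧ (q i ω).1 - (z ω).1 ≤ ℓ}) ∩
          ⋂ i ∈ I, ⋂ j ∈ I, {ω | |(q i ω).2 - (q j ω).2| ≤ |(q i ω).1 - (q j ω).1|} := by
      ext ω
      simp [IsCausal]
    rw [this]
    exact (Finset.measurableSet_biInter _ fun i _ => h2 i).inter
      (Finset.measurableSet_biInter _ fun i _ => Finset.measurableSet_biInter _ fun j _ => h3 i j)
  have h4 : (fun ω => ⨆ (_ : IsCausal (z ω) ℓ (fun i => q i ω) I), ∑ i ∈ I, (m i ω : ℝ≥0∞))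
      = {ω | IsCausal (z ω) ℓ (fun i => q i ω) I}.indicator fun ω => ∑ i ∈ I, (m i ω : ℝ≥0∞) := by
    ext ω
    by_cases h : IsCausal (z ω) ℓ (fun i => q i ω) I <;> simp [h]
  rw [h4]
  exact (Finset.measurable_fun_sum I fun i _ => (hm i).coe_nnreal_ennreal).indicator h1

lemma best_translate (z : ℝ × ℝ) (ℓ : ℝ) (q : ℕ → ℝ × ℝ) (m : ℕ → ℝ≥0) :
    best 0 ℓ (fun i => q i - z) m = best z ℓ q m := by
  simp [best, IsCausal]

lemma isCausal_smul {c : ℝ} (hc : 0 < c) {ℓ : ℝ} {q : ℕ → ℝ × ℝ} {I : Finset ℕ} :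
    IsCausal 0 (c * ℓ) (fun i => c • q i) I ↔ IsCausal 0 ℓ q I := by
  simp only [IsCausal, Prod.snd_zero, Prod.fst_zero, sub_zero, Prod.smul_fst, Prod.smul_snd,
    smul_eq_mul, ← mul_sub, abs_mul, abs_of_pos hc, mul_le_mul_iff_right₀ hc]

lemma best_smul {c : ℝ} (hc : 0 < c) (ℓ : ℝ) (q : ℕ → ℝ × ℝ) (m : ℕ → ℝ≥0) :
    best 0 (c * ℓ) (fun i => c • q i) m = best 0 ℓ q m := by
  simp only [best, isCausal_smul hc]

lemma best_mul (z : ℝ × ℝ) (ℓ : ℝ) (q : ℕ → ℝ × ℝ) (m : ℕ → ℝ≥0) (s : ℝ≥0) :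
    best z ℓ q (fun i => s * m i) = s * best z ℓ q m := by
  simp only [best, ENNReal.mul_iSup, Finset.mul_sum, ENNReal.coe_mul]

lemma best_mono (z : ℝ × ℝ) (ℓ : ℝ) (q : ℕ → ℝ × ℝ) {m m' : ℕ → ℝ≥0} (h : ∀ i, m i ≤ m' i) :
    best z ℓ q m ≤ best z ℓ q m' :=
  iSup₂_mono fun _ _ => Finset.sum_le_sum fun i _ => ENNReal.coe_le_coe.2 (h i)

/-- A run may be preceded by a run leading to its start. -/
lemma best_le_best_of_start {z z' : ℝ × ℝ} {ℓ ℓ' : ℝ} (h : |z.2 - z'.2| ≤ z.1 - z'.1)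
    (hℓ : ℓ + (z.1 - z'.1) ≤ ℓ') (q : ℕ → ℝ × ℝ) (m : ℕ → ℝ≥0) :
    best z ℓ q m ≤ best z' ℓ' q m := by
  refine iSup₂_le fun I hI => le_iSup₂_of_le I ⟨fun i hi => ⟨?_, ?_⟩, hI.2⟩ le_rfl
  · have := abs_sub_le (q i).2 z.2 z'.2
    have := (hI.1 i hi).1
    linarith
  · have := (hI.1 i hi).2
    linarith

/-- Targets that cannot be reached do not matter. -/
lemma best_congr {z : ℝ × ℝ} {ℓ : ℝ} {q : ℕ → ℝ × ℝ} {m m' : ℕ → ℝ≥0}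
    (h : ∀ i, |(q i).2 - z.2| ≤ (q i).1 - z.1 → (q i).1 - z.1 ≤ ℓ → m i = m' i) :
    best z ℓ q m = best z ℓ q m' :=
  iSup_congr fun _ => iSup_congr fun hI => Finset.sum_congr rfl fun i hi => by
    rw [h i (hI.1 i hi).1 (hI.1 i hi).2]

/-! ### The optimal reward as a limit of functions of finitely many cell totals -/

/-- A box containing all points which can be reached from the origin in a run of length `L`. -/
def box (L : ℝ) : Set (ℝ × ℝ) := Icc 0 L ×ˢ Icc (-L) L

lemma measurableSet_box (L : ℝ) : MeasurableSet (box L) := measurableSet_Icc.prod measurableSet_Icc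

lemma volume_box {L : ℝ} (hL : 0 ≤ L) : volume (box L) = ENNReal.ofReal (2 * L ^ 2) := by
  rw [box, Measure.volume_eq_prod, Measure.prod_prod, Real.volume_Icc, Real.volume_Icc,
    ← ENNReal.ofReal_mul (by linarith)]
  congr 1
  ring

lemma volume_box_ne_top (L : ℝ) : volume (box L) ≠ ∞ := by
  rw [box, Measure.volume_eq_prod, Measure.prod_prod, Real.volume_Icc, Real.volume_Icc]
  exact ENNReal.mul_ne_top ENNReal.ofReal_ne_top ENNReal.ofReal_ne_top

lemma mem_box {L : ℝ} {x : ℝ × ℝ} (h1 : |x.2| ≤ x.1) (h2 : x.1 ≤ L) : x ∈ box L :=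
  ⟨⟨(abs_nonneg _).trans h1, h2⟩, abs_le.1 (h1.trans h2)⟩

/-- The dyadic cell of level `n` containing `x`. -/
noncomputable def cell (n : ℕ) (x : ℝ × ℝ) : ℤ × ℤ := (⌊2 ^ n * x.1⌋, ⌊2 ^ n * x.2⌋)

lemma measurable_cell (n : ℕ) : Measurable (cell n) := by
  unfold cell
  fun_prop

/-- The cells of level `n` which may meet the box. -/
noncomputable def cells (n : ℕ) (L : ℝ) : Finset (ℤ × ℤ) :=
  Finset.Icc (0, ⌊2 ^ n * (-L)⌋) (⌊2 ^ n * L⌋, ⌊2 ^ n * L⌋)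

lemma cell_mem_cells {n : ℕ} {L : ℝ} {x : ℝ × ℝ} (hx : x ∈ box L) : cell n x ∈ cells n L := by
  obtain ⟨⟨h1, h2⟩, h3, h4⟩ := hx
  have hp : (0 : ℝ) < 2 ^ n := by positivity
  rw [cells, Finset.mem_Icc]
  refine ⟨⟨?_, ?_⟩, ?_, ?_⟩
  · exact Int.floor_nonneg.2 (by positivity)
  · exact Int.floor_le_floor ((mul_le_mul_iff_right₀ hp).2 h3)
  · exact Int.floor_le_floor ((mul_le_mul_iff_right₀ hp).2 h2)
  · exact Int.floor_le_floor ((mul_le_mul_iff_right₀ hp).2 h4)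

/-- Sets of cells which are causal up to an error of two cells. -/
def IsNearlyCausal (Q : Finset (ℤ × ℤ)) : Prop :=
  (∀ a ∈ Q, |a.2| ≤ a.1 + 2) ∧ ∀ a ∈ Q, ∀ b ∈ Q, |a.2 - b.2| ≤ |a.1 - b.1| + 2

/-- The part of the box in the cell `a`. -/
def boxCell (n : ℕ) (L : ℝ) (a : ℤ × ℤ) : Set (ℝ × ℝ) := box L ∩ cell n ⁻¹' {a}

lemma measurableSet_boxCell (n : ℕ) (L : ℝ) (a : ℤ × ℤ) : MeasurableSet (boxCell n L a) :=
  (measurableSet_box L).inter (measurable_cell n (measurableSet_singleton a))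

/-- The total reward in a set `B`. -/
noncomputable def total (B : Set (ℝ × ℝ)) (q : ℕ → ℝ × ℝ) (m : ℕ → ℝ≥0) : ℝ≥0∞ :=
  ∑' i, B.indicator (fun _ => 1) (q i) * m i

/-- The maximal total over nearly causal sets of cells, as a function of the cell totals. -/
noncomputable def cellMax (n : ℕ) (L : ℝ) (y : cells n L → ℝ≥0∞) : ℝ≥0∞ :=
  ⨆ (Q : Finset (cells n L)) (_ : IsNearlyCausal (Q.map (Function.Embedding.subtype _))),
    ∑ a ∈ Q, y a

lemma measurable_cellMax (n : ℕ) (L : ℝ) : Measurable (cellMax n L) := by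
  refine Measurable.iSup fun Q => Measurable.iSup fun _ => ?_
  exact Finset.measurable_fun_sum Q fun a _ => measurable_pi_apply a

/-- Rounding changes each of the two differences by less than one, whence the slack of two in
`IsNearlyCausal`. -/
lemma abs_floor_sub_floor_le {a b c d t : ℝ} (h : |a - b| ≤ |c - d|) :
    |⌊t * a⌋ - ⌊t * b⌋| ≤ |⌊t * c⌋ - ⌊t * d⌋| + 2 := by
  have h1 : |t * a - t * b| ≤ |t * c - t * d| := by
    rw [← mul_sub, ← mul_sub, abs_mul, abs_mul]
    exact mul_le_mul_of_nonneg_left h (abs_nonneg t)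
  have key : |(⌊t * a⌋ : ℝ) - ⌊t * b⌋| < |(⌊t * c⌋ : ℝ) - ⌊t * d⌋| + 2 := by
    have a1 := Int.floor_le (t * a)
    have a2 := Int.lt_floor_add_one (t * a)
    have b1 := Int.floor_le (t * b)
    have b2 := Int.lt_floor_add_one (t * b)
    have c1 := Int.floor_le (t * c)
    have c2 := Int.lt_floor_add_one (t * c)
    have d1 := Int.floor_le (t * d)
    have d2 := Int.lt_floor_add_one (t * d)
    have e1 : |t * c - t * d| < |(⌊t * c⌋ - ⌊t * d⌋ : ℝ)| + 1 := by
      rw [abs_lt]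
      constructor
      · have := neg_abs_le (⌊t * c⌋ - ⌊t * d⌋ : ℝ); linarith
      · have := le_abs_self (⌊t * c⌋ - ⌊t * d⌋ : ℝ); linarith
    obtain ⟨f1, f2⟩ := abs_le.1 h1
    rw [abs_lt]
    constructor <;> linarith
  have : ((|⌊t * a⌋ - ⌊t * b⌋| : ℤ) : ℝ) < ((|⌊t * c⌋ - ⌊t * d⌋| + 2 : ℤ) : ℝ) := by
    push_cast
    exact key
  exact (Int.cast_lt.1 this).le

/-- Undoing the rounding costs at most two more, so the total slack in the scaled coordinates is
four. -/
lemma le_of_abs_floor_sub_floor_le {a b c d t : ℝ}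
    (h : |⌊t * a⌋ - ⌊t * b⌋| ≤ |⌊t * c⌋ - ⌊t * d⌋| + 2) (ht : 0 ≤ t) :
    t * |a - b| ≤ t * |c - d| + 4 := by
  have h' : ((|⌊t * a⌋ - ⌊t * b⌋| : ℤ) : ℝ) ≤ ((|⌊t * c⌋ - ⌊t * d⌋| + 2 : ℤ) : ℝ) :=
    Int.cast_le.2 h
  push_cast at h'
  have e0 : ∀ a b : ℝ, t * |a - b| = |t * a - t * b| := fun a b => by
    rw [← mul_sub, abs_mul, abs_of_nonneg ht]
  rw [e0, e0]
  have a1 := Int.floor_le (t * a)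
  have a2 := Int.lt_floor_add_one (t * a)
  have b1 := Int.floor_le (t * b)
  have b2 := Int.lt_floor_add_one (t * b)
  have c1 := Int.floor_le (t * c)
  have c2 := Int.lt_floor_add_one (t * c)
  have d1 := Int.floor_le (t * d)
  have d2 := Int.lt_floor_add_one (t * d)
  have e1 : |(⌊t * c⌋ - ⌊t * d⌋ : ℝ)| ≤ |t * c - t * d| + 1 := by
    rw [abs_le]
    constructor
    · have := neg_abs_le (t * c - t * d); linarith
    · have := le_abs_self (t * c - t * d); linarith
  obtain ⟨f1, f2⟩ := abs_le.1 h'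
  rw [abs_le]
  constructor <;> linarith

lemma isNearlyCausal_image {L : ℝ} {q : ℕ → ℝ × ℝ} {I : Finset ℕ} (hI : IsCausal 0 L q I) (n : ℕ) :
    IsNearlyCausal (I.image fun i => cell n (q i)) := by
  constructor
  · intro a ha
    obtain ⟨i, hi, rfl⟩ := Finset.mem_image.1 ha
    have h1 := (hI.1 i hi).1
    simp only [Prod.snd_zero, Prod.fst_zero, sub_zero] at h1
    have h0 : 0 ≤ (q i).1 := (abs_nonneg _).trans h1
    have h2 := abs_floor_sub_floor_le (b := 0) (d := 0) (c := (q i).1) (a := (q i).2)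
      (t := 2 ^ n) (by simpa [abs_of_nonneg h0] using h1)
    simp only [mul_zero, Int.floor_zero, sub_zero] at h2
    rwa [abs_of_nonneg (a := ⌊2 ^ n * (q i).1⌋) (Int.floor_nonneg.2 (by positivity))] at h2
  · intro a ha b hb
    obtain ⟨i, hi, rfl⟩ := Finset.mem_image.1 ha
    obtain ⟨j, hj, rfl⟩ := Finset.mem_image.1 hb
    exact abs_floor_sub_floor_le (hI.2 i hi j hj)

lemma IsCausal.mem_box {L : ℝ} {q : ℕ → ℝ × ℝ} {I : Finset ℕ} (hI : IsCausal 0 L q I) {i : ℕ}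
    (hi : i ∈ I) : q i ∈ box L := by
  have h1 := hI.1 i hi
  simp only [Prod.snd_zero, Prod.fst_zero, sub_zero] at h1
  exact MaxReward.mem_box h1.1 h1.2

lemma sum_le_total {B : Set (ℝ × ℝ)} {q : ℕ → ℝ × ℝ} {m : ℕ → ℝ≥0} {I : Finset ℕ}
    (hI : ∀ i ∈ I, q i ∈ B) : ∑ i ∈ I, (m i : ℝ≥0∞) ≤ total B q m := by
  refine le_trans (le_of_eq ?_) (ENNReal.sum_le_tsum I)
  exact Finset.sum_congr rfl fun i hi => by simp [hI i hi]

lemma sum_total_boxCell (n : ℕ) (L : ℝ) (q : ℕ → ℝ × ℝ) (m : ℕ → ℝ≥0) (Q : Finset (ℤ × ℤ)) :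
    ∑ a ∈ Q, total (boxCell n L a) q m = total (box L ∩ cell n ⁻¹' Q) q m := by
  classical
  simp only [total]
  rw [← Summable.tsum_finsetSum fun _ _ => ENNReal.summable]
  refine tsum_congr fun i => ?_
  rw [← Finset.sum_mul]
  congr 1
  by_cases hb : q i ∈ box L
  · simp [boxCell, Set.indicator_apply, hb]
  · simp [boxCell, hb]

lemma total_mono {B C : Set (ℝ × ℝ)} (h : B ⊆ C) (q : ℕ → ℝ × ℝ) (m : ℕ → ℝ≥0) :
    total B q m ≤ total C q m :=
  ENNReal.tsum_le_tsum fun i => mul_le_mul_left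
    (Set.indicator_le_indicator_of_subset h (fun _ => zero_le) (q i)) _

lemma cellMax_eq (n : ℕ) (L : ℝ) (q : ℕ → ℝ × ℝ) (m : ℕ → ℝ≥0) :
    cellMax n L (fun a => total (boxCell n L a) q m)
      = ⨆ (Q : Finset (cells n L)) (_ : IsNearlyCausal (Q.map (Function.Embedding.subtype _))),
        total (box L ∩ cell n ⁻¹' (Q.map (Function.Embedding.subtype _))) q m := by
  refine iSup_congr fun Q => iSup_congr fun _ => ?_
  rw [← sum_total_boxCell, Finset.sum_map]
  rfl

lemma cellMax_le_total (n : ℕ) (L : ℝ) (q : ℕ → ℝ × ℝ) (m : ℕ → ℝ≥0) :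
    cellMax n L (fun a => total (boxCell n L a) q m) ≤ total (box L) q m := by
  rw [cellMax_eq]
  exact iSup₂_le fun Q _ => total_mono Set.inter_subset_left q m

/-- The cells met by a causal set of targets are nearly causal, and their totals include all rewards
of the set. -/
lemma best_le_cellMax (n : ℕ) (L : ℝ) (q : ℕ → ℝ × ℝ) (m : ℕ → ℝ≥0) :
    best 0 L q m ≤ cellMax n L (fun a => total (boxCell n L a) q m) := by
  classical
  rw [cellMax_eq]
  refine iSup₂_le fun I hI => ?_
  have himg : ((I.image fun i => cell n (q i)).subtype (· ∈ cells n L)).map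
      (Function.Embedding.subtype _) = I.image fun i => cell n (q i) := by
    rw [Finset.subtype_map, Finset.filter_true_of_mem]
    intro a ha
    obtain ⟨i, hi, rfl⟩ := Finset.mem_image.1 ha
    exact cell_mem_cells (hI.mem_box hi)
  refine le_iSup₂_of_le ((I.image fun i => cell n (q i)).subtype (· ∈ cells n L)) ?_ ?_
  · rw [himg]
    exact isNearlyCausal_image hI n
  · rw [himg]
    refine sum_le_total fun i hi => ⟨hI.mem_box hi, ?_⟩
    exact Finset.mem_coe.2 (Finset.mem_image_of_mem _ hi)

lemma eventually_lt_two_pow_mul {d : ℝ} (hd : 0 < d) : ∀ᶠ n : ℕ in atTop, 4 < 2 ^ n * d := by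
  have : Tendsto (fun n : ℕ => (2 : ℝ) ^ n * d) atTop atTop :=
    (tendsto_pow_atTop_atTop_of_one_lt one_lt_two).atTop_mul_const hd
  exact this.eventually_gt_atTop 4

/-- With finitely many targets in the box, every violated causality inequality is violated by a
fixed margin, which exceeds the error `4 / 2 ^ n` for large `n`. From then on, all targets in a
nearly causal set of cells form a causal set. -/
lemma eventually_cellMax_le_best (L : ℝ) (q : ℕ → ℝ × ℝ) (m : ℕ → ℝ≥0)
    (hfin : {i | q i ∈ box L}.Finite) :
    ∀ᶠ n in atTop, cellMax n L (fun a => total (boxCell n L a) q m) ≤ best 0 L q m := by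
  classical
  set J := hfin.toFinset with hJ
  have hmemJ : ∀ i, i ∈ J ↔ q i ∈ box L := fun i => by simp [hJ]
  have h1 : ∀ᶠ n : ℕ in atTop, ∀ i ∈ J, ∀ j ∈ J, |(q i).1 - (q j).1| < |(q i).2 - (q j).2| →
      4 < 2 ^ n * (|(q i).2 - (q j).2| - |(q i).1 - (q j).1|) := by
    rw [Filter.eventually_all_finset]
    intro i _
    rw [Filter.eventually_all_finset]
    intro j _
    by_cases h : |(q i).1 - (q j).1| < |(q i).2 - (q j).2|
    · filter_upwards [eventually_lt_two_pow_mul (sub_pos.2 h)] with n hn _ using hn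
    · exact Eventually.of_forall fun n h' => absurd h' h
  have h2 : ∀ᶠ n : ℕ in atTop, ∀ i ∈ J, (q i).1 < |(q i).2| →
      4 < 2 ^ n * (|(q i).2| - (q i).1) := by
    rw [Filter.eventually_all_finset]
    intro i _
    by_cases h : (q i).1 < |(q i).2|
    · filter_upwards [eventually_lt_two_pow_mul (sub_pos.2 h)] with n hn _ using hn
    · exact Eventually.of_forall fun n h' => absurd h' h
  filter_upwards [h1, h2] with n hn1 hn2
  have hp : (0 : ℝ) ≤ 2 ^ n := by positivity
  rw [cellMax_eq]
  refine iSup₂_le fun Q hQ => ?_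
  set Q' := Q.map (Function.Embedding.subtype _) with hQ'
  set I := J.filter fun i => cell n (q i) ∈ Q' with hI
  have hcausal : IsCausal 0 L q I := by
    constructor
    · intro i hi
      obtain ⟨hiJ, hiQ⟩ := Finset.mem_filter.1 hi
      have hbox := (hmemJ i).1 hiJ
      simp only [Prod.snd_zero, Prod.fst_zero, sub_zero]
      refine ⟨?_, hbox.1.2⟩
      by_contra! hcon
      have h3 := hn2 i hiJ hcon
      have h4 := hQ.1 _ hiQ
      have h0 : 0 ≤ (q i).1 := hbox.1.1
      have h5 := le_of_abs_floor_sub_floor_le (b := 0) (d := 0) (c := (q i).1) (a := (q i).2)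
        (t := 2 ^ n) (by
          simp only [mul_zero, Int.floor_zero, sub_zero]
          rw [abs_of_nonneg (a := ⌊2 ^ n * (q i).1⌋) (Int.floor_nonneg.2 (by positivity))]
          exact h4) hp
      simp only [sub_zero] at h5
      rw [abs_of_nonneg h0] at h5
      linarith
    · intro i hi j hj
      obtain ⟨hiJ, hiQ⟩ := Finset.mem_filter.1 hi
      obtain ⟨hjJ, hjQ⟩ := Finset.mem_filter.1 hj
      by_contra! hcon
      have h3 := hn1 i hiJ j hjJ hcon
      have h5 := le_of_abs_floor_sub_floor_le (hQ.2 _ hiQ _ hjQ) hp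
      linarith
  refine le_iSup₂_of_le I hcausal (le_of_eq ?_)
  rw [total, tsum_eq_sum (s := J)]
  · rw [hI, Finset.sum_filter]
    refine Finset.sum_congr rfl fun i hi => ?_
    have hb := (hmemJ i).1 hi
    by_cases hc : cell n (q i) ∈ Q'
    · have : q i ∈ box L ∩ cell n ⁻¹' Q' := ⟨hb, Finset.mem_coe.2 hc⟩
      rw [Set.indicator_of_mem this, if_pos hc, one_mul]
    · have : q i ∉ box L ∩ cell n ⁻¹' Q' := fun h' => hc (Finset.mem_coe.1 h'.2)
      rw [Set.indicator_of_notMem this, if_neg hc, zero_mul]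
  · intro i hi
    rw [Set.indicator_of_notMem fun h' => hi ((hmemJ i).2 h'.1), zero_mul]

/-! ### The law of the optimal reward is determined by the Laplace functional -/

/-- A random configuration of marked points with integrable total reward in `box L`. -/
structure IsRegular {Ω : Type*} [MeasurableSpace Ω] (P : Measure Ω) (L : ℝ)
    (q : ℕ → Ω → ℝ × ℝ) (m : ℕ → Ω → ℝ≥0) : Prop where
  measurable_loc : ∀ i, Measurable (q i)
  measurable_mark : ∀ i, Measurable (m i)
  finite : ∀ᵐ ω ∂P, {i | q i ω ∈ box L}.Finite
  integrable : ∫⁻ ω, total (box L) (fun i => q i ω) (fun i => m i ω) ∂P ≠ ∞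

section

variable {Ω : Type*} [MeasurableSpace Ω] {P : Measure Ω} {L : ℝ}
  {q : ℕ → Ω → ℝ × ℝ} {m : ℕ → Ω → ℝ≥0}

lemma IsRegular.measurable_total (h : IsRegular P L q m) {B : Set (ℝ × ℝ)} (hB : MeasurableSet B) :
    Measurable fun ω => total B (fun i => q i ω) (fun i => m i ω) :=
  Measurable.tsum fun i => ((measurable_const.indicator hB).comp (h.measurable_loc i)).mul
    (h.measurable_mark i).coe_nnreal_ennreal

/-- Almost surely the approximation is eventually exact, and it is dominated by the integrable total
of the box. -/
lemma IsRegular.tendsto_cellMax (h : IsRegular P L q m) :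
    Tendsto (fun n => ∫⁻ ω, cellMax n L (fun a => total (boxCell n L a) (fun i => q i ω)
        (fun i => m i ω)) ∂P) atTop
      (𝓝 (∫⁻ ω, best 0 L (fun i => q i ω) (fun i => m i ω) ∂P)) := by
  refine tendsto_lintegral_of_dominated_convergence
    (fun ω => total (box L) (fun i => q i ω) (fun i => m i ω)) (fun n => ?_)
    (fun n => Eventually.of_forall fun ω => cellMax_le_total n L _ _) h.integrable ?_
  · exact (measurable_cellMax n L).comp (measurable_pi_lambda _ fun a =>
      h.measurable_total (measurableSet_boxCell n L a))
  · filter_upwards [h.finite] with ω hω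
    refine tendsto_const_nhds.congr' ?_
    filter_upwards [eventually_cellMax_le_best L (fun i => q i ω) (fun i => m i ω) hω] with n hn
    exact le_antisymm (best_le_cellMax n L _ _) hn

end

/-- Step functions on the cells as test functions give the joint law of the cell totals, hence the
expectation of `cellMax`; then `n → ∞`. As the rewards enter the test sums linearly, a target of
reward zero is invisible, so thinning can be done by setting rewards to zero. -/
theorem lintegral_best_eq_of_laplace {Ω Ω' : Type*} [MeasurableSpace Ω] [MeasurableSpace Ω']
    {P : Measure Ω} {P' : Measure Ω'} [IsProbabilityMeasure P] [IsProbabilityMeasure P'] {L : ℝ}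
    {q : ℕ → Ω → ℝ × ℝ} {m : ℕ → Ω → ℝ≥0} {q' : ℕ → Ω' → ℝ × ℝ} {m' : ℕ → Ω' → ℝ≥0}
    (h : IsRegular P L q m) (h' : IsRegular P' L q' m')
    (hl : ∀ f : ℝ × ℝ → ℝ≥0∞, Measurable f →
      ∫⁻ ω, nexp (∑' i, f (q i ω) * m i ω) ∂P = ∫⁻ ω, nexp (∑' i, f (q' i ω) * m' i ω) ∂P') :
    ∫⁻ ω, best 0 L (fun i => q i ω) (fun i => m i ω) ∂P
      = ∫⁻ ω, best 0 L (fun i => q' i ω) (fun i => m' i ω) ∂P' := by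
  refine tendsto_nhds_unique h.tendsto_cellMax (h'.tendsto_cellMax.congr fun n => ?_)
  have hv : Measurable fun ω => fun a : cells n L =>
      total (boxCell n L a) (fun i => q i ω) (fun i => m i ω) :=
    measurable_pi_lambda _ fun a => h.measurable_total (measurableSet_boxCell n L a)
  have hv' : Measurable fun ω => fun a : cells n L =>
      total (boxCell n L a) (fun i => q' i ω) (fun i => m' i ω) :=
    measurable_pi_lambda _ fun a => h'.measurable_total (measurableSet_boxCell n L a)
  rw [← lintegral_map (measurable_cellMax n L) hv, ← lintegral_map (measurable_cellMax n L) hv']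
  have := Measure.isProbabilityMeasure_map (μ := P) hv.aemeasurable
  have := Measure.isProbabilityMeasure_map (μ := P') hv'.aemeasurable
  congr 1
  refine measure_ext_of_lintegral_nexp fun t => ?_
  have hm : Measurable fun x : cells n L → ℝ≥0∞ => nexp (∑ j, t j * x j) := by fun_prop
  rw [lintegral_map hm hv, lintegral_map hm hv']
  let f : ℝ × ℝ → ℝ≥0∞ := fun x => ∑ a : cells n L, t a * (boxCell n L a).indicator (fun _ => 1) x
  have hf : Measurable f := Finset.measurable_fun_sum _ fun a _ =>
    (measurable_const.indicator (measurableSet_boxCell n L a)).const_mul _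
  have key : ∀ (x : ℕ → ℝ × ℝ) (y : ℕ → ℝ≥0),
      ∑ a : cells n L, t a * total (boxCell n L a) x y = ∑' i, f (x i) * y i := by
    intro x y
    simp only [total, f, ← ENNReal.tsum_mul_left, Finset.sum_mul]
    rw [← Summable.tsum_finsetSum fun _ _ => ENNReal.summable]
    simp only [mul_assoc]
  simp_rw [key]
  exact (hl f hf).symm

section Transform

variable {Ω : Type*} [MeasurableSpace Ω] {P : Measure Ω} {lam : ℝ≥0} {xm α : ℝ}
  {p : ℕ → Ω → ℝ × ℝ} {r : ℕ → Ω → ℝ≥0}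

/-! ### Transformations of the target field -/

/-- Zooming by `c` at `z` and reducing the rewards keeps a target field regular. -/
lemma IsParetoField.isRegular [IsProbabilityMeasure P] (h : IsParetoField P lam xm α p r)
    (hxm : 0 < xm) (hα : 1 < α) (L : ℝ) {c : ℝ} (hc : c ≠ 0) (z : ℝ × ℝ)
    {φ : (ℝ × ℝ) × ℝ≥0 → ℝ≥0} (hφ : Measurable φ) (hle : ∀ x u, φ (x, u) ≤ u) :
    IsRegular P L (fun i ω => c • (p i ω - z)) (fun i ω => φ (p i ω, r i ω)) := by
  set T : ℝ × ℝ → ℝ × ℝ := fun x => c • (x - z) with hT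
  have hTm : Measurable T := by fun_prop
  have hBm : MeasurableSet (T ⁻¹' box L) := hTm (measurableSet_box L)
  have hv : volume (T ⁻¹' box L) ≠ ∞ := by
    have h1 : T ⁻¹' box L ⊆ (fun y => c⁻¹ • y + z) '' box L := fun x hx =>
      ⟨T x, hx, by simp [hT, smul_smul, inv_mul_cancel₀ hc]⟩
    have h2 : IsCompact ((fun y : ℝ × ℝ => c⁻¹ • y + z) '' box L) :=
      (isCompact_Icc.prod isCompact_Icc).image (by fun_prop)
    exact ((measure_mono h1).trans_lt h2.measure_lt_top).ne
  refine ⟨fun i => hTm.comp (h.poisson.measurable i), fun i => hφ.comp (h.measurable_pair i),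
    h.poisson.ae_finite hBm hv, ?_⟩
  refine ((lintegral_mono fun ω => ?_).trans_lt
    (lt_top_iff_ne_top.2 (?_ : ∫⁻ ω, ∑' i, (T ⁻¹' box L).indicator (fun _ => 1) (p i ω) *
      (r i ω : ℝ≥0∞) ∂P ≠ ∞))).ne
  · exact ENNReal.tsum_le_tsum fun i =>
      mul_le_mul (le_of_eq rfl) (ENNReal.coe_le_coe.2 (hle _ _)) zero_le zero_le
  · rw [h.lintegral_tsum_mul hBm hv measurable_coe_nnreal_ennreal]
    exact ENNReal.mul_ne_top (ENNReal.mul_ne_top ENNReal.coe_ne_top hv)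
      (lintegral_coe_markLaw_ne_top hxm hα)

lemma IsRegular.cond {L : ℝ} {m : ℕ → Ω → ℝ≥0} [IsFiniteMeasure P] (h : IsRegular P L p m)
    {A : Set Ω} (hA : P A ≠ 0) : IsRegular P[|A] L p m := by
  refine ⟨h.measurable_loc, h.measurable_mark,
    (cond_absolutelyContinuous (μ := P) (s := A)).ae_le h.finite, ?_⟩
  rw [ProbabilityTheory.cond, lintegral_smul_measure, smul_eq_mul]
  refine ENNReal.mul_ne_top (ENNReal.inv_ne_top.2 hA) ?_
  exact ((setLIntegral_le_lintegral _ _).trans_lt h.integrable.lt_top).ne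

lemma IsParetoField.isRegular_self [IsProbabilityMeasure P] (h : IsParetoField P lam xm α p r)
    (hxm : 0 < xm) (hα : 1 < α) (L : ℝ) : IsRegular P L p r := by
  have := h.isRegular hxm hα L one_ne_zero 0 (φ := Prod.snd) measurable_snd fun _ _ => le_rfl
  simpa using this

/-- The expectation of the optimal reward is the same for all target fields. -/
theorem IsParetoField.lintegral_best_eq [IsProbabilityMeasure P]
    (h : IsParetoField P lam xm α p r) (hxm : 0 < xm) (hα : 1 < α)
    {Ω' : Type*} [MeasurableSpace Ω'] {P' : Measure Ω'} [IsProbabilityMeasure P']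
    {p' : ℕ → Ω' → ℝ × ℝ} {r' : ℕ → Ω' → ℝ≥0} (h' : IsParetoField P' lam xm α p' r') (L : ℝ) :
    ∫⁻ ω, best 0 L (fun i => p i ω) (fun i => r i ω) ∂P
      = ∫⁻ ω, best 0 L (fun i => p' i ω) (fun i => r' i ω) ∂P' := by
  refine lintegral_best_eq_of_laplace (h.isRegular_self hxm hα L) (h'.isRegular_self hxm hα L)
    fun f hf => ?_
  have hF : Measurable fun y : (ℝ × ℝ) × ℝ≥0 => f y.1 * y.2 := by fun_prop
  exact (h.lintegral_nexp_tsum hF).trans (h'.lintegral_nexp_tsum hF).symm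

/-- The Laplace functional is invariant because Lebesgue measure is. -/
lemma IsParetoField.lintegral_best_translate [IsProbabilityMeasure P]
    (h : IsParetoField P lam xm α p r) (hxm : 0 < xm) (hα : 1 < α) (L : ℝ) (z : ℝ × ℝ) :
    ∫⁻ ω, best z L (fun i => p i ω) (fun i => r i ω) ∂P
      = ∫⁻ ω, best 0 L (fun i => p i ω) (fun i => r i ω) ∂P := by
  have hreg := h.isRegular hxm hα L one_ne_zero z (φ := Prod.snd) measurable_snd fun _ _ => le_rfl
  simp only [one_smul] at hreg
  simp_rw [← best_translate z]
  refine lintegral_best_eq_of_laplace hreg (h.isRegular_self hxm hα L) fun f hf => ?_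
  have hF : Measurable fun y : (ℝ × ℝ) × ℝ≥0 => f y.1 * y.2 := by fun_prop
  have hF' : Measurable fun y : (ℝ × ℝ) × ℝ≥0 => f (y.1 - z) * y.2 := by fun_prop
  refine (h.lintegral_nexp_tsum hF').trans ((h.lintegral_nexp_tsum hF).trans ?_).symm
  rw [← lintegral_sub_right_eq_self
    (fun x => ∫⁻ u, (1 - nexp (f x * (u : ℝ≥0))) ∂(markLaw xm α)) z]

lemma lintegral_comp_smul_plane {g : ℝ × ℝ → ℝ≥0∞} (hg : Measurable g) {c : ℝ} (hc : 0 < c) :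
    ENNReal.ofReal (c ^ 2) * ∫⁻ x, g (c • x) = ∫⁻ x, g x := by
  have hmap : Measure.map (fun x : ℝ × ℝ => c • x) volume
      = ENNReal.ofReal |(c ^ 2)⁻¹| • (volume : Measure (ℝ × ℝ)) := by
    have := Measure.map_addHaar_smul (volume : Measure (ℝ × ℝ)) hc.ne'
    simpa using this
  rw [← lintegral_map (f := g) (g := fun x : ℝ × ℝ => c • x) hg (by fun_prop), hmap,
    lintegral_smul_measure, smul_eq_mul, ← mul_assoc, ← ENNReal.ofReal_mul (by positivity),
    abs_of_pos (by positivity), mul_inv_cancel₀ (by positivity), ENNReal.ofReal_one, one_mul]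

/-- Zooming out and thinning out the small rewards reproduces the target field. -/
theorem IsParetoField.lintegral_best_scale [IsProbabilityMeasure P]
    (h : IsParetoField P lam xm α p r) (hxm : 0 < xm) (hα : 1 < α) (L : ℝ) {c : ℝ} (hc : 0 < c)
    (hc1 : c ≤ 1) :
    ∫⁻ ω, best 0 (c * L) (fun i => p i ω) (fun i => r i ω) ∂P
      ≤ ENNReal.ofReal (c ^ (2 / α)) * ∫⁻ ω, best 0 L (fun i => p i ω) (fun i => r i ω) ∂P := by
  have hα0 : 0 < α := by linarith
  -- Chosen so that `s ^ α = c ^ 2`: the fraction of rewards that survive the cut `xm ≤ s * u`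
  -- balances the increase of the intensity under contraction by `c`.
  set s : ℝ≥0 := ⟨c ^ (2 / α), by positivity⟩ with hs
  have hsc : (s : ℝ) = c ^ (2 / α) := rfl
  have hs0 : 0 < s := by
    rw [← NNReal.coe_pos, hsc]
    positivity
  have hs1 : s ≤ 1 := by
    rw [← NNReal.coe_le_coe, hsc]
    exact Real.rpow_le_one hc.le hc1 (by positivity)
  have hsα : (s : ℝ) ^ α = c ^ 2 := by
    rw [hsc, ← Real.rpow_mul hc.le, div_mul_cancel₀ _ hα0.ne', Real.rpow_two]
  have hms : MeasurableSet {u : ℝ≥0 | xm ≤ s * u} := measurableSet_le measurable_const (by fun_prop)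
  let φ : (ℝ × ℝ) × ℝ≥0 → ℝ≥0 := fun y => {u : ℝ≥0 | xm ≤ s * u}.indicator (fun u => s * u) y.2
  have hφ0 : Measurable ({u : ℝ≥0 | xm ≤ s * u}.indicator fun u => s * u) :=
    Measurable.indicator (by fun_prop) hms
  have hφ : Measurable φ := hφ0.comp measurable_snd
  have hφs : ∀ x u, φ (x, u) ≤ s * u := fun x u => Set.indicator_le_self _ _ _
  have hφle : ∀ x u, φ (x, u) ≤ u := fun x u => (hφs x u).trans (mul_le_of_le_one_left zero_le hs1)
  have hreg := h.isRegular hxm hα (c * L) hc.ne' 0 hφ hφle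
  simp only [sub_zero] at hreg
  have key : ∫⁻ ω, best 0 (c * L) (fun i => p i ω) (fun i => r i ω) ∂P
      = ∫⁻ ω, best 0 (c * L) (fun i => c • p i ω) (fun i => φ (p i ω, r i ω)) ∂P := by
    refine lintegral_best_eq_of_laplace (h.isRegular_self hxm hα _) hreg fun f hf => ?_
    have hF : Measurable fun y : (ℝ × ℝ) × ℝ≥0 => f y.1 * y.2 := by fun_prop
    have hF' : Measurable fun y : (ℝ × ℝ) × ℝ≥0 => f (c • y.1) * φ y := by fun_prop
    refine (h.lintegral_nexp_tsum hF).trans ((h.lintegral_nexp_tsum hF').trans ?_).symm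
    congr 2
    have h1 : ∀ x : ℝ × ℝ, ∫⁻ u, (1 - nexp (f (c • x) * φ (x, u))) ∂(markLaw xm α)
        = ENNReal.ofReal (c ^ 2) * ∫⁻ u, (1 - nexp (f (c • x) * (u : ℝ≥0))) ∂(markLaw xm α) := by
      intro x
      rw [← hsα, ← lintegral_markLaw_scale hxm hα hs0 hs1
        (φ := fun u => 1 - nexp (f (c • x) * (u : ℝ≥0))) (by fun_prop)]
      refine lintegral_congr fun u => ?_
      by_cases hu : u ∈ {u : ℝ≥0 | xm ≤ s * u}
      · simp only [φ, Set.indicator_of_mem hu]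
      · simp only [φ, Set.indicator_of_notMem hu]
        simp
    have h2 : Measurable fun x : ℝ × ℝ => ∫⁻ u, (1 - nexp (f x * (u : ℝ≥0))) ∂(markLaw xm α) := by
      have := h.isProbabilityMeasure_markLaw
      exact Measurable.lintegral_prod_right' (f := fun y : (ℝ × ℝ) × ℝ≥0 => 1 - nexp (f y.1 * y.2))
        (by fun_prop)
    simp_rw [h1]
    have h3 : Measurable fun x : ℝ × ℝ =>
        ∫⁻ u, (1 - nexp (f (c • x) * (u : ℝ≥0))) ∂(markLaw xm α) :=
      h2.comp (show Measurable fun x : ℝ × ℝ => c • x by fun_prop)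
    rw [lintegral_const_mul _ h3]
    exact lintegral_comp_smul_plane h2 hc
  -- The only loss is in the discarded rewards, and dropping rewards cannot increase the optimum.
  have hle : ∀ ω, best 0 (c * L) (fun i => c • p i ω) (fun i => φ (p i ω, r i ω))
      ≤ s * best 0 L (fun i => p i ω) (fun i => r i ω) := by
    intro ω
    rw [← best_smul hc L, ← best_mul]
    exact best_mono _ _ _ fun i => hφs _ _
  rw [key]
  refine (lintegral_mono hle).trans (le_of_eq ?_)
  rw [lintegral_const_mul _ (measurable_best measurable_const L h.poisson.measurable h.measurable)]
  congr 1
  rw [← hsc, ENNReal.ofReal_coe_nnreal]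

/-! ### Independence of the sensed targets and the targets ahead -/

lemma coe_markedCount {Ω : Type*} (p : ℕ → Ω → ℝ × ℝ) (r : ℕ → Ω → ℝ≥0)
    (B : Set (ℝ × ℝ)) (U : Set ℝ≥0) (ω : Ω) :
    ((markedCount p r B U ω : ℕ∞) : ℝ≥0∞)
      = ∑' i, (B ×ˢ U).indicator (fun _ => 1) (p i ω, r i ω) := by
  rw [markedCount, coe_encard_eq_tsum]
  rfl

lemma IsParetoField.measurable_markedCount (h : IsParetoField P lam xm α p r) {B : Set (ℝ × ℝ)}
    (hB : MeasurableSet B) {U : Set ℝ≥0} (hU : MeasurableSet U) :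
    Measurable fun ω => ((markedCount p r B U ω : ℕ∞) : ℝ≥0∞) := by
  simp_rw [coe_markedCount]
  exact h.measurable_tsum (measurable_const.indicator (hB.prod hU))

lemma IsParetoField.sensed_le (h : IsParetoField P lam xm α p r) (a : ℝ) :
    sensed p r a ≤ ‹MeasurableSpace Ω› := by
  refine MeasurableSpace.generateFrom_le ?_
  rintro A ⟨B, U, n, hB, -, hU, rfl⟩
  exact measurable_of_measurable_coe_enat (h.measurable_markedCount hB hU)
    (measurableSet_singleton n)

/-- The functionals of the targets with coordinate greater than `a` are uncorrelated with the
events which depend on the sensed targets. -/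
theorem IsParetoField.setLIntegral_nexp [IsProbabilityMeasure P]
    (h : IsParetoField P lam xm α p r) (a : ℝ) {A : Set Ω} (hA : MeasurableSet[sensed p r a] A)
    {F : (ℝ × ℝ) × ℝ≥0 → ℝ≥0∞} (hF : Measurable F) (hF0 : ∀ x u, x.1 ≤ a → F (x, u) = 0) :
    ∫⁻ ω in A, nexp (∑' i, F (p i ω, r i ω)) ∂P
      = P A * ∫⁻ ω, nexp (∑' i, F (p i ω, r i ω)) ∂P := by
  have := h.isProbabilityMeasure_markLaw
  let J : Type := {j : Set (ℝ × ℝ) × Set ℝ≥0 //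
    MeasurableSet j.1 ∧ (∀ q ∈ j.1, 0 ≤ q.1 ∧ q.1 ≤ a) ∧ MeasurableSet j.2}
  let N : Ω → J → ℝ≥0∞ := fun ω j => ((markedCount p r j.1.1 j.1.2 ω : ℕ∞) : ℝ≥0∞)
  have hN : Measurable N := measurable_pi_lambda _ fun j => h.measurable_markedCount j.2.1 j.2.2.2
  have hcomap : sensed p r a ≤ MeasurableSpace.comap N inferInstance := by
    refine MeasurableSpace.generateFrom_le ?_
    rintro A ⟨B, U, n, hB, hBa, hU, rfl⟩
    refine ⟨{y | y ⟨(B, U), hB, hBa, hU⟩ = (n : ℝ≥0∞)},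
      measurable_pi_apply _ (measurableSet_singleton _), ?_⟩
    ext ω
    simp [N]
  obtain ⟨A', hA', rfl⟩ := hcomap A hA
  have hmeas : Measurable fun ω => nexp (∑' i, F (p i ω, r i ω)) :=
    measurable_nexp.comp (h.measurable_tsum hF)
  set e : ℝ≥0∞ := ∫⁻ ω, nexp (∑' i, F (p i ω, r i ω)) ∂P with he
  have he1 : e ≠ ∞ := ((lintegral_nexp_le_one P _).trans_lt ENNReal.one_lt_top).ne
  -- The claim says that `ν` and `κ` agree on sensed events. Such events are measurable with respect
  -- to the family of counts `N`, so equality of the images under `N` suffices.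
  let ν : Measure Ω := P.withDensity fun ω => nexp (∑' i, F (p i ω, r i ω))
  let κ : Measure Ω := e • P
  have : IsFiniteMeasure ν := isFiniteMeasure_withDensity he1
  have : IsFiniteMeasure κ := by
    refine ⟨?_⟩
    simp [κ, he1.lt_top]
  have hmarg : ∀ I : Finset J, (κ.map N).map I.restrict = (ν.map N).map I.restrict := by
    intro I
    have hr : Measurable (I.restrict (π := fun _ : J => ℝ≥0∞)) := Finset.measurable_restrict I
    refine measure_ext_of_lintegral_nexp fun t => ?_
    have hm : Measurable fun x : I → ℝ≥0∞ => nexp (∑ j, t j * x j) := by fun_prop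
    rw [Measure.map_map hr hN, Measure.map_map hr hN, lintegral_map hm (hr.comp hN),
      lintegral_map hm (hr.comp hN)]
    let f : (ℝ × ℝ) × ℝ≥0 → ℝ≥0∞ := fun y =>
      ∑ j : I, t j * (j.1.1.1 ×ˢ j.1.1.2).indicator (fun _ => 1) y
    have hf : Measurable f := Finset.measurable_fun_sum _ fun j _ =>
      (measurable_const.indicator (j.1.2.1.prod j.1.2.2.2)).const_mul _
    have hf0 : ∀ x u, a < x.1 → f (x, u) = 0 := by
      intro x u hx
      refine Finset.sum_eq_zero fun j _ => ?_
      rw [Set.indicator_of_notMem, mul_zero]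
      intro hmem
      exact absurd (j.1.2.2.1 x hmem.1).2 (not_le.2 hx)
    have key : ∀ ω, ∑ j : I, (t j : ℝ≥0∞) * (I.restrict ∘ N) ω j = ∑' i, f (p i ω, r i ω) := by
      intro ω
      simp only [Function.comp_apply, Finset.restrict, N, coe_markedCount, f,
        ← ENNReal.tsum_mul_left]
      rw [← Summable.tsum_finsetSum fun _ _ => ENNReal.summable]
    simp_rw [key]
    have hmf : Measurable fun ω => nexp (∑' i, f (p i ω, r i ω)) :=
      measurable_nexp.comp (h.measurable_tsum hf)
    rw [lintegral_smul_measure, smul_eq_mul, lintegral_withDensity_eq_lintegral_mul _ hmeas hmf]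
    simp only [Pi.mul_apply, ← nexp_add]
    simp_rw [← ENNReal.summable.tsum_add ENNReal.summable]
    rw [he, h.lintegral_nexp_tsum hF, h.lintegral_nexp_tsum hf,
      h.lintegral_nexp_tsum (F := fun y => F y + f y) (hF.add hf), ← nexp_add, ← mul_add]
    have hmF : Measurable fun x => ∫⁻ u, (1 - nexp (F (x, u))) ∂(markLaw xm α) :=
      Measurable.lintegral_prod_right' (f := fun y => 1 - nexp (F y)) (by fun_prop)
    -- `F` lives on `x.1 > a` and `f` on `x.1 ≤ a`. At each point one of them vanishes, so `1 -
    -- nexp` is additive on `F + f` and the Laplace functional factorizes.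
    rw [← lintegral_add_left hmF]
    congr 3
    ext x
    rw [← lintegral_add_left (by fun_prop)]
    congr 1
    ext u
    rcases le_or_gt x.1 a with hx | hx
    · simp [hF0 x u hx]
    · simp [hf0 x u hx]
  -- Finite-dimensional marginals determine a finite measure on the product over the uncountable
  -- index type `J`.
  have hlim : κ.map N = ν.map N :=
    IsProjectiveLimit.unique (P := fun I => (ν.map N).map I.restrict) hmarg fun I => rfl
  have hAm : MeasurableSet (N ⁻¹' A') := hN hA'
  have h1 : κ (N ⁻¹' A') = ν (N ⁻¹' A') := by
    rw [← Measure.map_apply hN hA', hlim, Measure.map_apply hN hA']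
  rw [withDensity_apply _ hAm] at h1
  rw [← h1, Measure.smul_apply, smul_eq_mul, mul_comm]

/-- The reward which can be collected ahead of `a` is not influenced by the sensed targets. -/
theorem IsParetoField.setLIntegral_best_le [IsProbabilityMeasure P]
    (h : IsParetoField P lam xm α p r) (hxm : 0 < xm) (hα : 1 < α) (a : ℝ) {A : Set Ω}
    (hA : MeasurableSet[sensed p r a] A) (z : ℝ × ℝ) (ℓ : ℝ) :
    ∫⁻ ω in A, best z ℓ (fun i => p i ω) (fun i => if a < (p i ω).1 then r i ω else 0) ∂P
      ≤ P A * ∫⁻ ω, best 0 ℓ (fun i => p i ω) (fun i => r i ω) ∂P := by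
  by_cases hPA : P A = 0
  · rw [hPA, zero_mul, Measure.restrict_eq_zero.2 hPA, lintegral_zero_measure]
  have hAm : MeasurableSet A := h.sensed_le a A hA
  let φ : (ℝ × ℝ) × ℝ≥0 → ℝ≥0 := fun y => if a < y.1.1 then y.2 else 0
  have hφ : Measurable φ :=
    Measurable.ite (measurableSet_lt measurable_const (by fun_prop)) measurable_snd measurable_const
  have hφle : ∀ x u, φ (x, u) ≤ u := by
    intro x u
    simp only [φ]
    split_ifs <;> simp
  have hreg := h.isRegular hxm hα ℓ one_ne_zero z hφ hφle
  simp only [one_smul] at hreg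
  have := cond_isProbabilityMeasure (μ := P) hPA
  have hPA' : P A * (P A)⁻¹ = 1 := ENNReal.mul_inv_cancel hPA (measure_ne_top _ _)
  have hset : ∀ g : Ω → ℝ≥0∞, ∫⁻ ω in A, g ω ∂P = P A * ∫⁻ ω, g ω ∂P[|A] := by
    intro g
    rw [ProbabilityTheory.cond, lintegral_smul_measure, smul_eq_mul, ← mul_assoc, hPA', one_mul]
  -- Conditioning on `A` does not change the Laplace functional of the field cut off to `x.1 > a`.
  have key := lintegral_best_eq_of_laplace (hreg.cond hPA) hreg fun f hf => by
    have hF : Measurable fun y : (ℝ × ℝ) × ℝ≥0 => f (y.1 - z) * φ y := by fun_prop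
    have h1 := h.setLIntegral_nexp a hA hF fun x u hx => by simp [φ, not_lt.2 hx]
    rw [hset, ENNReal.mul_right_inj hPA (measure_ne_top _ _)] at h1
    exact h1
  rw [hset]
  refine mul_le_mul_right ?_ _
  simp_rw [best_translate z] at key
  refine (le_of_eq key).trans ?_
  rw [← h.lintegral_best_translate hxm hα ℓ z]
  exact lintegral_mono fun ω => best_mono _ _ _ fun i => hφle _ _

end Transform

/-! ### Tubes around Lipschitz functions -/

/-- The steps of discretized `1`-Lipschitz functions. -/
noncomputable def codes (n : ℕ) : Finset (Fin n → ℤ) := Fintype.piFinset fun _ => Finset.Icc (-1 : ℤ) 1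

lemma card_codes (n : ℕ) : (codes n).card = 3 ^ n := by
  simp [codes, Fintype.card_piFinset]

/-- The position of a discretized function after `t` steps. -/
def position {n : ℕ} (s : Fin n → ℤ) (t : ℕ) : ℤ :=
  ∑ j ∈ Finset.range t, if h : j < n then s ⟨j, h⟩ else 0

/-- The region visited by the functions with code `s` and mesh `δ`. -/
def tube {n : ℕ} (δ : ℝ) (s : Fin n → ℤ) : Set (ℝ × ℝ) :=
  ⋃ t ∈ Finset.range n, Icc (t * δ) ((t + 1) * δ) ×ˢ
    Icc ((position s t - 1) * δ) ((position s t + 2) * δ)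

lemma measurableSet_tube {n : ℕ} (δ : ℝ) (s : Fin n → ℤ) : MeasurableSet (tube δ s) :=
  Finset.measurableSet_biUnion _ fun _ _ => measurableSet_Icc.prod measurableSet_Icc

lemma volume_tube_le {n : ℕ} {δ : ℝ} (hδ : 0 ≤ δ) (s : Fin n → ℤ) :
    volume (tube δ s) ≤ ENNReal.ofReal (n * (3 * δ ^ 2)) := by
  refine (measure_biUnion_finset_le _ _).trans ?_
  have h : ∀ t : ℕ, volume (Icc ((t : ℝ) * δ) ((t + 1) * δ) ×ˢ
      Icc ((position s t - 1) * δ) ((position s t + 2) * δ)) = ENNReal.ofReal (3 * δ ^ 2) := by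
    intro t
    rw [Measure.volume_eq_prod, Measure.prod_prod, Real.volume_Icc, Real.volume_Icc,
      ← ENNReal.ofReal_mul (by linarith)]
    congr 1
    ring
  simp_rw [h]
  rw [Finset.sum_const, Finset.card_range, nsmul_eq_mul, ENNReal.ofReal_mul (p := (n : ℝ)) (by positivity),
    ENNReal.ofReal_natCast]

/-- Round `f` down to multiples of `δ` at the grid points. Over one step `f` moves by at most `δ`,
so the rounded value changes by at most one unit, and in between `f` stays within one unit below and
two above the rounded value. -/
lemma exists_code {n : ℕ} (hn : 0 < n) {L : ℝ} (hL : 0 < L) {f : ℝ → ℝ} (hf : LipschitzWith 1 f)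
    (hf0 : f 0 = 0) :
    ∃ s ∈ codes n, ∀ x ∈ Icc 0 L, (x, f x) ∈ tube (L / n) s := by
  have hn' : (0 : ℝ) < n := by exact_mod_cast hn
  set δ : ℝ := L / n with hδ
  have hδ0 : 0 < δ := by positivity
  have hnδ : n * δ = L := by rw [hδ]; field_simp
  have hlip : ∀ x y, |f x - f y| ≤ |x - y| := fun x y => by
    simpa [Real.dist_eq] using hf.dist_le_mul x y
  let κ : ℕ → ℤ := fun t => ⌊f (t * δ) / δ⌋
  have hκ0 : κ 0 = 0 := by simp [κ, hf0]
  have hκl : ∀ t : ℕ, κ t * δ ≤ f (t * δ) := fun t => (le_div_iff₀ hδ0).1 (Int.floor_le _)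
  have hκu : ∀ t : ℕ, f (t * δ) < (κ t + 1) * δ := fun t => (div_lt_iff₀ hδ0).1 (Int.lt_floor_add_one _)
  have hpos : ∀ t ≤ n, position (fun j : Fin n => κ (j + 1) - κ j) t = κ t := by
    intro t ht
    have : ∀ j ∈ Finset.range t, (if h : j < n then κ ((⟨j, h⟩ : Fin n) + 1) - κ (⟨j, h⟩ : Fin n)
        else 0) = κ (j + 1) - κ j := by
      intro j hj
      rw [dif_pos ((Finset.mem_range.1 hj).trans_le ht)]
    rw [position, Finset.sum_congr rfl this, Finset.sum_range_sub, hκ0, sub_zero]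
  refine ⟨fun j => κ (j + 1) - κ j, ?_, ?_⟩
  · rw [codes, Fintype.mem_piFinset]
    intro j
    have h1 := hlip (((j : ℕ) + 1 : ℕ) * δ) ((j : ℕ) * δ)
    have h2 : (((j : ℕ) + 1 : ℕ) * δ) - ((j : ℕ) * δ) = δ := by push_cast; ring
    rw [h2, abs_of_pos hδ0, abs_le] at h1
    have a1 := hκl j
    have a2 := hκu j
    have a3 := hκl (j + 1)
    have a4 := hκu (j + 1)
    have b1 : ((κ (j + 1) : ℝ) - κ j) < 2 := by
      have : ((κ (j + 1) : ℝ) - κ j) * δ < 2 * δ := by linarith [h1.2]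
      exact lt_of_mul_lt_mul_right this hδ0.le
    have b2 : -2 < ((κ (j + 1) : ℝ) - κ j) := by
      have : -2 * δ < ((κ (j + 1) : ℝ) - κ j) * δ := by linarith [h1.1]
      exact lt_of_mul_lt_mul_right this hδ0.le
    have c1 : κ (j + 1) - κ j < 2 := by exact_mod_cast b1
    have c2 : -2 < κ (j + 1) - κ j := by exact_mod_cast b2
    rw [Finset.mem_Icc]
    omega
  · intro x hx
    have hex : ∃ t < n, (t : ℝ) * δ ≤ x ∧ x ≤ (t + 1) * δ := by
      rcases hx.2.lt_or_eq with hlt | heq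
      · refine ⟨⌊x / δ⌋₊, ?_, ?_, ?_⟩
        · rw [Nat.floor_lt (div_nonneg hx.1 hδ0.le), div_lt_iff₀ hδ0, hnδ]
          exact hlt
        · exact (le_div_iff₀ hδ0).1 (Nat.floor_le (div_nonneg hx.1 hδ0.le))
        · exact ((div_lt_iff₀ hδ0).1 (Nat.lt_floor_add_one _)).le
      -- The endpoint `x = L` belongs to the last interval, whereas the floor would give `n`.
      · refine ⟨n - 1, by omega, ?_, ?_⟩ <;> rw [heq, Nat.cast_sub (by omega)] <;> push_cast <;>
          nlinarith
    obtain ⟨t, htn, ht1, ht2⟩ := hex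
    refine Set.mem_iUnion₂.2 ⟨t, Finset.mem_range.2 htn, ⟨ht1, ht2⟩, ?_⟩
    rw [hpos t htn.le]
    have h1 := hlip x (t * δ)
    rw [abs_of_nonneg (by linarith : (0 : ℝ) ≤ x - t * δ), abs_le] at h1
    have a1 := hκl t
    have a2 := hκu t
    exact ⟨by linarith [h1.1], by linarith [h1.2]⟩

/-! ### Decomposition of the rewards into dyadic levels -/

/-- A nonzero `u ≤ w` lies in some `(w / 2 ^ (j + 1), w / 2 ^ j]`, and the term of that `j` alone
dominates it. -/
lemma coe_le_tail_add_tsum {w : ℝ} (hw : 0 < w) (u : ℝ≥0) :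
    (u : ℝ≥0∞) ≤ {u : ℝ≥0 | w < u}.indicator (fun u => (u : ℝ≥0∞)) u
      + ∑' j : ℕ, ENNReal.ofReal (2 * (w / 2 ^ (j + 1))) *
          {u : ℝ≥0 | w / 2 ^ (j + 1) < u}.indicator (fun _ => 1) u := by
  by_cases hu : w < u
  · rw [Set.indicator_of_mem (show u ∈ {u : ℝ≥0 | w < u} from hu)]
    exact le_self_add
  · rcases eq_or_lt_of_le (zero_le (a := u)) with h0 | h0
    · rw [← h0]
      simp
    · have h0' : (0 : ℝ) < u := h0
      have h1 : 1 ≤ w / u := (one_le_div h0').2 (not_lt.1 hu)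
      obtain ⟨j, hj1, hj2⟩ := exists_nat_pow_near h1 one_lt_two
      have hmem : u ∈ {u : ℝ≥0 | w / 2 ^ (j + 1) < u} := by
        change w / 2 ^ (j + 1) < u
        rw [div_lt_iff₀ (by positivity)]
        rwa [div_lt_iff₀ h0', mul_comm] at hj2
      refine le_add_left (le_trans ?_ (ENNReal.le_tsum j))
      rw [Set.indicator_of_mem hmem, mul_one, ← ENNReal.ofReal_coe_nnreal]
      refine ENNReal.ofReal_le_ofReal ?_
      rw [le_div_iff₀ h0'] at hj1
      rw [pow_succ]
      have : 2 * (w / (2 ^ j * 2)) = w / 2 ^ j := by field_simp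
      rw [this, le_div_iff₀ (by positivity)]
      linarith

/-- The number of targets in `B` with reward greater than `w`. -/
noncomputable def countAbove (B : Set (ℝ × ℝ)) (w : ℝ) (q : ℕ → ℝ × ℝ) (m : ℕ → ℝ≥0) : ℝ≥0∞ :=
  ∑' i, (B ×ˢ {u : ℝ≥0 | w < u}).indicator (fun _ => 1) (q i, m i)

/-- The maximal number of targets with reward greater than `w` in a tube. -/
noncomputable def tubeMax (n : ℕ) (L w : ℝ) (q : ℕ → ℝ × ℝ) (m : ℕ → ℝ≥0) : ℝ≥0∞ :=
  ⨆ s ∈ codes n, countAbove (tube (L / n) s) w q m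

/-- A causal set lies on a `1`-Lipschitz graph through the origin, hence in a tube for every mesh.
Each reward level may therefore use its own mesh, to be optimized later. -/
lemma best_le_tail_add_tsum {L w : ℝ} (hL : 0 < L) (hw : 0 < w) {n : ℕ → ℕ} (hn : ∀ j, 0 < n j)
    (q : ℕ → ℝ × ℝ) (m : ℕ → ℝ≥0) :
    best 0 L q m ≤ (∑' i, (box L).indicator (fun _ => 1) (q i) *
        {u : ℝ≥0 | w < u}.indicator (fun u => (u : ℝ≥0∞)) (m i)) +
      ∑' j : ℕ, ENNReal.ofReal (2 * (w / 2 ^ (j + 1))) * tubeMax (n j) L (w / 2 ^ (j + 1)) q m := by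
  classical
  refine iSup₂_le fun I hI => ?_
  refine (Finset.sum_le_sum fun i _ => coe_le_tail_add_tsum hw (m i)).trans ?_
  rw [Finset.sum_add_distrib]
  refine add_le_add ?_ ?_
  · refine le_trans (le_of_eq (Finset.sum_congr rfl fun i hi => ?_)) (ENNReal.sum_le_tsum I)
    rw [Set.indicator_of_mem (hI.mem_box hi), one_mul]
  · rw [← Summable.tsum_finsetSum fun _ _ => ENNReal.summable]
    refine ENNReal.tsum_le_tsum fun j => ?_
    rw [← Finset.mul_sum]
    refine mul_le_mul_right ?_ _
    obtain ⟨f, hf, hfS⟩ := exists_lipschitzWith_one (S := insert 0 (I.image q))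
      ⟨0, Finset.mem_insert_self _ _⟩ (by
        have hstart : ∀ i ∈ I, |(q i).2| ≤ |(q i).1| := fun i hi => by
          have := (hI.1 i hi).1
          simp only [Prod.snd_zero, Prod.fst_zero, sub_zero] at this
          exact this.trans (le_abs_self _)
        intro a ha b hb
        rw [Finset.mem_insert, Finset.mem_image] at ha hb
        rcases ha with rfl | ⟨i, hi, rfl⟩ <;> rcases hb with rfl | ⟨k, hk, rfl⟩
        · simp
        · simpa using hstart k hk
        · simpa using hstart i hi
        · exact hI.2 i hi k hk)
    have hf0 : f 0 = 0 := hfS 0 (Finset.mem_insert_self _ _)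
    obtain ⟨s, hs, hsf⟩ := exists_code (hn j) hL hf hf0
    refine le_iSup₂_of_le s hs ?_
    refine le_trans (le_of_eq (Finset.sum_congr rfl fun i hi => ?_)) (ENNReal.sum_le_tsum I)
    have h1 : q i ∈ tube (L / n j) s := by
      have := hsf (q i).1 (hI.mem_box hi).1
      rwa [hfS (q i) (Finset.mem_insert_of_mem (Finset.mem_image_of_mem q hi))] at this
    by_cases hu : m i ∈ {u : ℝ≥0 | w / 2 ^ (j + 1) < u}
    · have h2 : (q i, m i) ∈ tube (L / n j) s ×ˢ {u : ℝ≥0 | w / 2 ^ (j + 1) < u} := ⟨h1, hu⟩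
      rw [Set.indicator_of_mem hu, Set.indicator_of_mem h2]
    · have h2 : (q i, m i) ∉ tube (L / n j) s ×ˢ {u : ℝ≥0 | w / 2 ^ (j + 1) < u} :=
        fun h => hu h.2
      rw [Set.indicator_of_notMem hu, Set.indicator_of_notMem h2]

/-! ### Exponential moments of the number of targets -/

/-- This is `t + 1 ≤ exp t` at `t = y - A`. It bounds the expectation of a maximum by `A` plus a sum
of exponential moments. -/
lemma le_add_nexp_mul {A : ℝ} (hA : 0 ≤ A) (y : ℝ≥0∞) :
    y ≤ ENNReal.ofReal A + ENNReal.ofReal (Real.exp (-A)) * (nexp y)⁻¹ := by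
  induction y using ENNReal.recTopCoe with
  | top => simp [ENNReal.mul_top, Real.exp_pos]
  | coe x =>
    rw [nexp_coe, ← ENNReal.ofReal_inv_of_pos (Real.exp_pos _), ← ENNReal.ofReal_mul
      (Real.exp_pos _).le, ← ENNReal.ofReal_add hA (by positivity), ← ENNReal.ofReal_coe_nnreal]
    refine ENNReal.ofReal_le_ofReal ?_
    rw [← Real.exp_neg, ← Real.exp_add]
    have := Real.add_one_le_exp (-A + - -(x : ℝ))
    linarith

section Field

variable {Ω : Type*} [MeasurableSpace Ω] {P : Measure Ω} {lam : ℝ≥0} {xm α : ℝ}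
  {p : ℕ → Ω → ℝ × ℝ} {r : ℕ → Ω → ℝ≥0}

lemma measurableSet_above (w : ℝ) : MeasurableSet {u : ℝ≥0 | w < u} :=
  measurableSet_lt measurable_const (by fun_prop)

lemma IsParetoField.measurable_countAbove (h : IsParetoField P lam xm α p r) {B : Set (ℝ × ℝ)}
    (hB : MeasurableSet B) (w : ℝ) :
    Measurable fun ω => countAbove B w (fun i => p i ω) (fun i => r i ω) :=
  h.measurable_tsum (measurable_const.indicator (hB.prod (measurableSet_above w)))

/-- The number of targets in a region with reward above a level has the Poisson distribution. -/
lemma IsParetoField.map_countAbove [IsProbabilityMeasure P] (h : IsParetoField P lam xm α p r)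
    {B : Set (ℝ × ℝ)} (hB : MeasurableSet B) (w : ℝ) {a : ℝ≥0}
    (ha : (a : ℝ≥0∞) = lam * (volume B * markLaw xm α {u | w < u})) :
    P.map (fun ω (_ : Unit) => countAbove B w (fun i => p i ω) (fun i => r i ω))
      = (poissonMeasure a).map fun (n : ℕ) (_ : Unit) => (n : ℝ≥0∞) := by
  have hm : Measurable fun ω (_ : Unit) => countAbove B w (fun i => p i ω) (fun i => r i ω) :=
    measurable_pi_lambda _ fun _ => h.measurable_countAbove hB w
  have hc : Measurable fun (n : ℕ) (_ : Unit) => (n : ℝ≥0∞) := measurable_from_top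
  have := h.isProbabilityMeasure_markLaw
  have := Measure.isProbabilityMeasure_map (μ := P) hm.aemeasurable
  have := Measure.isProbabilityMeasure_map (μ := poissonMeasure a) hc.aemeasurable
  -- The index `Unit` serves to apply the uniqueness theorem for Laplace transforms to a single
  -- variable.
  refine measure_ext_of_lintegral_nexp fun t => ?_
  have ht : Measurable fun x : Unit → ℝ≥0∞ => nexp (∑ j, t j * x j) := by fun_prop
  rw [lintegral_map ht hm, lintegral_map ht hc]
  simp only [Finset.univ_unique, Finset.sum_singleton, mul_comm (t default : ℝ≥0∞)]
  rw [lintegral_nexp_poissonMeasure, ha]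
  simp only [countAbove, ← ENNReal.tsum_mul_right]
  have hBU := hB.prod (measurableSet_above w)
  rw [h.lintegral_nexp_tsum (F := fun y => (B ×ˢ {u : ℝ≥0 | w < u}).indicator (fun _ => 1) y *
    (t default : ℝ≥0∞)) ((measurable_const.indicator hBU).mul_const _), mul_assoc]
  congr 2
  set e := 1 - nexp (t default : ℝ≥0∞) with he
  have h1 : ∀ x u, 1 - nexp ((B ×ˢ {u : ℝ≥0 | w < u}).indicator (fun _ => 1) (x, u) *
      (t default : ℝ≥0∞)) = B.indicator (fun _ => 1) x *
        ({u : ℝ≥0 | w < u}.indicator (fun _ => e) u) := by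
    intro x u
    by_cases hx : x ∈ B <;> by_cases hu : w < u <;> simp [hx, hu, he]
  have hi : Measurable ({u : ℝ≥0 | w < u}.indicator fun _ => e) :=
    measurable_const.indicator (measurableSet_above w)
  simp_rw [h1]
  simp_rw [lintegral_const_mul _ hi]
  rw [lintegral_mul_const _ (measurable_const.indicator hB), lintegral_indicator_const
    (measurableSet_above w), lintegral_indicator_const hB, one_mul]
  ring

/-- The count is Poisson with some mean `a ≤ μ`, so its exponential moment is `exp (a * (e - 1))`,
and `e - 1 ≤ 2`. -/
lemma IsParetoField.lintegral_inv_nexp_countAbove_le [IsProbabilityMeasure P]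
    (h : IsParetoField P lam xm α p r) {B : Set (ℝ × ℝ)} (hB : MeasurableSet B) (w : ℝ) {μ : ℝ}
    (hμ : lam * (volume B * markLaw xm α {u | w < u}) ≤ ENNReal.ofReal μ) (hμ0 : 0 ≤ μ) :
    ∫⁻ ω, (nexp (countAbove B w (fun i => p i ω) (fun i => r i ω)))⁻¹ ∂P
      ≤ ENNReal.ofReal (Real.exp (2 * μ)) := by
  have hm : Measurable fun ω (_ : Unit) => countAbove B w (fun i => p i ω) (fun i => r i ω) :=
    measurable_pi_lambda _ fun _ => h.measurable_countAbove hB w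
  have hc : Measurable fun (n : ℕ) (_ : Unit) => (n : ℝ≥0∞) := measurable_from_top
  obtain ⟨a, ha⟩ := WithTop.ne_top_iff_exists.1 (hμ.trans_lt ENNReal.ofReal_lt_top).ne
  replace ha : (a : ℝ≥0∞) = lam * (volume B * markLaw xm α {u | w < u}) := ha
  have hg : Measurable fun x : Unit → ℝ≥0∞ => (nexp (x default))⁻¹ := by fun_prop
  have h1 : ∫⁻ ω, (nexp (countAbove B w (fun i => p i ω) (fun i => r i ω)))⁻¹ ∂P
      = ∫⁻ n : ℕ, (nexp (n : ℝ≥0∞))⁻¹ ∂(poissonMeasure a) := by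
    have := lintegral_map (μ := P) hg hm
    rw [← this, h.map_countAbove hB w ha, lintegral_map hg hc]
  have h2 : ∀ n : ℕ, (nexp (n : ℝ≥0∞))⁻¹ = ENNReal.ofReal (Real.exp 1) ^ n := by
    intro n
    have : nexp (n : ℝ≥0∞) = ENNReal.ofReal (Real.exp (-n)) := nexp_coe n
    rw [this, ← ENNReal.ofReal_inv_of_pos (Real.exp_pos _), ← Real.exp_neg, neg_neg,
      ← ENNReal.ofReal_pow (Real.exp_pos _).le, ← Real.exp_nat_mul, mul_one]
  simp_rw [h1, h2]
  rw [lintegral_pow_poissonMeasure a (Real.exp_pos _).le]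
  refine ENNReal.ofReal_le_ofReal (Real.exp_le_exp.2 ?_)
  have haμ : (a : ℝ) ≤ μ := by
    rw [← ha, ← ENNReal.ofReal_coe_nnreal, ENNReal.ofReal_le_ofReal_iff hμ0] at hμ
    exact hμ
  have he : Real.exp 1 ≤ 3 := Real.exp_one_lt_three.le
  have : (a : ℝ) * (Real.exp 1 - 1) ≤ a * 2 := mul_le_mul_of_nonneg_left (by linarith) a.2
  linarith

/-- A union bound over `3 ^ n ≤ exp (2 * n)` tubes, each with exponential moment at most `exp (2 *
μ)`. The threshold `A = 2 * n + 2 * μ` makes the exponential remainder at most one. -/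
lemma IsParetoField.lintegral_tubeMax_le [IsProbabilityMeasure P]
    (h : IsParetoField P lam xm α p r) (n : ℕ) (L w : ℝ) {μ : ℝ} (hμ0 : 0 ≤ μ)
    (hμ : ∀ s ∈ codes n,
      lam * (volume (tube (L / n) s) * markLaw xm α {u | w < u}) ≤ ENNReal.ofReal μ) :
    ∫⁻ ω, tubeMax n L w (fun i => p i ω) (fun i => r i ω) ∂P
      ≤ ENNReal.ofReal (2 * n + 2 * μ + 1) := by
  set A : ℝ := 2 * n + 2 * μ with hA
  have hA0 : 0 ≤ A := by positivity
  have hpt : ∀ ω, tubeMax n L w (fun i => p i ω) (fun i => r i ω) ≤ ENNReal.ofReal A +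
      ENNReal.ofReal (Real.exp (-A)) * ∑ s ∈ codes n,
        (nexp (countAbove (tube (L / n) s) w (fun i => p i ω) (fun i => r i ω)))⁻¹ := by
    intro ω
    refine iSup₂_le fun s hs => (le_add_nexp_mul hA0 _).trans ?_
    gcongr
    exact Finset.single_le_sum (f := fun s =>
      (nexp (countAbove (tube (L / n) s) w (fun i => p i ω) (fun i => r i ω)))⁻¹)
      (fun _ _ => zero_le) hs
  have hm : ∀ s : Fin n → ℤ, Measurable fun ω =>
      (nexp (countAbove (tube (L / n) s) w (fun i => p i ω) (fun i => r i ω)))⁻¹ := fun s =>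
    (measurable_nexp.comp (h.measurable_countAbove (measurableSet_tube _ s) w)).inv
  refine (lintegral_mono hpt).trans ?_
  rw [lintegral_add_left measurable_const, lintegral_const_mul _
    (Finset.measurable_fun_sum _ fun s _ => hm s), lintegral_finsetSum _ fun s _ => hm s,
    lintegral_const, measure_univ, mul_one, ENNReal.ofReal_add hA0 zero_le_one]
  gcongr
  calc ENNReal.ofReal (Real.exp (-A)) * ∑ s ∈ codes n, ∫⁻ ω,
        (nexp (countAbove (tube (L / n) s) w (fun i => p i ω) (fun i => r i ω)))⁻¹ ∂P
      ≤ ENNReal.ofReal (Real.exp (-A)) * ∑ s ∈ codes n, ENNReal.ofReal (Real.exp (2 * μ)) := by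
        gcongr with s hs
        exact h.lintegral_inv_nexp_countAbove_le (measurableSet_tube _ s) w (hμ s hs) hμ0
    _ ≤ ENNReal.ofReal 1 := by
        rw [Finset.sum_const, card_codes, nsmul_eq_mul, ← ENNReal.ofReal_natCast,
          ← ENNReal.ofReal_mul (by positivity), ← ENNReal.ofReal_mul (by positivity)]
        refine ENNReal.ofReal_le_ofReal ?_
        have h3 : (3 : ℝ) ^ n ≤ Real.exp (2 * n) := by
          have : (3 : ℝ) ≤ Real.exp 2 := by
            have := Real.add_one_le_exp (2 : ℝ)
            linarith
          calc (3 : ℝ) ^ n ≤ Real.exp 2 ^ n := by gcongr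
            _ = Real.exp (2 * n) := by rw [← Real.exp_nat_mul, mul_comm]
        push_cast
        calc Real.exp (-A) * (3 ^ n * Real.exp (2 * μ))
            ≤ Real.exp (-A) * (Real.exp (2 * n) * Real.exp (2 * μ)) := by gcongr
          _ = 1 := by
            rw [← Real.exp_add, ← Real.exp_add, hA]
            simp

/-- The expected optimal reward grows at most like `L ^ (2 / α)`. -/
theorem IsParetoField.exists_lintegral_best_le [IsProbabilityMeasure P]
    (h : IsParetoField P lam xm α p r) (hxm : 0 < xm) (hα : α ∈ Set.Ioo (1 : ℝ) 2) :
    ∃ C : ℝ, 0 ≤ C ∧ ∀ L, 0 < L →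
      ∫⁻ ω, best 0 L (fun i => p i ω) (fun i => r i ω) ∂P ≤ ENNReal.ofReal (C * L ^ (2 / α)) := by
  obtain ⟨hα1, hα2⟩ := hα
  have hα0 : 0 < α := by linarith
  -- With `b ^ (j + 1)` columns at level `j`, the bound on the mean count per tube is again of order
  -- `b ^ (j + 1)`. The series of `(b / 2) ^ (j + 1)` converges since `α < 2`.
  set b : ℝ := 2 ^ (α / 2) with hb
  have hb1 : 1 ≤ b := Real.one_le_rpow one_le_two (by linarith)
  have hb2 : b < 2 := by
    have := Real.rpow_lt_rpow_of_exponent_lt one_lt_two (show α / 2 < 1 by linarith)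
    rwa [Real.rpow_one] at this
  have hbsq : ∀ j : ℕ, ((2 : ℝ) ^ (j + 1)) ^ α = (b ^ (j + 1)) ^ 2 := by
    intro j
    rw [hb, ← Real.rpow_natCast, ← Real.rpow_natCast (2 ^ (α / 2)), ← Real.rpow_mul (by norm_num),
      ← Real.rpow_mul (by norm_num), ← Real.rpow_natCast, ← Real.rpow_mul (by norm_num)]
    congr 1
    push_cast
    ring
  -- Collects `2 * n + 2 * μ + 1` in units of `b ^ (j + 1)`: four from `n ≤ 2 * b ^ (j + 1)`, one
  -- from the constant, the rest from `μ`.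
  set K : ℝ := 6 * lam * xm ^ α + 5 with hK
  have hK0 : 0 ≤ K := by positivity
  have hsum : Summable fun j : ℕ => (b / 2) ^ (j + 1) := by
    have := summable_geometric_of_lt_one (r := b / 2) (by positivity) (by linarith)
    exact (summable_nat_add_iff 1).2 this
  refine ⟨2 * lam * (α / (α - 1) * xm ^ α) + 2 * K * ∑' j : ℕ, (b / 2) ^ (j + 1), ?_, ?_⟩
  · have : 0 < α - 1 := by linarith
    have : 0 ≤ ∑' j : ℕ, (b / 2) ^ (j + 1) := tsum_nonneg fun j => by positivity
    positivity
  intro L hL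
  -- At this level `w ^ α = L ^ 2`, so the mean number of rewards above `w` in the box is bounded
  -- uniformly in `L`.
  set w : ℝ := L ^ (2 / α) with hw
  have hw0 : 0 < w := by positivity
  have hwα : w ^ α = L ^ 2 := by
    rw [hw, ← Real.rpow_mul hL.le, div_mul_cancel₀ _ hα0.ne', Real.rpow_two]
  let n : ℕ → ℕ := fun j => ⌈b ^ (j + 1)⌉₊
  have hB1 : ∀ j : ℕ, 1 ≤ b ^ (j + 1) := fun j => one_le_pow₀ hb1
  have hn : ∀ j, 0 < n j := fun j => Nat.ceil_pos.2 (by positivity)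
  have hn1 : ∀ j, b ^ (j + 1) ≤ n j := fun j => Nat.le_ceil _
  have hn2 : ∀ j, (n j : ℝ) ≤ 2 * b ^ (j + 1) := fun j => by
    have := Nat.ceil_lt_add_one (show 0 ≤ b ^ (j + 1) by positivity)
    have := hB1 j
    linarith
  have htube : ∀ j, ∫⁻ ω, tubeMax (n j) L (w / 2 ^ (j + 1)) (fun i => p i ω) (fun i => r i ω) ∂P
      ≤ ENNReal.ofReal (K * b ^ (j + 1)) := by
    intro j
    have hn' : (0 : ℝ) < n j := by exact_mod_cast hn j
    refine (h.lintegral_tubeMax_le (n j) L (w / 2 ^ (j + 1))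
      (μ := 3 * lam * xm ^ α * b ^ (j + 1)) (by positivity) fun s _ => ?_).trans ?_
    · calc (lam : ℝ≥0∞) * (volume (tube (L / n j) s) * markLaw xm α {u | w / 2 ^ (j + 1) < u})
          ≤ ENNReal.ofReal lam * (ENNReal.ofReal (n j * (3 * (L / n j) ^ 2)) *
              ENNReal.ofReal ((xm / (w / 2 ^ (j + 1))) ^ α)) := by
            rw [ENNReal.ofReal_coe_nnreal]
            gcongr
            · exact volume_tube_le (by positivity) s
            · exact markLaw_Ioi_le hxm hα1 (by positivity)
        _ ≤ ENNReal.ofReal (3 * lam * xm ^ α * b ^ (j + 1)) := by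
            rw [← ENNReal.ofReal_mul (by positivity), ← ENNReal.ofReal_mul (by positivity)]
            refine ENNReal.ofReal_le_ofReal ?_
            rw [Real.div_rpow hxm.le (by positivity), Real.div_rpow hw0.le (by positivity), hwα,
              hbsq]
            have e : (lam : ℝ) * (n j * (3 * (L / n j) ^ 2) *
                (xm ^ α / (L ^ 2 / (b ^ (j + 1)) ^ 2)))
                = 3 * lam * xm ^ α * ((b ^ (j + 1)) ^ 2 / n j) := by
              field_simp
            rw [e]
            gcongr
            rw [div_le_iff₀ hn', sq]
            gcongr
            exact hn1 j
    · refine ENNReal.ofReal_le_ofReal ?_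
      rw [hK]
      have := hn2 j
      have := hB1 j
      linarith
  have hms : Measurable ({u : ℝ≥0 | w < u}.indicator fun u => (u : ℝ≥0∞)) :=
    Measurable.indicator (by fun_prop) (measurableSet_above w)
  have hmt : ∀ j, Measurable fun ω =>
      tubeMax (n j) L (w / 2 ^ (j + 1)) (fun i => p i ω) (fun i => r i ω) := fun j =>
    Measurable.iSup fun s => Measurable.iSup fun _ =>
      h.measurable_countAbove (measurableSet_tube _ s) _
  refine (lintegral_mono fun ω => best_le_tail_add_tsum hL hw0 hn _ _).trans ?_
  rw [lintegral_add_right _ (Measurable.tsum fun j => (hmt j).const_mul _),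
    h.lintegral_tsum_mul (measurableSet_box L) (volume_box_ne_top L) hms,
    lintegral_tsum fun j => ((hmt j).const_mul _).aemeasurable, add_mul,
    ENNReal.ofReal_add]
  rotate_left
  · have : 0 < α - 1 := by linarith
    positivity
  · have : 0 ≤ ∑' j : ℕ, (b / 2) ^ (j + 1) := tsum_nonneg fun j => by positivity
    positivity
  refine add_le_add ?_ ?_
  · have h1 : 0 < α - 1 := by linarith
    calc (lam : ℝ≥0∞) * volume (box L) *
          ∫⁻ u, {u : ℝ≥0 | w < u}.indicator (fun u => (u : ℝ≥0∞)) u ∂(markLaw xm α)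
        ≤ ENNReal.ofReal lam * ENNReal.ofReal (2 * L ^ 2) *
          ENNReal.ofReal (α / (α - 1) * xm ^ α * w ^ (1 - α)) := by
          rw [ENNReal.ofReal_coe_nnreal, volume_box hL.le]
          gcongr
          exact lintegral_markLaw_tail_le hxm hα1 hw0
      _ = ENNReal.ofReal (2 * lam * (α / (α - 1) * xm ^ α) * w) := by
          rw [← ENNReal.ofReal_mul (by positivity), ← ENNReal.ofReal_mul (by positivity)]
          congr 1
          rw [Real.rpow_sub hw0, Real.rpow_one, hwα]
          field_simp
  · calc ∑' j, ∫⁻ ω, ENNReal.ofReal (2 * (w / 2 ^ (j + 1))) *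
          tubeMax (n j) L (w / 2 ^ (j + 1)) (fun i => p i ω) (fun i => r i ω) ∂P
        ≤ ∑' j : ℕ, ENNReal.ofReal (2 * K * (b / 2) ^ (j + 1) * w) := by
          refine ENNReal.tsum_le_tsum fun j => ?_
          rw [lintegral_const_mul _ (hmt j)]
          refine (mul_le_mul_right (htube j) _).trans ?_
          rw [← ENNReal.ofReal_mul (by positivity)]
          apply le_of_eq
          congr 1
          rw [div_pow]
          field_simp
      _ = ENNReal.ofReal (2 * K * (∑' j : ℕ, (b / 2) ^ (j + 1)) * w) := by
          rw [← tsum_mul_left, ← tsum_mul_right, ENNReal.ofReal_tsum_of_nonneg]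
          · intro j
            positivity
          · exact (hsum.mul_left _).mul_right _

end Field

/-! ### Characterization of Poisson processes by the Laplace functional -/

section Characterization

variable {Ω : Type*} [MeasurableSpace Ω] {P : Measure Ω} [IsProbabilityMeasure P] {lam : ℝ≥0}
  {p : ℕ → Ω → ℝ × ℝ}

/-- Testing with combinations of indicators of the `B j` gives the joint Laplace transform of the
counts. Disjointness makes `1 - nexp` of the combination split into a sum, and so the transform into
a product. -/
lemma map_count_of_laplace (hp : ∀ i, Measurable (p i))
    (hl : ∀ f : ℝ × ℝ → ℝ≥0∞, Measurable f →
      ∫⁻ ω, nexp (∑' i, f (p i ω)) ∂P = nexp (lam * ∫⁻ x, (1 - nexp (f x))))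
    {k : ℕ} {B : Fin k → Set (ℝ × ℝ)} (hB : ∀ j, MeasurableSet (B j)) (hv : ∀ j, volume (B j) ≠ ∞)
    (hd : Pairwise fun i j => Disjoint (B i) (B j)) :
    P.map (fun ω j => ((count p (B j) ω : ℕ∞) : ℝ≥0∞)) = Measure.infinitePi fun j =>
      (poissonMeasure (lam * (volume (B j)).toNNReal)).map fun n : ℕ => (n : ℝ≥0∞) := by
  have hc : Measurable (fun n : ℕ => (n : ℝ≥0∞)) := measurable_from_top
  have hm : Measurable fun ω j => ((count p (B j) ω : ℕ∞) : ℝ≥0∞) :=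
    measurable_pi_lambda _ fun j => by
      simp_rw [coe_count]
      exact measurable_tsum_comp hp (measurable_const.indicator (hB j))
  have hc' : Measurable fun (n : Fin k → ℕ) j => (n j : ℝ≥0∞) := by fun_prop
  rw [← Measure.infinitePi_map_pi _ fun _ => hc]
  have := Measure.isProbabilityMeasure_map (μ := P) hm.aemeasurable
  have := Measure.isProbabilityMeasure_map (μ := Measure.infinitePi fun j : Fin k =>
    poissonMeasure (lam * (volume (B j)).toNNReal)) hc'.aemeasurable
  refine measure_ext_of_lintegral_nexp fun t => ?_
  have ht : Measurable fun x : Fin k → ℝ≥0∞ => nexp (∑ j, t j * x j) := by fun_prop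
  rw [lintegral_map ht hm, lintegral_map ht hc']
  have h1 := lintegral_nexp_tsum_infinitePi
    (fun j : Fin k => poissonMeasure (lam * (volume (B j)).toNNReal))
    (f := fun j (n : ℕ) => (n * t j : ℝ≥0∞)) fun j => measurable_from_top
  simp only [tsum_fintype] at h1
  simp_rw [mul_comm (t _ : ℝ≥0∞), h1, lintegral_nexp_poissonMeasure, nlog_nexp, coe_count,
    ← ENNReal.tsum_mul_right, ← Summable.tsum_finsetSum fun _ _ => ENNReal.summable]
  have hf : Measurable fun x : ℝ × ℝ => ∑ j, (B j).indicator (fun _ => 1) x * (t j : ℝ≥0∞) :=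
    Finset.measurable_fun_sum _ fun j _ => (measurable_const.indicator (hB j)).mul_const _
  rw [hl _ hf]
  congr 1
  have h2 : ∀ x, 1 - nexp (∑ j, (B j).indicator (fun _ => 1) x * (t j : ℝ≥0∞))
      = ∑ j, (B j).indicator (fun _ => 1 - nexp (t j)) x := by
    intro x
    by_cases hx : ∃ j, x ∈ B j
    · obtain ⟨j, hj⟩ := hx
      have hne : ∀ i, i ≠ j → x ∉ B i := fun i hi hxi =>
        Set.disjoint_left.1 (hd hi) hxi hj
      rw [Finset.sum_eq_single j (fun i _ hi => by rw [Set.indicator_of_notMem (hne i hi), zero_mul])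
        (by simp), Finset.sum_eq_single j (fun i _ hi => Set.indicator_of_notMem (hne i hi) _)
        (by simp), Set.indicator_of_mem hj, Set.indicator_of_mem hj, one_mul]
    · push Not at hx
      simp [hx]
  simp_rw [h2]
  rw [lintegral_finsetSum _ fun j _ => measurable_const.indicator (hB j), Finset.mul_sum]
  refine Finset.sum_congr rfl fun j _ => ?_
  rw [lintegral_indicator_const (hB j), ENNReal.coe_mul, ENNReal.coe_toNNReal (hv j)]
  ring

/-- A point process with the Laplace functional of a Poisson process is a Poisson process. -/
theorem isPoissonProcess_of_laplace (hp : ∀ i, Measurable (p i))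
    (hl : ∀ f : ℝ × ℝ → ℝ≥0∞, Measurable f →
      ∫⁻ ω, nexp (∑' i, f (p i ω)) ∂P = nexp (lam * ∫⁻ x, (1 - nexp (f x)))) :
    IsPoissonProcess P lam p := by
  have hc : Measurable (fun n : ℕ => (n : ℝ≥0∞)) := measurable_from_top
  have hm : ∀ B, MeasurableSet B → Measurable fun ω => ((count p B ω : ℕ∞) : ℝ≥0∞) := fun B hB => by
    simp_rw [coe_count]
    exact measurable_tsum_comp hp (measurable_const.indicator hB)
  have hprob : ∀ a : ℝ≥0, IsProbabilityMeasure ((poissonMeasure a).map fun n : ℕ => (n : ℝ≥0∞)) :=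
    fun a => Measure.isProbabilityMeasure_map hc.aemeasurable
  have hmarg : ∀ {k : ℕ} {B : Fin k → Set (ℝ × ℝ)}, (∀ j, MeasurableSet (B j)) →
      (∀ j, volume (B j) ≠ ∞) → Pairwise (fun i j => Disjoint (B i) (B j)) → ∀ j,
      P.map (fun ω => ((count p (B j) ω : ℕ∞) : ℝ≥0∞))
        = (poissonMeasure (lam * (volume (B j)).toNNReal)).map fun n : ℕ => (n : ℝ≥0∞) := by
    intro k B hB hv hd j
    have h1 := congrArg (fun ν => Measure.map (fun x : Fin k → ℝ≥0∞ => x j) ν)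
      (map_count_of_laplace hp hl hB hv hd)
    simp only [Measure.infinitePi_map_eval] at h1
    rw [← h1, Measure.map_map (measurable_pi_apply j)
      (measurable_pi_lambda _ fun i => hm (B i) (hB i))]
    rfl
  refine ⟨hp, fun B hB hv n => ?_, fun k B hB hv hd => ?_⟩
  · have h1 := hmarg (k := 1) (B := fun _ => B) (fun _ => hB) (fun _ => hv)
      (fun i j hij => absurd (Subsingleton.elim i j) hij) 0
    have h2 := congrArg (fun ν => ν {(n : ℝ≥0∞)}) h1
    simp only [Measure.map_apply (hm B hB) (measurableSet_singleton _),
      Measure.map_apply hc (measurableSet_singleton _)] at h2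
    convert! h2 using 2
    · ext ω
      change count p B ω = n ↔ ((count p B ω : ℕ∞) : ℝ≥0∞) = n
      rw [← ENat.toENNReal_coe n, ENat.toENNReal_inj]
    · ext j
      simp
  · have hind : iIndepFun (fun j ω => ((count p (B j) ω : ℕ∞) : ℝ≥0∞)) P := by
      rw [iIndepFun_iff_map_fun_eq_infinitePi_map fun j => hm (B j) (hB j),
        map_count_of_laplace hp hl hB hv hd]
      simp_rw [hmarg hB hv hd]
    rw [iIndepFun_iff_measure_inter_preimage_eq_mul] at hind ⊢
    intro S s _
    have h1 : ∀ j, count p (B j) ⁻¹' s j = (fun ω => ((count p (B j) ω : ℕ∞) : ℝ≥0∞)) ⁻¹'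
        ((fun n : ℕ∞ => (n : ℝ≥0∞)) '' s j) := by
      intro j
      ext ω
      simp
    simp_rw [h1]
    exact hind S fun j _ => ((s j).to_countable.image _).measurableSet

end Characterization

/-! ### Construction of a Poisson process -/

lemma measurable_sInf_nat {Ω : Type*} [MeasurableSpace Ω] {S : Ω → Set ℕ}
    (hS : ∀ a, MeasurableSet {ω | a ∈ S ω}) : Measurable fun ω => sInf (S ω) := by
  refine measurable_to_countable' fun a => ?_
  -- The empty set has `sInf` zero, which is why the value `0` needs an extra piece.
  have : (fun ω => sInf (S ω)) ⁻¹' {a}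
      = ({ω | a ∈ S ω} ∩ ⋂ b ∈ Finset.range a, {ω | b ∈ S ω}ᶜ) ∪
        if a = 0 then ⋂ b, {ω | b ∈ S ω}ᶜ else ∅ := by
    ext ω
    simp only [Set.mem_preimage, Set.mem_singleton_iff, Set.mem_union, Set.mem_inter_iff,
      Set.mem_iInter, Finset.mem_range, Set.mem_compl_iff]
    constructor
    · intro h
      rcases (S ω).eq_empty_or_nonempty with he | hne
      · right
        rw [he, Nat.sInf_empty] at h
        rw [if_pos h.symm]
        simp [he]
      · left
        rw [← h]
        exact ⟨Nat.sInf_mem hne, fun b hb => Nat.notMem_of_lt_sInf hb⟩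
    · rintro (⟨h1, h2⟩ | h)
      · refine le_antisymm (Nat.sInf_le h1) ?_
        by_contra! hlt
        exact h2 _ hlt (Nat.sInf_mem ⟨a, h1⟩)
      · split_ifs at h with ha
        · have he : S ω = ∅ := by
            ext b
            simpa using Set.mem_iInter.1 h b
          rw [he, Nat.sInf_empty, ha]
        · exact absurd h (Set.notMem_empty _)
  rw [this]
  refine ((hS a).inter (Finset.measurableSet_biInter _ fun b _ => (hS b).compl)).union ?_
  split_ifs
  · exact MeasurableSet.iInter fun b => (hS b).compl
  · exact MeasurableSet.empty

lemma measurable_nth {Ω : Type*} [MeasurableSpace Ω] {q : Ω → ℕ → Prop}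
    (hq : ∀ a, MeasurableSet {ω | q ω a}) (i : ℕ) : Measurable fun ω => Nat.nth (q ω) i := by
  induction i using Nat.strong_induction_on with
  | _ i ih =>
    simp_rw [Nat.nth_eq_sInf _ i]
    refine measurable_sInf_nat fun a => ?_
    have : {ω | a ∈ {x | q ω x ∧ ∀ k < i, Nat.nth (q ω) k < x}}
        = {ω | q ω a} ∩ ⋂ k ∈ Finset.range i, {ω | Nat.nth (q ω) k < a} := by
      ext ω
      simp
    rw [this]
    refine (hq a).inter (Finset.measurableSet_biInter _ fun k hk => ?_)
    exact measurableSet_lt (ih k (Finset.mem_range.1 hk)) measurable_const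

/-- Used to normalize the finite pieces of `lam • volume`; for a vanishing piece any probability
measure will do. -/
lemma exists_probability_smul {E : Type*} [MeasurableSpace E] [Nonempty E] (μ : Measure E)
    [IsFiniteMeasure μ] : ∃ ν : Measure E, IsProbabilityMeasure ν ∧ μ = μ univ • ν := by
  by_cases h : μ = 0
  · obtain ⟨x⟩ := ‹Nonempty E›
    exact ⟨Measure.dirac x, inferInstance, by simp [h]⟩
  · have h' : μ univ ≠ 0 := by simpa using h
    refine ⟨(μ univ)⁻¹ • μ, ⟨?_⟩, ?_⟩
    · rw [Measure.smul_apply, smul_eq_mul, ENNReal.inv_mul_cancel h' (measure_ne_top _ _)]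
    · rw [smul_smul, ENNReal.mul_inv_cancel h' (measure_ne_top _ _), one_smul]

lemma tsum_ite_lt (n : ℕ) (c : ℝ≥0∞) : ∑' j : ℕ, (if j < n then c else 0) = n * c := by
  rw [tsum_eq_sum (s := Finset.range n) fun j hj => if_neg fun h => hj (Finset.mem_range.2 h),
    Finset.sum_congr rfl fun j hj => if_pos (Finset.mem_range.1 hj), Finset.sum_const,
    Finset.card_range, nsmul_eq_mul]

/-- Superposition of Poisson numbers of independent points. -/
theorem lintegral_nexp_superposition (m : ℕ → ℝ≥0) (ν : ℕ → Measure (ℝ × ℝ))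
    [∀ k, IsProbabilityMeasure (ν k)] {f : ℝ × ℝ → ℝ≥0∞} (hf : Measurable f) :
    ∫⁻ ω, nexp (∑' a : ℕ × ℕ, if a.2 < ω.1 a.1 then f (ω.2 a) else 0)
        ∂((Measure.infinitePi fun k => poissonMeasure (m k)).prod
          (Measure.infinitePi fun a : ℕ × ℕ => ν a.1))
      = nexp (∫⁻ x, (1 - nexp (f x)) ∂(Measure.sum fun k => (m k : ℝ≥0∞) • ν k)) := by
  have hact : ∀ a : ℕ × ℕ, MeasurableSet {ω : (ℕ → ℕ) × (ℕ × ℕ → ℝ × ℝ) | a.2 < ω.1 a.1} :=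
    fun a => measurableSet_lt measurable_const (by fun_prop)
  have hm : Measurable fun ω : (ℕ → ℕ) × (ℕ × ℕ → ℝ × ℝ) =>
      nexp (∑' a : ℕ × ℕ, if a.2 < ω.1 a.1 then f (ω.2 a) else 0) :=
    measurable_nexp.comp (Measurable.tsum fun a =>
      Measurable.ite (hact a) (hf.comp (by fun_prop)) measurable_const)
  rw [lintegral_prod _ hm.aemeasurable]
  -- Given the numbers `n k`, the active points are independent, and the `n k` points of piece `k`
  -- contribute equal factors. The Poisson transform then integrates out each `n k`.
  have h1 : ∀ n : ℕ → ℕ, ∫⁻ y, nexp (∑' a : ℕ × ℕ, if a.2 < n a.1 then f (y a) else 0)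
      ∂(Measure.infinitePi fun a : ℕ × ℕ => ν a.1)
      = nexp (∑' k, (n k : ℝ≥0∞) * nlog (∫⁻ x, nexp (f x) ∂(ν k))) := by
    intro n
    refine (lintegral_nexp_tsum_infinitePi (fun a : ℕ × ℕ => ν a.1)
      (f := fun a x => if a.2 < n a.1 then f x else 0)
      fun a => Measurable.ite (MeasurableSet.const _) hf measurable_const).trans ?_
    rw [ENNReal.tsum_prod']
    congr 2
    ext k
    rw [← tsum_ite_lt]
    refine tsum_congr fun j => ?_
    split_ifs with hj
    · rfl
    · simpa using nlog_nexp 0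
  simp_rw [h1]
  rw [lintegral_nexp_tsum_infinitePi (fun k => poissonMeasure (m k))
    (f := fun k (n : ℕ) => (n : ℝ≥0∞) * nlog (∫⁻ x, nexp (f x) ∂(ν k)))
    fun k => measurable_from_top, lintegral_sum_measure]
  congr 2
  ext k
  rw [lintegral_nexp_poissonMeasure, nlog_nexp, nexp_nlog (lintegral_nexp_le_one _ _),
    lintegral_smul_measure, smul_eq_mul, lintegral_sub (by fun_prop)
      ((lintegral_nexp_le_one _ _).trans_lt ENNReal.one_lt_top).ne
      (Eventually.of_forall fun u => nexp_le_one _)]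
  simp

/-- Split `lam • volume` into countably many finite measures, put a Poisson number of independent
points on each, and superpose. Points are then enumerated by `ℕ` without gaps, which requires
infinitely many of them. -/
theorem exists_isPoissonProcess {lam : ℝ≥0} (hlam : 0 < lam) :
    ∃ (Ω : Type) (_ : MeasurableSpace Ω) (P : Measure Ω) (_ : IsProbabilityMeasure P)
      (p : ℕ → Ω → ℝ × ℝ), IsPoissonProcess P lam p := by
  let Λ : Measure (ℝ × ℝ) := lam • volume
  choose ν hν hνΛ using fun k => exists_probability_smul (sfiniteSeq Λ k)
  let m : ℕ → ℝ≥0 := fun k => (sfiniteSeq Λ k univ).toNNReal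
  have hsum : Measure.sum (fun k => (m k : ℝ≥0∞) • ν k) = Λ := by
    conv_rhs => rw [← sum_sfiniteSeq Λ]
    congr 1
    ext1 k
    rw [ENNReal.coe_toNNReal (measure_ne_top _ _), ← hνΛ k]
  let P : Measure ((ℕ → ℕ) × (ℕ × ℕ → ℝ × ℝ)) :=
    (Measure.infinitePi fun k => poissonMeasure (m k)).prod
      (Measure.infinitePi fun a : ℕ × ℕ => ν a.1)
  let act : (ℕ → ℕ) × (ℕ × ℕ → ℝ × ℝ) → ℕ → Prop := fun ω a => (Nat.unpair a).2 < ω.1 (Nat.unpair a).1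
  have hact : ∀ a, MeasurableSet {ω | act ω a} :=
    fun a => measurableSet_lt measurable_const (by fun_prop)
  let p : ℕ → (ℕ → ℕ) × (ℕ × ℕ → ℝ × ℝ) → ℝ × ℝ := fun i ω =>
    ω.2 (Nat.unpair (Nat.nth (act ω) i))
  have hp : ∀ i, Measurable (p i) := fun i => by
    have h1 : Measurable fun y : ((ℕ → ℕ) × (ℕ × ℕ → ℝ × ℝ)) × ℕ => y.1.2 (Nat.unpair y.2) :=
      measurable_from_prod_countable_left fun a =>
        (measurable_pi_apply (Nat.unpair a)).comp measurable_snd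
    exact h1.comp (measurable_id.prodMk (measurable_nth hact i))
  have hreidx : ∀ (f : ℝ × ℝ → ℝ≥0∞) (ω : (ℕ → ℕ) × (ℕ × ℕ → ℝ × ℝ)),
      ∑' a : ℕ × ℕ, (if a.2 < ω.1 a.1 then f (ω.2 a) else 0)
        = ∑' a : ℕ, {a | act ω a}.indicator (fun a => f (ω.2 (Nat.unpair a))) a := by
    intro f ω
    rw [← Equiv.tsum_eq Nat.pairEquiv.symm]
    refine tsum_congr fun a => ?_
    rw [Set.indicator_apply]
    rfl
  have hlap : ∀ f : ℝ × ℝ → ℝ≥0∞, Measurable f →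
      ∫⁻ ω, nexp (∑' a : ℕ, {a | act ω a}.indicator (fun a => f (ω.2 (Nat.unpair a))) a) ∂P
        = nexp (lam * ∫⁻ x, (1 - nexp (f x))) := by
    intro f hf
    simp_rw [← hreidx]
    refine (lintegral_nexp_superposition m ν hf).trans ?_
    rw [hsum]
    simp only [Λ]
    rw [lintegral_smul_measure]
    rfl
  -- The Laplace functional at the constant one is `nexp ∞ = 0`, since the plane has infinite area;
  -- hence the number of active points is almost surely infinite.
  have hinf : ∀ᵐ ω ∂P, {a | act ω a}.Infinite := by
    have h1 := hlap (fun _ => 1) measurable_const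
    have h2 : nexp (lam * ∫⁻ _ : ℝ × ℝ, (1 - nexp 1)) = 0 := by
      have hne : 1 - nexp 1 ≠ 0 := by
        have h0 := nexp_strictAnti zero_lt_one
        rw [nexp_zero] at h0
        exact (tsub_pos_of_lt h0).ne'
      have hl : (lam : ℝ≥0∞) ≠ 0 := by simpa using hlam.ne'
      have hvol : (volume : Measure (ℝ × ℝ)) univ = ∞ := measure_univ_of_isAddLeftInvariant _
      rw [lintegral_const, hvol, ENNReal.mul_top hne, ENNReal.mul_top hl, nexp_top]
    have hmeas : Measurable fun ω : (ℕ → ℕ) × (ℕ × ℕ → ℝ × ℝ) =>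
        nexp (∑' a : ℕ, {a | act ω a}.indicator (fun _ => 1) a) :=
      measurable_nexp.comp (Measurable.tsum fun a =>
        measurable_const.indicator (s := {ω | act ω a}) (hact a))
    rw [h2, lintegral_eq_zero_iff hmeas] at h1
    filter_upwards [h1] with ω hω
    have h3 : ∑' a : ℕ, {a | act ω a}.indicator (fun _ => (1 : ℝ≥0∞)) a = ∞ :=
      nexp_injective (by rw [nexp_top]; exact hω)
    rw [← coe_encard_eq_tsum] at h3
    exact Set.encard_eq_top_iff.1 (by simpa using h3)
  refine ⟨(ℕ → ℕ) × (ℕ × ℕ → ℝ × ℝ), inferInstance, P, inferInstance, p,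
    isPoissonProcess_of_laplace hp fun f hf => ?_⟩
  rw [← hlap f hf]
  refine lintegral_congr_ae ?_
  filter_upwards [hinf] with ω hω
  congr 1
  rw [← (Nat.nth_injective hω).tsum_eq
    (f := {a | act ω a}.indicator fun a => f (ω.2 (Nat.unpair a)))]
  · refine tsum_congr fun i => ?_
    rw [Set.indicator_of_mem (show Nat.nth (act ω) i ∈ {a | act ω a} from
      Nat.nth_mem_of_infinite hω i)]
  · rw [Nat.range_nth_of_infinite hω]
    intro a ha
    by_contra hcon
    exact ha (Set.indicator_of_notMem hcon _)

/-- The product of a Poisson process with an independent i.i.d. sequence of marks. Passing through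
`Real.toNNReal` keeps the Pareto law because it charges only numbers at least `xm`. -/
theorem exists_isParetoField {lam : ℝ≥0} (hlam : 0 < lam) {xm α : ℝ} (hxm : 0 < xm) (hα : 1 < α) :
    ∃ (Ω : Type) (_ : MeasurableSpace Ω) (P : Measure Ω) (_ : IsProbabilityMeasure P)
      (p : ℕ → Ω → ℝ × ℝ) (r : ℕ → Ω → ℝ≥0), IsParetoField P lam xm α p r := by
  obtain ⟨Ω, _, P, _, p, hp⟩ := exists_isPoissonProcess hlam
  have := isProbabilityMeasure_paretoMeasure hxm (by linarith : 0 < α)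
  have hpr : IsProbabilityMeasure (markLaw xm α) :=
    Measure.isProbabilityMeasure_map measurable_real_toNNReal.aemeasurable
  let Q : Measure (ℕ → ℝ≥0) := Measure.infinitePi fun _ => markLaw xm α
  have hsnd : (P.prod Q).map Prod.snd = Q := measurePreserving_snd.map_eq
  have hmark : ∀ i, (P.prod Q).map (fun ω => ω.2 i) = markLaw xm α := by
    intro i
    have h1 : (P.prod Q).map (fun ω => ω.2 i) = Q.map fun m => m i := by
      conv_rhs => rw [← hsnd, Measure.map_map (measurable_pi_apply i) measurable_snd]
      rfl
    rw [h1, Measure.infinitePi_map_eval]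
  refine ⟨Ω × (ℕ → ℝ≥0), inferInstance, P.prod Q, inferInstance, fun i ω => p i ω.1,
    fun i ω => ω.2 i, ?_, fun i => by fun_prop, fun i => ?_, ?_, ?_⟩
  · refine isPoissonProcess_of_laplace (fun i => (hp.measurable i).comp measurable_fst) fun f hf => ?_
    rw [← hp.lintegral_nexp_tsum hf]
    have hm : Measurable fun ω => nexp (∑' i, f (p i ω)) :=
      measurable_nexp.comp (measurable_tsum_comp hp.measurable hf)
    have hfst : (P.prod Q).map Prod.fst = P := measurePreserving_fst.map_eq
    conv_rhs => rw [← hfst, lintegral_map hm measurable_fst]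
  · have h1 : (P.prod Q).map (fun ω => (ω.2 i : ℝ)) = (markLaw xm α).map fun u : ℝ≥0 => (u : ℝ) := by
      rw [← hmark i, Measure.map_map measurable_coe_nnreal_real (by fun_prop)]
      rfl
    rw [h1, markLaw, Measure.map_map measurable_coe_nnreal_real measurable_real_toNNReal]
    have h2 : ((fun u : ℝ≥0 => (u : ℝ)) ∘ Real.toNNReal) =ᵐ[paretoMeasure xm α] id := by
      have hd : Measurable (paretoPDF xm α) := (measurable_paretoPDFReal xm α).ennreal_ofReal
      rw [Filter.EventuallyEq, paretoMeasure, ae_withDensity_iff hd]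
      refine Eventually.of_forall fun x hx => ?_
      have hx' : xm ≤ x := by
        by_contra! hlt
        exact hx (paretoPDF_of_lt hlt)
      exact Real.coe_toNNReal x (hxm.le.trans hx')
    rw [Measure.map_congr h2, Measure.map_id]
  · rw [iIndepFun_iff_map_fun_eq_infinitePi_map fun i => by fun_prop]
    simp_rw [hmark]
    exact hsnd
  · exact indepFun_prod (X := fun ω i => p i ω) (Y := fun m : ℕ → ℝ≥0 => fun i => m i)
      (measurable_pi_lambda _ hp.measurable) (by fun_prop)

section RecedingHorizon

variable {Ω : Type*} [MeasurableSpace Ω] {P : Measure Ω} {lam : ℝ≥0} {xm α v S : ℝ}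
  {p : ℕ → Ω → ℝ × ℝ} {r : ℕ → Ω → ℝ≥0} {X : ℕ → Ω → ℝ → ℝ × ℝ}

/-! ### One iteration of the receding-horizon algorithm -/

lemma IsRecedingHorizon.startState_fst (hX : IsRecedingHorizon P p r v S X) (hv : 0 < v)
    (hS : 0 < S) (k : ℕ) (ω : Ω) : (startState v S X ω k).1 = k * S := by
  induction k with
  | zero => simp [startState]
  | succ k ih =>
    change (X k ω (S / v)).1 = _
    rw [(hX.feasible k ω).fst ⟨by positivity, le_rfl⟩, ih, mul_div_cancel₀ _ hv.ne']
    push_cast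
    ring

lemma IsRecedingHorizon.measurable_startState (hX : IsRecedingHorizon P p r v S X) (hv : 0 < v)
    (hS : 0 < S) (k : ℕ) :
    Measurable[sensed p r (k * S)] fun ω => startState v S X ω k := by
  cases k with
  | zero => exact measurable_const
  | succ k =>
    rw [Nat.cast_succ]
    exact hX.adapted k (S / v) ⟨by positivity, le_rfl⟩

/-- Replaces the reward of the chosen trajectory by a visibly measurable quantity, whatever the rule
for ties. -/
lemma IsRecedingHorizon.collected_ae_eq (hX : IsRecedingHorizon P p r v S X) (hv : 0 < v) (k : ℕ) :
    (fun ω => collected (fun i => p i ω) (fun i => r i ω) (S / v) (X k ω)) =ᵐ[P]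
      fun ω => best (startState v S X ω k) S (fun i => p i ω) (fun i => r i ω) := by
  filter_upwards [hX.optimal] with ω hω
  exact le_antisymm (collected_le_best hv (hX.feasible k ω) _ _)
    (best_le_of_forall_collected_le hv fun x hx => hω k x hx)

lemma IsParetoField.measurable_best_startState (h : IsParetoField P lam xm α p r)
    (hX : IsRecedingHorizon P p r v S X) (hv : 0 < v) (hS : 0 < S) (k : ℕ) :
    Measurable fun ω => best (startState v S X ω k) S (fun i => p i ω) (fun i => r i ω) :=
  measurable_best ((hX.measurable_startState hv hS k).mono (h.sensed_le _) le_rfl) S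
    h.poisson.measurable h.measurable

/-- The expected reward of an iteration is at most the optimal one for twice the horizon. -/
theorem IsParetoField.lintegral_collected_le [IsProbabilityMeasure P]
    (h : IsParetoField P lam xm α p r) (hxm : 0 < xm) (hα : 1 < α)
    (hX : IsRecedingHorizon P p r v S X) (hv : 0 < v) (hS : 0 < S) (k : ℕ) :
    ∫⁻ ω, collected (fun i => p i ω) (fun i => r i ω) (S / v) (X k ω) ∂P
      ≤ ∫⁻ ω, best 0 (2 * S) (fun i => p i ω) (fun i => r i ω) ∂P := by
  set a : ℝ := k * S with ha
  -- Targets exactly on the starting line belong both to the sensed region and to the present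
  -- iteration; almost surely there are none.
  have hline : ∀ᵐ ω ∂P, ∀ i, p i ω ∉ ({a} ×ˢ univ : Set (ℝ × ℝ)) := by
    refine h.poisson.ae_notMem_of_volume_eq_zero ((measurableSet_singleton a).prod .univ) ?_
    rw [Measure.volume_eq_prod, Measure.prod_prod, Real.volume_singleton, zero_mul]
  -- Rounding the lateral position to multiples of `S` splits the space into countably many sensed
  -- events, on each of which a deterministic start can be used.
  let A : ℤ → Set Ω := fun z => {ω | ⌊(startState v S X ω k).2 / S⌋ = z}
  have hA : ∀ z, MeasurableSet[sensed p r a] (A z) := by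
    intro z
    have h1 : Measurable fun y : ℝ × ℝ => ⌊y.2 / S⌋ := by fun_prop
    exact h1.comp (hX.measurable_startState hv hS k) (measurableSet_singleton z)
  have hA' : ∀ z, MeasurableSet (A z) := fun z => h.sensed_le a _ (hA z)
  -- From the grid point a distance `S` behind, the true start is reachable, as the lateral error is
  -- at most `S`; hence the horizon `2 * S`. Only targets strictly ahead of `a` are counted, to keep
  -- independence of the sensed ones.
  let g : ℤ → Ω → ℝ≥0∞ := fun z ω => best (a - S, z * S) (2 * S) (fun i => p i ω)
    (fun i => if a < (p i ω).1 then r i ω else 0)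
  have hg : ∀ z, Measurable (g z) := fun z =>
    measurable_best measurable_const _ h.poisson.measurable fun i => Measurable.ite
      (measurableSet_lt measurable_const (h.poisson.measurable i).fst) (h.measurable i)
      measurable_const
  have hpt : ∀ᵐ ω ∂P, collected (fun i => p i ω) (fun i => r i ω) (S / v) (X k ω)
      ≤ ∑' z, (A z).indicator (g z) ω := by
    filter_upwards [hline] with ω hω
    have hfst : (startState v S X ω k).1 = a := hX.startState_fst hv hS k ω
    set σ := (startState v S X ω k).2 with hσ
    refine (collected_le_best hv (hX.feasible k ω) _ _).trans ?_
    refine le_trans ?_ (ENNReal.le_tsum ⌊σ / S⌋)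
    rw [Set.indicator_of_mem (show ω ∈ A ⌊σ / S⌋ from rfl)]
    have h1 := (le_div_iff₀ hS).1 (Int.floor_le (σ / S))
    have h2 := (div_lt_iff₀ hS).1 (Int.lt_floor_add_one (σ / S))
    refine le_trans (le_of_eq (best_congr fun i hi1 _ => ?_))
      (best_le_best_of_start (ℓ := S) (z := startState v S X ω k) ?_ ?_ _ _)
    · rw [hfst] at hi1
      have h3 : a ≤ (p i ω).1 := by
        have := (abs_nonneg _).trans hi1
        linarith
      have h4 : a ≠ (p i ω).1 := fun he => hω i ⟨he.symm, trivial⟩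
      rw [if_pos (lt_of_le_of_ne h3 h4)]
    · rw [hfst, ← hσ, abs_le]
      constructor <;> simp only <;> linarith
    · rw [hfst]
      simp only
      linarith
  calc ∫⁻ ω, collected (fun i => p i ω) (fun i => r i ω) (S / v) (X k ω) ∂P
      ≤ ∫⁻ ω, ∑' z, (A z).indicator (g z) ω ∂P := lintegral_mono_ae hpt
    _ = ∑' z, ∫⁻ ω in A z, g z ω ∂P := by
        rw [lintegral_tsum fun z => ((hg z).indicator (hA' z)).aemeasurable]
        exact tsum_congr fun z => lintegral_indicator (hA' z) _
    _ ≤ ∑' z, P (A z) * ∫⁻ ω, best 0 (2 * S) (fun i => p i ω) (fun i => r i ω) ∂P :=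
        ENNReal.tsum_le_tsum fun z => h.setLIntegral_best_le hxm hα a (hA z) _ _
    _ = (∑' z, P (A z)) * ∫⁻ ω, best 0 (2 * S) (fun i => p i ω) (fun i => r i ω) ∂P :=
        ENNReal.tsum_mul_right
    _ ≤ 1 * ∫⁻ ω, best 0 (2 * S) (fun i => p i ω) (fun i => r i ω) ∂P := by
        gcongr
        have hd : Pairwise (Function.onFun Disjoint A) := by
          intro z w hzw
          refine Set.disjoint_left.2 fun ω h1 h2 => hzw ?_
          exact Eq.trans (Eq.symm h1) h2
        rw [← measure_iUnion hd hA']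
        exact prob_le_one
    _ = ∫⁻ ω, best 0 (2 * S) (fun i => p i ω) (fun i => r i ω) ∂P := one_mul _

end RecedingHorizon

section Limit

variable {Ω : Type*} [MeasurableSpace Ω] {P : Measure Ω} {lam : ℝ≥0} {xm α : ℝ}
  {p : ℕ → Ω → ℝ × ℝ} {r : ℕ → Ω → ℝ≥0}

/-! ### The growth of the expected optimal reward -/

/-- The rectangle `D` lies in the cone reachable from the origin, so each single target in `D` can
be collected. A zero optimum would force a zero total in `D`, against Campbell's formula and rewards
at least `xm`. -/
lemma IsParetoField.lintegral_best_pos [IsProbabilityMeasure P] (h : IsParetoField P lam xm α p r)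
    (hlam : 0 < lam) (hxm : 0 < xm) :
    0 < ∫⁻ ω, best 0 1 (fun i => p i ω) (fun i => r i ω) ∂P := by
  have := h.isProbabilityMeasure_markLaw
  rw [pos_iff_ne_zero]
  intro h0
  rw [lintegral_eq_zero_iff (measurable_best measurable_const 1 h.poisson.measurable
    h.measurable)] at h0
  set D : Set (ℝ × ℝ) := Ioo (1 / 2) 1 ×ˢ Ioo (-(1 / 2)) (1 / 2) with hD
  have hDm : MeasurableSet D := measurableSet_Ioo.prod measurableSet_Ioo
  have hvol : volume D = ENNReal.ofReal (1 / 2) := by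
    rw [hD, Measure.volume_eq_prod, Measure.prod_prod, Real.volume_Ioo, Real.volume_Ioo,
      ← ENNReal.ofReal_mul (by norm_num)]
    norm_num
  have h1 := h.lintegral_tsum_mul hDm (by rw [hvol]; exact ENNReal.ofReal_ne_top)
    measurable_coe_nnreal_ennreal
  have h2 : ∫⁻ ω, ∑' i, D.indicator (fun _ => 1) (p i ω) * (r i ω : ℝ≥0∞) ∂P = 0 := by
    rw [← lintegral_zero (μ := P)]
    refine lintegral_congr_ae ?_
    filter_upwards [h0] with ω hω
    refine ENNReal.tsum_eq_zero.2 fun i => ?_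
    by_cases hi : p i ω ∈ D
    · have hc : IsCausal 0 1 (fun i => p i ω) {i} := by
        obtain ⟨⟨a1, a2⟩, a3, a4⟩ := hi
        refine ⟨fun j hj => ?_, fun j hj k hk => ?_⟩
        · rw [Finset.mem_singleton.1 hj]
          simp only [Prod.snd_zero, Prod.fst_zero, sub_zero]
          exact ⟨abs_le.2 ⟨by linarith, by linarith⟩, a2.le⟩
        · rw [Finset.mem_singleton.1 hj, Finset.mem_singleton.1 hk]
          simp
      have h3 : (r i ω : ℝ≥0∞) ≤ best 0 1 (fun i => p i ω) (fun i => r i ω) :=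
        le_iSup₂_of_le {i} hc (by simp)
      rw [hω] at h3
      simp only [Pi.zero_apply, nonpos_iff_eq_zero] at h3
      rw [h3, mul_zero]
    · rw [Set.indicator_of_notMem hi, zero_mul]
  rw [h2, hvol] at h1
  have h4 : ∫⁻ u, (u : ℝ≥0∞) ∂(markLaw xm α) = 0 := by
    have hl : (lam : ℝ≥0∞) * ENNReal.ofReal (1 / 2) ≠ 0 := by simp [hlam.ne']
    exact (mul_eq_zero.1 h1.symm).resolve_left hl
  rw [lintegral_eq_zero_iff measurable_coe_nnreal_ennreal] at h4
  obtain ⟨u, hu, hu'⟩ := (h4.and (ae_markLaw_le (xm := xm) (α := α))).exists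
  have : u = 0 := by simpa using hu
  rw [this] at hu'
  exact absurd hu' (not_le.2 hxm)

/-- The expected optimal reward is asymptotically proportional to `L ^ (2 / α)`. -/
theorem IsParetoField.exists_tendsto_lintegral_best [IsProbabilityMeasure P]
    (h : IsParetoField P lam xm α p r) (hlam : 0 < lam) (hxm : 0 < xm)
    (hα : α ∈ Set.Ioo (1 : ℝ) 2) :
    ∃ c : ℝ, 0 < c ∧ Tendsto (fun L : ℝ =>
      (∫⁻ ω, best 0 L (fun i => p i ω) (fun i => r i ω) ∂P).toReal / L ^ (2 / α)) atTop (𝓝 c) := by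
  obtain ⟨C, hC0, hC⟩ := h.exists_lintegral_best_le hxm hα
  set G : ℝ → ℝ≥0∞ := fun L => ∫⁻ ω, best 0 L (fun i => p i ω) (fun i => r i ω) ∂P with hG
  have hfin : ∀ L, 0 < L → G L ≠ ∞ := fun L hL => ((hC L hL).trans_lt ENNReal.ofReal_lt_top).ne
  have hbdd : ∀ L, 0 < L → (G L).toReal / L ^ (2 / α) ≤ C := by
    intro L hL
    rw [div_le_iff₀ (by positivity)]
    exact ENNReal.toReal_le_of_le_ofReal (by positivity) (hC L hL)
  -- This is the scaling inequality with `c = L / L'`.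
  have hmono : ∀ L L', 0 < L → L ≤ L' →
      (G L).toReal / L ^ (2 / α) ≤ (G L').toReal / L' ^ (2 / α) := by
    intro L L' hL hLL'
    have hL' : 0 < L' := hL.trans_le hLL'
    have h1 := h.lintegral_best_scale hxm hα.1 L' (div_pos hL hL') ((div_le_one hL').2 hLL')
    rw [div_mul_cancel₀ _ hL'.ne'] at h1
    have h2 := ENNReal.toReal_mono (ENNReal.mul_ne_top ENNReal.ofReal_ne_top (hfin L' hL')) h1
    rw [ENNReal.toReal_mul, ENNReal.toReal_ofReal (by positivity), Real.div_rpow hL.le hL'.le] at h2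
    rw [div_le_iff₀ (by positivity)]
    refine h2.trans (le_of_eq ?_)
    ring
  -- Freezing the quotient below `1` makes it monotone and bounded on all of `ℝ`, so that it tends
  -- to its supremum, positive by the value at `1`.
  set g : ℝ → ℝ := fun L => (G (max L 1)).toReal / (max L 1) ^ (2 / α) with hg
  have hgm : Monotone g := fun L L' hLL' =>
    hmono _ _ (lt_max_of_lt_right one_pos) (max_le_max_right 1 hLL')
  have hgb : BddAbove (Set.range g) := ⟨C, by
    rintro _ ⟨L, rfl⟩
    exact hbdd _ (lt_max_of_lt_right one_pos)⟩
  refine ⟨⨆ L, g L, ?_, ?_⟩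
  · refine lt_of_lt_of_le ?_ (le_ciSup hgb 1)
    have h1 : 0 < (G 1).toReal :=
      ENNReal.toReal_pos (h.lintegral_best_pos hlam hxm).ne' (hfin 1 one_pos)
    simpa [hg] using h1
  · refine (tendsto_atTop_ciSup hgm hgb).congr' ?_
    filter_upwards [eventually_ge_atTop 1] with L hL
    simp only [hg, hG, max_eq_left hL]

end Limit

end MaxReward

/-! ### The asymptotic gap between the optimal and the receding-horizon reward -/

theorem mainTheorem5 (lam : ℝ≥0) (hlam : 0 < lam) (v : ℝ) (hv : 0 < v)
    (xm : ℝ) (hxm : 0 < xm) (α : ℝ) (hα : α ∈ Set.Ioo (1 : ℝ) 2) :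
    (∃ (Ω : Type) (_ : MeasurableSpace Ω) (P : Measure Ω) (_ : IsProbabilityMeasure P)
      (p : ℕ → Ω → ℝ × ℝ) (r : ℕ → Ω → ℝ≥0), MaxReward.IsParetoField P lam xm α p r) ∧
    ∃ c : ℝ, 0 < c ∧
      ∀ (Ω : Type*) [MeasurableSpace Ω] (P : Measure Ω) [IsProbabilityMeasure P]
        (p : ℕ → Ω → ℝ × ℝ) (r : ℕ → Ω → ℝ≥0), MaxReward.IsParetoField P lam xm α p r →
      ∀ S : ℝ → ℝ, (∀ L, 0 < L → 0 < S L) → Tendsto (fun L => S L / L) atTop (𝓝 0) →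
      ∀ X : ℝ → ℕ → Ω → ℝ → ℝ × ℝ,
        (∀ L, 0 < L → MaxReward.IsRecedingHorizon P p r v (S L) (X L)) →
        (∀ L, 0 < L →
          AEMeasurable (MaxReward.optimalMean p r v L) P ∧
          ∫⁻ ω, MaxReward.optimalMean p r v L ω ∂P ≠ ∞ ∧
          AEMeasurable (MaxReward.iterativeMean p r v (S L) (X L) L) P ∧
          ∫⁻ ω, MaxReward.iterativeMean p r v (S L) (X L) L ω ∂P ≠ ∞) ∧
        Tendsto (fun L : ℝ =>
          ((∫⁻ ω, MaxReward.optimalMean p r v L ω ∂P).toReal -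
            (∫⁻ ω, MaxReward.iterativeMean p r v (S L) (X L) L ω ∂P).toReal) /
              L ^ (2 / α - 1))
          atTop (𝓝 c) := by
  obtain ⟨Ω₀, _, P₀, _, p₀, r₀, h₀⟩ := MaxReward.exists_isParetoField hlam hxm hα.1
  refine ⟨⟨Ω₀, inferInstance, P₀, inferInstance, p₀, r₀, h₀⟩, ?_⟩
  -- The constant is read off from one fixed field, and `lintegral_best_eq` transfers it to every
  -- other; this puts `c` before the quantification over probability spaces.
  obtain ⟨c, hc, hlim⟩ := h₀.exists_tendsto_lintegral_best hlam hxm hα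
  refine ⟨c, hc, ?_⟩
  intro Ω _ P _ p r h S hS hSL X hX
  set G : ℝ → ℝ≥0∞ := fun L => ∫⁻ ω, MaxReward.best 0 L (fun i => p i ω) (fun i => r i ω) ∂P with hG
  have hlimG : Tendsto (fun L : ℝ => (G L).toReal / L ^ (2 / α)) atTop (𝓝 c) :=
    hlim.congr fun L => by rw [h₀.lintegral_best_eq hxm hα.1 h L]
  obtain ⟨C, hC0, hC⟩ := h.exists_lintegral_best_le hxm hα
  have hfin : ∀ L, 0 < L → G L ≠ ∞ := fun L hL => ((hC L hL).trans_lt ENNReal.ofReal_lt_top).ne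
  have hbest : ∀ L, Measurable fun ω => MaxReward.best 0 L (fun i => p i ω) (fun i => r i ω) :=
    fun L => MaxReward.measurable_best measurable_const L h.poisson.measurable h.measurable
  have hopt : ∀ L, MaxReward.optimalMean p r v L
      = fun ω => MaxReward.best 0 L (fun i => p i ω) (fun i => r i ω) * (ENNReal.ofReal L)⁻¹ := by
    intro L
    ext ω
    rw [MaxReward.optimalMean, MaxReward.optimalTotal_eq_best hv, div_eq_mul_inv]
  have hoptE : ∀ L, ∫⁻ ω, MaxReward.optimalMean p r v L ω ∂P = G L * (ENNReal.ofReal L)⁻¹ := by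
    intro L
    rw [hopt, lintegral_mul_const _ (hbest L)]
  have hcolm : ∀ L, 0 < L → ∀ k, AEMeasurable (fun ω => MaxReward.collected (fun i => p i ω)
      (fun i => r i ω) (S L / v) (X L k ω)) P := fun L hL k =>
    (h.measurable_best_startState (hX L hL) hv (hS L hL) k).aemeasurable.congr
      ((hX L hL).collected_ae_eq hv k).symm
  have hsumm : ∀ L, 0 < L → AEMeasurable (fun ω => ∑ k ∈ Finset.range ⌈L / S L⌉₊,
      MaxReward.collected (fun i => p i ω) (fun i => r i ω) (S L / v) (X L k ω)) P := fun L hL =>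
    Finset.aemeasurable_fun_sum _ fun k _ => hcolm L hL k
  have hiterE : ∀ L, 0 < L → ∫⁻ ω, MaxReward.iterativeMean p r v (S L) (X L) L ω ∂P
      ≤ ⌈L / S L⌉₊ * G (2 * S L) * (ENNReal.ofReal L)⁻¹ := by
    intro L hL
    simp only [MaxReward.iterativeMean, div_eq_mul_inv (b := ENNReal.ofReal L)]
    rw [lintegral_mul_const'' _ (hsumm L hL), lintegral_finsetSum' _ fun k _ => hcolm L hL k]
    gcongr
    refine (Finset.sum_le_sum fun k _ =>
      h.lintegral_collected_le hxm hα.1 (hX L hL) hv (hS L hL) k).trans ?_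
    rw [Finset.sum_const, Finset.card_range, nsmul_eq_mul]
  have hinv : ∀ L, 0 < L → (ENNReal.ofReal L)⁻¹ ≠ ∞ := fun L hL =>
    ENNReal.inv_ne_top.2 (ENNReal.ofReal_pos.2 hL).ne'
  have hub : ∀ L, 0 < L → ⌈L / S L⌉₊ * G (2 * S L) * (ENNReal.ofReal L)⁻¹ ≠ ∞ := fun L hL =>
    ENNReal.mul_ne_top (ENNReal.mul_ne_top (ENNReal.natCast_ne_top _)
      (hfin _ (mul_pos two_pos (hS L hL)))) (hinv L hL)
  refine ⟨fun L hL => ⟨?_, ?_, ?_, ?_⟩, ?_⟩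
  · rw [hopt]
    exact ((hbest L).mul_const _).aemeasurable
  · rw [hoptE]
    exact ENNReal.mul_ne_top (hfin L hL) (hinv L hL)
  · exact (hsumm L hL).div_const _
  · exact ((hiterE L hL).trans_lt (hub L hL).lt_top).ne
  · set β : ℝ := 2 / α with hβ
    have hβ1 : 0 < β - 1 := by
      rw [hβ, sub_pos, lt_div_iff₀ (by linarith [hα.1])]
      linarith [hα.2]
    have hopt_real : ∀ L, 0 < L →
        (∫⁻ ω, MaxReward.optimalMean p r v L ω ∂P).toReal / L ^ (β - 1)
          = (G L).toReal / L ^ β := by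
      intro L hL
      rw [hoptE, ENNReal.toReal_mul, ENNReal.toReal_inv, ENNReal.toReal_ofReal hL.le,
        Real.rpow_sub hL, Real.rpow_one]
      field_simp
    -- Insert `G(2 S) ≤ C * (2 * S) ^ β` and `⌈L / S⌉ ≤ L / S + 1`. The second power of `S / L` is
    -- the cost of the rounding up; both exponents are positive because `α < 2`.
    have hiter_real : ∀ L, 0 < L →
        (∫⁻ ω, MaxReward.iterativeMean p r v (S L) (X L) L ω ∂P).toReal / L ^ (β - 1)
          ≤ C * 2 ^ β * ((S L / L) ^ (β - 1) + (S L / L) ^ β) := by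
      intro L hL
      have hSp := hS L hL
      have h1 := ENNReal.toReal_mono (hub L hL) (hiterE L hL)
      rw [ENNReal.toReal_mul, ENNReal.toReal_mul, ENNReal.toReal_inv, ENNReal.toReal_ofReal hL.le,
        ENNReal.toReal_natCast] at h1
      have h2 : (G (2 * S L)).toReal ≤ C * (2 * S L) ^ β :=
        ENNReal.toReal_le_of_le_ofReal (by positivity) (hC _ (by positivity))
      have h3 : (⌈L / S L⌉₊ : ℝ) ≤ L / S L + 1 := (Nat.ceil_lt_add_one (by positivity)).le
      calc (∫⁻ ω, MaxReward.iterativeMean p r v (S L) (X L) L ω ∂P).toReal / L ^ (β - 1)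
          ≤ ((L / S L + 1) * (C * (2 * S L) ^ β) * L⁻¹) / L ^ (β - 1) := by
            gcongr
            refine h1.trans ?_
            gcongr
        _ = C * 2 ^ β * ((S L / L) ^ (β - 1) + (S L / L) ^ β) := by
            rw [Real.rpow_sub hL, Real.rpow_one, Real.rpow_sub (div_pos hSp hL), Real.rpow_one,
              Real.div_rpow hSp.le hL.le, Real.mul_rpow two_pos.le hSp.le]
            field_simp
    have hzero : Tendsto (fun L : ℝ =>
        (∫⁻ ω, MaxReward.iterativeMean p r v (S L) (X L) L ω ∂P).toReal / L ^ (β - 1))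
        atTop (𝓝 0) := by
      have hpow : ∀ e : ℝ, 0 < e → Tendsto (fun L => (S L / L) ^ e) atTop (𝓝 0) := by
        intro e he
        have := hSL.rpow_const (p := e) (Or.inr he.le)
        rwa [Real.zero_rpow he.ne'] at this
      have hup : Tendsto (fun L => C * 2 ^ β * ((S L / L) ^ (β - 1) + (S L / L) ^ β))
          atTop (𝓝 0) := by
        have := ((hpow (β - 1) hβ1).add (hpow β (by linarith))).const_mul (C * 2 ^ β)
        simpa using this
      refine tendsto_of_tendsto_of_tendsto_of_le_of_le' tendsto_const_nhds hup ?_ ?_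
      · filter_upwards [eventually_gt_atTop 0] with L hL
        positivity
      · filter_upwards [eventually_gt_atTop 0] with L hL using hiter_real L hL
    have hfinal := hlimG.sub hzero
    rw [sub_zero] at hfinal
    refine hfinal.congr' ?_
    filter_upwards [eventually_gt_atTop 0] with L hL
    rw [sub_div, hopt_real L hL]
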